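/- Let $1<p<\infty$, let $H$ be a complex Hilbert space, and let $S^p(H)$ be the Schatten class of all bounded operators $A$ on $H$ with $\|A\|_p=\mathrm{Tr}(|A|^p)^{1/p}<\infty$, with the norm $\|\cdot\|_p$. A bounded linear map $T:S^p(H)\to S^p(H)$ is called completely bounded if for every Hilbert space $K$ the map $\mathrm{id}\otimes T$ on the algebraic tensor product $S^p(K)\otimes S^p(H)\subset S^p(K\otimes_2 H)$ extends to a bounded map on $S^p(K\otimes_2 H)$ (again denoted $\mathrm{id}\otimes T$); its completely bounded norm $\|T\|_{cb}$ is the supremum over all $K$ of the norms of these extensions. Let $CB(S^p(H),S^p(H))$ be the space of completely bounded maps; it contains all bounded finite rank operators on $S^p(H)$. The stable point-norm topology $\mathcal T_n$ on $CB(S^p(H),S^p(H))$ is the locally convex topology defined by the seminorms $$T\mapsto \sup_{i\ge 0}\,\|(\mathrm{id}\otimes T)(x_i)\|_{S^p(\ell^2\otimes_2 H)},$$ where $(x_i)_{i\ge0}$ ranges over all sequences in $S^p(\ell^2\otimes_2 H)$ that converge to $0$ in norm. **Theorem 3.10.** Let $F_0$ be a linear subspace of the space of bounded finite rank operators on $S^p(H)$.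 If $\mathrm{id}_{S^p(H)}$ belongs to the $\mathcal T_n$-closure of $F_0$, then $\mathrm{id}_{S^p(H)}$ belongs to the $\mathcal T_n$-closure of $\{T\in F_0 : \|T\|_{cb}\le 1\}$. -/

import Mathlib

open scoped ComplexOrder InnerProductSpace ENNReal Topology TensorProduct

namespace Schatten

section Definitions

variable {H : Type*} [NormedAddCommGroup H] [InnerProductSpace ℂ H] [CompleteSpace H]

/-- The trace `∑ᵢ ⟪bᵢ, B bᵢ⟫ ∈ [0, ∞]` of a positive bounded operator `B`, computed in some Hilbert
basis `b` of `H` (see `trace_star_mul_self` for the independence of the basis). -/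
noncomputable def trace (B : H →L[ℂ] H) : ℝ≥0∞ :=
  ∑' i, ENNReal.ofReal
    (RCLike.re ⟪(exists_hilbertBasis ℂ H).choose_spec.choose i,
      B ((exists_hilbertBasis ℂ H).choose_spec.choose i)⟫_ℂ)

/-- The Schatten `p`-norm `‖A‖_p = Tr(|A|^p)^(1/p) ∈ [0, ∞]` of a bounded operator `A`. -/
noncomputable def eSchattenNorm (p : ℝ) (A : H →L[ℂ] H) : ℝ≥0∞ :=
  trace (CFC.abs A ^ p) ^ (1 / p)

end Definitions

section Aux

variable {H : Type*} [NormedAddCommGroup H] [InnerProductSpace ℂ H]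

theorem parseval {ι : Type*} (b : HilbertBasis ι ℂ H) (x : H) :
    ∑' i, ‖⟪b i, x⟫_ℂ‖ₑ ^ 2 = ‖x‖ₑ ^ 2 := by
  have h := b.hasSum_inner_mul_inner x x
  have h2 : HasSum (fun i => ‖⟪b i, x⟫_ℂ‖ ^ 2) (‖x‖ ^ 2) := by
    have := (RCLike.hasSum_re ℂ h)
    convert this using 1
    · ext i
      rw [← inner_conj_symm x (b i), RCLike.conj_mul]
      norm_cast
    · rw [inner_self_eq_norm_sq_to_K]; norm_cast
  have h3 := h2.tsum_eq
  have : ∀ y : ℂ, ‖y‖ₑ ^ 2 = ENNReal.ofReal (‖y‖ ^ 2) := fun y => by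
    rw [ENNReal.ofReal_pow (norm_nonneg _), ofReal_norm]
  simp_rw [this]
  rw [← ENNReal.ofReal_tsum_of_nonneg (fun _ => by positivity) h2.summable, h3,
    ENNReal.ofReal_pow (norm_nonneg _), ofReal_norm]

theorem bessel {ι : Type*} {v : ι → H} (hv : Orthonormal ℂ v) (x : H) :
    ∑' i, ‖⟪v i, x⟫_ℂ‖ₑ ^ 2 ≤ ‖x‖ₑ ^ 2 := by
  have : ∀ y : ℂ, ‖y‖ₑ ^ 2 = ENNReal.ofReal (‖y‖ ^ 2) := fun y => by
    rw [ENNReal.ofReal_pow (norm_nonneg _), ofReal_norm]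
  simp_rw [this]
  rw [← ENNReal.ofReal_tsum_of_nonneg (fun _ => by positivity) (hv.inner_products_summable x),
    ← ofReal_norm, ← ENNReal.ofReal_pow (norm_nonneg _)]
  exact ENNReal.ofReal_le_ofReal (hv.tsum_inner_products_le x)

theorem two_mul_le_enn (a b : ℝ≥0∞) : a * b ≤ (a ^ 2 + b ^ 2) / 2 := by
  have := ENNReal.young_inequality a b (p := 2) (q := 2) (by constructor <;> norm_num)
  simp only [ENNReal.ofReal_ofNat] at this
  rw [ENNReal.add_div]
  exact_mod_cast this

theorem enorm_inner_symm (x y : H) : ‖⟪x, y⟫_ℂ‖ₑ = ‖⟪y, x⟫_ℂ‖ₑ :=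
  enorm_eq_iff_norm_eq.2 (norm_inner_symm x y)

theorem rankOne_compact (x y : H) : IsCompactOperator (InnerProductSpace.rankOne ℂ x y) := by
  rw [InnerProductSpace.rankOne_def']
  exact (isCompactOperator_of_locallyCompactSpace_rng (M₂ := ℂ) (M₃ := H)
    (ContinuousLinearMap.toSpanSingleton ℂ x)).comp_clm (innerSL ℂ y)

theorem tsum_mul_le_one {ι : Type*} {a b : ι → ℝ≥0∞} (ha : ∑' i, a i ^ 2 ≤ 1)
    (hb : ∑' i, b i ^ 2 ≤ 1) : ∑' i, a i * b i ≤ 1 := by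
  calc ∑' i, a i * b i ≤ ∑' i, (a i ^ 2 + b i ^ 2) / 2 :=
        ENNReal.tsum_le_tsum fun i => two_mul_le_enn _ _
    _ = (∑' i, a i ^ 2 + ∑' i, b i ^ 2) / 2 := by
        simp_rw [div_eq_mul_inv]; rw [ENNReal.tsum_mul_right, ENNReal.tsum_add]
    _ ≤ (1 + 1) / 2 := by gcongr
    _ = 1 := by rw [one_add_one_eq_two]; exact ENNReal.div_self two_ne_zero ENNReal.ofNat_ne_top

theorem jensen_tsum {ι : Type*} {p : ℝ} (hp : 1 ≤ p) (w l : ι → ℝ≥0∞) (hw : ∑' k, w k ≤ 1) :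
    (∑' k, w k * l k) ^ p ≤ ∑' k, w k * l k ^ p := by
  have hp0 : 0 < p := by linarith
  rw [← ENNReal.le_rpow_inv_iff hp0]
  rw [ENNReal.tsum_eq_iSup_sum]
  refine iSup_le fun s => ?_
  refine (ENNReal.inner_le_weight_mul_Lp_of_nonneg s hp w l).trans ?_
  have h1 : (∑ i ∈ s, w i) ^ (1 - p⁻¹) ≤ 1 :=
    ENNReal.rpow_le_one ((ENNReal.sum_le_tsum s).trans hw) (by
      have := inv_le_one_of_one_le₀ hp; linarith)
  calc _ ≤ 1 * (∑' k, w k * l k ^ p) ^ p⁻¹ := by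
        gcongr
        exact ENNReal.sum_le_tsum s
    _ = _ := one_mul _

theorem doubly_substochastic {ι κ : Type*} {p : ℝ} (hp : 1 ≤ p) (w : κ → ι → ℝ≥0∞)
    (l : ι → ℝ≥0∞) (hw : ∀ i, ∑' k, w i k ≤ 1) (hw' : ∀ k, ∑' i, w i k ≤ 1) :
    ∑' i, (∑' k, w i k * l k) ^ p ≤ ∑' k, l k ^ p := by
  calc _ ≤ ∑' i, ∑' k, w i k * l k ^ p := ENNReal.tsum_le_tsum fun i => jensen_tsum hp _ _ (hw i)
    _ = ∑' k, (∑' i, w i k) * l k ^ p := by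
        rw [ENNReal.tsum_comm]; simp_rw [ENNReal.tsum_mul_right]
    _ ≤ ∑' k, l k ^ p := ENNReal.tsum_le_tsum fun k => by
        calc _ ≤ 1 * l k ^ p := by gcongr; exact hw' k
          _ = _ := one_mul _

variable [CompleteSpace H]

theorem tsum_norm_sq_indep {ι κ : Type*} (b : HilbertBasis ι ℂ H) (c : HilbertBasis κ ℂ H)
    (C : H →L[ℂ] H) : ∑' i, ‖C (b i)‖ₑ ^ 2 = ∑' j, ‖star C (c j)‖ₑ ^ 2 := by
  have h1 : ∀ i, ‖C (b i)‖ₑ ^ 2 = ∑' j, ‖⟪c j, C (b i)⟫_ℂ‖ₑ ^ 2 := fun i => (parseval c _).symm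
  have h2 : ∀ j, ‖star C (c j)‖ₑ ^ 2 = ∑' i, ‖⟪b i, star C (c j)⟫_ℂ‖ₑ ^ 2 :=
    fun j => (parseval b _).symm
  simp_rw [h1, h2]
  rw [ENNReal.tsum_comm]
  refine tsum_congr fun j => tsum_congr fun i => ?_
  rw [ContinuousLinearMap.star_eq_adjoint, ContinuousLinearMap.adjoint_inner_right,
    enorm_eq_iff_norm_eq.2 (norm_inner_symm _ _)]

theorem trace_star_mul_self {κ : Type*} (c : HilbertBasis κ ℂ H) (C : H →L[ℂ] H) :
    trace (star C * C) = ∑' j, ‖C (c j)‖ₑ ^ 2 := by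
  have key : ∀ x : H, ENNReal.ofReal (RCLike.re ⟪x, (star C * C) x⟫_ℂ) = ‖C x‖ₑ ^ 2 := fun x => by
    rw [mul_apply_eq_comp, ContinuousLinearMap.star_eq_adjoint,
      ContinuousLinearMap.adjoint_inner_right, inner_self_eq_norm_sq,
      ENNReal.ofReal_pow (norm_nonneg _), ofReal_norm]
  unfold trace
  simp_rw [key]
  rw [tsum_norm_sq_indep _ c, tsum_norm_sq_indep c c, star_star]

theorem trace_of_nonneg {κ : Type*} (c : HilbertBasis κ ℂ H) {B : H →L[ℂ] H} (hB : 0 ≤ B) :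
    trace B = ∑' j, ENNReal.ofReal (RCLike.re ⟪c j, B (c j)⟫_ℂ) := by
  obtain ⟨C, rfl⟩ := CStarAlgebra.nonneg_iff_eq_star_mul_self.1 hB
  rw [trace_star_mul_self c]
  refine tsum_congr fun x => ?_
  rw [mul_apply_eq_comp, ContinuousLinearMap.star_eq_adjoint,
      ContinuousLinearMap.adjoint_inner_right, inner_self_eq_norm_sq,
      ENNReal.ofReal_pow (norm_nonneg _), ofReal_norm]

/-- An eigenvector of `a` is an eigenvector of `f(a)`. -/
theorem cfc_apply_eigenvector {a : H →L[ℂ] H} (ha : IsSelfAdjoint a) {f : ℝ → ℝ}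
    (hf : ContinuousOn f (spectrum ℝ a)) {v : H} {l : ℝ} (hv : a v = l • v) :
    cfc f a v = f l • v := by
  rcases eq_or_ne v 0 with rfl | hv0
  · simp
  have hl : l ∈ spectrum ℝ a := by
    rw [spectrum.mem_iff]
    intro hu
    obtain ⟨u, hu⟩ := hu
    have h0 : (u : H →L[ℂ] H) v = 0 := by
      rw [hu, sub_apply, hv, Algebra.algebraMap_eq_smul_one]
      simp
    have : ((u⁻¹ : (H →L[ℂ] H)ˣ) : H →L[ℂ] H) ((u : H →L[ℂ] H) v) = v := by
      rw [← mul_apply_eq_comp, Units.inv_mul]; rfl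
    rw [h0, map_zero] at this
    exact hv0 this.symm
  have main : ∀ g : C(spectrum ℝ a, ℝ), cfcHom ha g v = g ⟨l, hl⟩ • v := by
    intro g
    have hid : cfcHom ha (.restrict (spectrum ℝ a) <| .id ℝ) = a := cfcHom_id ha
    induction g using ContinuousMap.induction_on_of_compact with
    | const r =>
      have : (ContinuousMap.const (spectrum ℝ a) r) = algebraMap ℝ _ r := rfl
      rw [this, AlgHomClass.commutes, Algebra.algebraMap_eq_smul_one]
      simp
    | id => rw [hid, hv]; rfl
    | star_id =>
      rw [map_star, hid, ha.star_eq, hv]; rfl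
    | add f g hf hg =>
      rw [map_add, add_apply, hf, hg, ← add_smul]; rfl
    | mul f g hf hg =>
      rw [map_mul, mul_apply_eq_comp, hg, ContinuousMap.mul_apply, mul_smul]
      have : cfcHom ha f (g ⟨l, hl⟩ • v) = g ⟨l, hl⟩ • cfcHom ha f v :=
        (cfcHom ha f).map_smul_of_tower _ _
      rw [this, hf, smul_comm]
    | frequently f h =>
      refine h.mem_of_closed (s := {g | cfcHom ha g v = g ⟨l, hl⟩ • v}) ?_
      refine isClosed_eq ?_ ?_
      · have := cfcHom_continuous (R := ℝ) ha
        exact (ContinuousLinearMap.apply ℂ H v).continuous.comp this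
      · have : Continuous fun g : C(spectrum ℝ a, ℝ) => g ⟨l, hl⟩ :=
          ContinuousEvalConst.continuous_eval_const _
        exact this.smul continuous_const
  rw [cfc_apply f a ha hf, main]
  rfl

theorem abs_apply_norm (A : H →L[ℂ] H) (x : H) : ‖CFC.abs A x‖ = ‖A x‖ := by
  have h := CFC.abs_mul_abs A
  have hsa : star (CFC.abs A) = CFC.abs A := (CFC.abs_nonneg A).isSelfAdjoint.star_eq
  have h2 : ∀ C : H →L[ℂ] H, ‖C x‖ ^ 2 = RCLike.re ⟪x, (star C * C) x⟫_ℂ := fun C => by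
    rw [mul_apply_eq_comp, ContinuousLinearMap.star_eq_adjoint,
      ContinuousLinearMap.adjoint_inner_right, inner_self_eq_norm_sq]
  have : ‖CFC.abs A x‖ ^ 2 = ‖A x‖ ^ 2 := by rw [h2, h2 A, hsa, h]
  exact (pow_left_inj₀ (norm_nonneg _) (norm_nonneg _) two_ne_zero).1 this

theorem compact_of_star_mul_self {A : H →L[ℂ] H} (h : IsCompactOperator (star A * A : H →L[ℂ] H)) :
    IsCompactOperator A := by
  have h1 : IsCompact (closure ((star A * A : H →L[ℂ] H) '' Metric.closedBall 0 1)) :=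
    (isCompactOperator_iff_isCompact_closure_image_closedBall
      ((star A * A : H →L[ℂ] H) : H →ₗ[ℂ] H) zero_lt_one).1 h
  refine (isCompactOperator_iff_isCompact_closure_image_closedBall
      (A : H →ₗ[ℂ] H) zero_lt_one).2 ?_
  have ht := h1.totallyBounded.subset subset_closure
  suffices TotallyBounded (A '' Metric.closedBall 0 1) from
    this.closure.isCompact_of_isClosed isClosed_closure
  rw [Metric.totallyBounded_iff]
  intro ε hε
  obtain ⟨t, hts, htf, ht⟩ := Metric.finite_approx_of_totallyBounded ht (ε ^ 2 / 2) (by positivity)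
  choose! g hg using fun y (hy : y ∈ t) => hts hy
  refine ⟨(fun y => A (g y)) '' t, htf.image _, ?_⟩
  rintro _ ⟨x, hx, rfl⟩
  obtain ⟨y, hy, hxy⟩ := Set.mem_iUnion₂.1 (ht ⟨x, hx, rfl⟩)
  refine Set.mem_iUnion₂.2 ⟨_, ⟨y, hy, rfl⟩, ?_⟩
  rw [Metric.mem_ball, dist_eq_norm] at hxy ⊢
  rw [← (hg y hy).2, ← map_sub] at hxy
  rw [← map_sub]
  have hb : ‖x - g y‖ ≤ 2 := by
    have h1 := (hg y hy).1
    rw [mem_closedBall_zero_iff] at h1 hx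
    exact (norm_sub_le _ _).trans (by linarith)
  have hs : ‖A (x - g y)‖ ^ 2 ≤ ‖x - g y‖ * ‖(star A * A) (x - g y)‖ := by
    rw [← inner_self_eq_norm_sq (𝕜 := ℂ), ← ContinuousLinearMap.adjoint_inner_right]
    exact (RCLike.re_le_norm _).trans (norm_inner_le_norm _ _)
  have : ‖A (x - g y)‖ ^ 2 < ε ^ 2 := by nlinarith [norm_nonneg ((star A * A) (x - g y))]
  exact lt_of_pow_lt_pow_left₀ 2 hε.le this

/-- A Hilbert-Schmidt operator is compact. -/
theorem compact_of_tsum_lt_top {κ : Type*} (c : HilbertBasis κ ℂ H) {C : H →L[ℂ] H}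
    (h : ∑' j, ‖C (c j)‖ₑ ^ 2 < ⊤) : IsCompactOperator C := by
  classical
  let D : Finset κ → (H →L[ℂ] H) := fun s => ∑ j ∈ s, (innerSL ℂ (c j)).smulRight (C (c j))
  have hD : ∀ s, IsCompactOperator (D s) := fun s => by
    have : D s ∈ compactOperator (RingHom.id ℂ) H H := Submodule.sum_mem _ fun j _ => by
      change IsCompactOperator _
      exact (isCompactOperator_of_locallyCompactSpace_rng (M₂ := ℂ) (M₃ := H)
        (ContinuousLinearMap.toSpanSingleton ℂ (C (c j)))).comp_clm (innerSL ℂ (c j))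
    exact this
  have hbound : ∀ s : Finset κ, ∀ x : H,
      ‖(C - D s) x‖ₑ ≤ (∑' j : {j // j ∉ s}, ‖C (c j)‖ₑ ^ 2) ^ (1 / 2 : ℝ) * ‖x‖ₑ := by
    intro s x
    have hsum : HasSum (fun j => ⟪c j, x⟫_ℂ • C (c j)) (C x) := by
      have := (c.hasSum_repr x).mapL C
      simpa [HilbertBasis.repr_apply_apply] using this
    have h2 : HasSum (fun j : {j // j ∉ s} => ⟪c j, x⟫_ℂ • C (c j)) ((C - D s) x) := by
      have := (s.hasSum_compl_iff (f := fun j => ⟪c j, x⟫_ℂ • C (c j)) (a := (C - D s) x)).2 (by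
        convert hsum using 1
        simp [D])
      exact this
    have h3 : ‖(C - D s) x‖ₑ ≤ ∑' j : {j // j ∉ s}, ‖⟪c j, x⟫_ℂ‖ₑ * ‖C (c j)‖ₑ := by
      rw [← h2.tsum_eq]
      refine (enorm_tsum_le_tsum_enorm).trans (le_of_eq ?_)
      simp_rw [enorm_smul]
    have h4 : ∑' j : {j // j ∉ s}, ‖⟪c j, x⟫_ℂ‖ₑ * ‖C (c j)‖ₑ ≤
        (∑' j : {j // j ∉ s}, ‖⟪c j, x⟫_ℂ‖ₑ ^ 2) ^ (1 / 2 : ℝ) *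
        (∑' j : {j // j ∉ s}, ‖C (c j)‖ₑ ^ 2) ^ (1 / 2 : ℝ) := by
      rw [ENNReal.tsum_eq_iSup_sum]
      refine iSup_le fun t => ?_
      refine (ENNReal.inner_le_Lp_mul_Lq t _ _ (p := 2) (q := 2)
        (by constructor <;> norm_num)).trans ?_
      simp only [ENNReal.rpow_ofNat]
      gcongr <;> exact ENNReal.sum_le_tsum t
    refine h3.trans (h4.trans ?_)
    rw [mul_comm]
    gcongr
    have h5 : ∑' j : {j // j ∉ s}, ‖⟪c j, x⟫_ℂ‖ₑ ^ 2 ≤ ‖x‖ₑ ^ 2 :=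
      (ENNReal.tsum_comp_le_tsum_of_injective Subtype.val_injective _).trans (parseval c x).le
    calc _ ≤ (‖x‖ₑ ^ 2) ^ (1 / 2 : ℝ) := by gcongr
      _ = _ := by rw [← ENNReal.rpow_natCast, ← ENNReal.rpow_mul]; norm_num
  refine isCompactOperator_of_tendsto (F := D) (l := Filter.atTop) ?_ (.of_forall hD)
  rw [tendsto_iff_norm_sub_tendsto_zero]
  have ht : Filter.Tendsto (fun s : Finset κ =>
      ((∑' j : {j // j ∉ s}, ‖C (c j)‖ₑ ^ 2) ^ (1 / 2 : ℝ)).toReal) Filter.atTop (𝓝 0) := by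
    have h1 := ENNReal.tendsto_tsum_compl_atTop_zero h.ne
    have h2 := (h1.ennrpow_const (1 / 2 : ℝ))
    rw [ENNReal.zero_rpow_of_pos (by norm_num)] at h2
    exact (ENNReal.tendsto_toReal ENNReal.zero_ne_top).comp h2
  refine squeeze_zero (fun _ => norm_nonneg _) (fun s => ?_) ht
  rw [norm_sub_rev]
  refine ContinuousLinearMap.opNorm_le_bound _ ENNReal.toReal_nonneg fun x => ?_
  have := ENNReal.toReal_mono ?_ (hbound s x)
  · rwa [ENNReal.toReal_mul, toReal_enorm, toReal_enorm] at this
  · refine ENNReal.mul_ne_top (ENNReal.rpow_ne_top_of_nonneg (by norm_num) ?_) enorm_ne_top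
    exact ((ENNReal.tsum_comp_le_tsum_of_injective Subtype.val_injective _).trans_lt h).ne

theorem compact_of_trace_lt_top {B : H →L[ℂ] H} (hB : 0 ≤ B) (h : trace B < ⊤) :
    IsCompactOperator B := by
  obtain ⟨C, rfl⟩ := CStarAlgebra.nonneg_iff_eq_star_mul_self.1 hB
  obtain ⟨w, c, -⟩ := exists_hilbertBasis ℂ H
  rw [trace_star_mul_self c] at h
  exact (compact_of_tsum_lt_top c h).clm_comp (star C)

theorem compact_of_pow {T : H →L[ℂ] H} (hT : 0 ≤ T) (k : ℕ)
    (h : IsCompactOperator (T ^ (2 ^ k) : H →L[ℂ] H)) : IsCompactOperator T := by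
  induction k with
  | zero => simpa using h
  | succ k ih =>
    apply ih
    apply compact_of_star_mul_self
    rw [(hT.isSelfAdjoint.pow _).star_eq, ← pow_add, ← two_mul, ← pow_succ']
    exact h

theorem compact_of_eSchattenNorm_lt_top {p : ℝ} (hp : 1 ≤ p) {A : H →L[ℂ] H}
    (h : eSchattenNorm p A < ⊤) : IsCompactOperator A := by
  have hp0 : 0 < p := by linarith
  have hT := CFC.abs_nonneg A
  set T := CFC.abs A with hTdef
  have h1 : trace (T ^ p) < ⊤ := by
    rw [eSchattenNorm, ENNReal.rpow_lt_top_iff_of_pos (by positivity)] at h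
    exact h
  have h2 : IsCompactOperator (T ^ p : H →L[ℂ] H) := compact_of_trace_lt_top CFC.rpow_nonneg h1
  obtain ⟨k, hk⟩ : ∃ k : ℕ, p ≤ (2 ^ k : ℕ) := by
    obtain ⟨n, hn⟩ := exists_nat_ge p
    exact ⟨n, hn.trans (by exact_mod_cast Nat.lt_two_pow_self.le)⟩
  have h3 : T ^ (2 ^ k) = cfc (fun x : ℝ => x ^ (((2 ^ k : ℕ) : ℝ) - p)) T * T ^ p := by
    rw [CFC.rpow_eq_cfc_real hT, ← cfc_mul _ _ T
      (by exact (Real.continuous_rpow_const (by linarith)).continuousOn)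
      (by exact (Real.continuous_rpow_const hp0.le).continuousOn),
      ← cfc_pow_id (R := ℝ) T (2 ^ k) hT.isSelfAdjoint]
    refine cfc_congr fun x hx => ?_
    have hx0 : 0 ≤ x := spectrum_nonneg_of_nonneg hT hx
    rw [← Real.rpow_natCast]
    rcases hx0.eq_or_lt with rfl | hx0
    · rw [Real.zero_rpow hp0.ne', mul_zero, Real.zero_rpow]
      positivity
    · rw [← Real.rpow_add hx0]; ring_nf
  have h4 : IsCompactOperator (T ^ (2 ^ k) : H →L[ℂ] H) := by
    rw [h3]; exact h2.clm_comp _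
  have h5 := compact_of_pow hT k h4
  apply compact_of_star_mul_self
  rw [← CFC.abs_mul_abs A]
  exact h5.clm_comp _

/-- Diagonalization of a compact positive operator in a Hilbert basis. -/
theorem exists_eigenbasis {T : H →L[ℂ] H} (hT : 0 ≤ T) (hc : IsCompactOperator T) :
    ∃ (w : Set H) (g : HilbertBasis w ℂ H) (l : w → ℝ), (∀ i, 0 ≤ l i) ∧
      ∀ i, T (g i) = l i • g i := by
  classical
  have hpos : T.IsPositive := (ContinuousLinearMap.nonneg_iff_isPositive T).1 hT
  -- a maximal orthonormal set of eigenvectors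
  have hsym : T.IsSymmetric := hpos.isSymmetric
  have hbot := ContinuousLinearMap.orthogonalComplement_iSup_eigenspaces_eq_bot hc hsym
  let E := fun μ : ℂ => Module.End.eigenspace (T : Module.End ℂ H) μ
  have hcl : ∀ μ, IsClosed (E μ : Set H) := fun μ => by
    have : (E μ : Set H) = {x | T x = μ • x} := by
      ext x; exact Module.End.mem_eigenspace_iff
    rw [this]
    exact isClosed_eq T.continuous (continuous_const_smul μ)
  have : ∀ μ, CompleteSpace (E μ) := fun μ => (hcl μ).completeSpace_coe
  choose w b hb using fun μ => exists_hilbertBasis ℂ (E μ)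
  have hof : OrthogonalFamily ℂ (fun μ => E μ) fun μ => (E μ).subtypeₗᵢ :=
    hsym.orthogonalFamily_eigenspaces
  let v : (Σ μ, w μ) → H := fun i => (b i.1 i.2 : H)
  have hv : Orthonormal ℂ v := hof.orthonormal_sigma_orthonormal fun μ => (b μ).orthonormal
  have hvsp : (Submodule.span ℂ (Set.range v))ᗮ = ⊥ := by
    rw [eq_bot_iff, ← hbot]
    intro x hx
    rw [Submodule.mem_orthogonal] at hx ⊢
    have hle : (⨆ μ, E μ) ≤ (ℂ ∙ x)ᗮ := by
      refine iSup_le fun μ y hy => ?_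
      rw [Submodule.mem_orthogonal_singleton_iff_inner_left]
      have hs := (b μ).hasSum_repr ⟨y, hy⟩
      have hs2 := (hs.mapL (E μ).subtypeL).mapL ((innerSL ℂ) x)
      have hz : ∀ i, ⟪x, (b μ i : H)⟫_ℂ = 0 := fun i => by
        rw [inner_eq_zero_symm]
        exact hx _ (Submodule.subset_span ⟨⟨μ, i⟩, rfl⟩)
      have hs3 : ⟪x, y⟫_ℂ = 0 := by
        refine hs2.unique ?_
        simp [hz, hasSum_zero]
      rw [inner_eq_zero_symm]; exact hs3
    intro u hu
    exact (Submodule.mem_orthogonal_singleton_iff_inner_left).1 (hle hu)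
  have hv' : Orthonormal ℂ ((↑) : Set.range v → H) := hv.toSubtypeRange
  have hr : Set.range ((↑) : Set.range v → H) = Set.range v := Subtype.range_coe
  let g := HilbertBasis.mkOfOrthogonalEqBot hv' (by rw [hr]; exact hvsp)
  have hg : ∀ i, g i = i := fun i => by
    simp [g]
  have heig : ∀ i : Set.range v, ∃ l : ℝ, 0 ≤ l ∧ T i = l • (i : H) := by
    rintro ⟨_, ⟨μ, i⟩, rfl⟩
    have h1 : T (v ⟨μ, i⟩) = μ • v ⟨μ, i⟩ := Module.End.mem_eigenspace_iff.1 (b μ i).2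
    have h2 : 0 ≤ ⟪v ⟨μ, i⟩, T (v ⟨μ, i⟩)⟫_ℂ := hpos.inner_nonneg_right _
    rw [h1, inner_smul_right, inner_self_eq_norm_sq_to_K, hv.1] at h2
    have h3 : 0 ≤ μ := by simpa using h2
    refine ⟨μ.re, (Complex.nonneg_iff.1 h3).1, ?_⟩
    have h4 : μ = (μ.re : ℂ) := by
      apply Complex.ext <;> simp [(Complex.nonneg_iff.1 h3).2.symm]
    change T (v ⟨μ, i⟩) = μ.re • v ⟨μ, i⟩
    rw [h1]
    generalize v ⟨μ, i⟩ = x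
    conv_lhs => rw [h4]
    simp
  choose l hl hl2 using heig
  exact ⟨_, g, l, hl, fun i => by rw [hg]; exact hl2 i⟩

end Aux

section Variational

variable {H : Type*} [NormedAddCommGroup H] [InnerProductSpace ℂ H] [CompleteSpace H]

theorem abs_apply_of_eigen {A : H →L[ℂ] H} {v : H} {l : ℝ} (hl : 0 ≤ l)
    (h : (star A * A) v = (l ^ 2) • v) : CFC.abs A v = l • v := by
  have hpos : 0 ≤ star A * A := star_mul_self_nonneg A
  have : CFC.abs A = cfc Real.sqrt (star A * A) := by
    rw [CFC.abs, CFC.sqrt_eq_real_sqrt _ hpos, cfcₙ_eq_cfc]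
  rw [this, cfc_apply_eigenvector hpos.isSelfAdjoint Real.continuous_sqrt.continuousOn h,
    Real.sqrt_sq hl]

/-- The Schatten norm through the eigenvalues of `|A|²`. -/
theorem eSchattenNorm_of_eigen {p : ℝ} (hp : 1 ≤ p) {ι : Type*} {A : H →L[ℂ] H}
    (g : HilbertBasis ι ℂ H) {l : ι → ℝ} (hl : ∀ i, 0 ≤ l i)
    (h : ∀ i, (star A * A) (g i) = (l i ^ 2) • g i) :
    eSchattenNorm p A = (∑' i, ENNReal.ofReal (l i) ^ p) ^ (1 / p) := by
  have hp0 : 0 < p := by linarith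
  rw [eSchattenNorm, trace_of_nonneg g CFC.rpow_nonneg]
  congr 1
  refine tsum_congr fun i => ?_
  rw [CFC.rpow_eq_cfc_real (CFC.abs_nonneg A),
    cfc_apply_eigenvector (CFC.abs_nonneg A).isSelfAdjoint
      (Real.continuous_rpow_const hp0.le).continuousOn (abs_apply_of_eigen (hl i) (h i)),
    inner_smul_right_eq_smul, inner_self_eq_norm_sq_to_K, g.orthonormal.1,
    ENNReal.ofReal_rpow_of_nonneg (hl i) hp0.le]
  simp

/-- A compact operator `A` has a Hilbert basis of eigenvectors of `|A|²`. -/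
theorem exists_singular_basis {A : H →L[ℂ] H} (hA : IsCompactOperator A) :
    ∃ (w : Set H) (g : HilbertBasis w ℂ H) (l : w → ℝ), (∀ i, 0 ≤ l i) ∧
      ∀ i, (star A * A) (g i) = (l i ^ 2) • g i := by
  have hpos : 0 ≤ star A * A := star_mul_self_nonneg A
  obtain ⟨w, g, l, hl, h⟩ := exists_eigenbasis hpos (hA.clm_comp (star A))
  exact ⟨w, g, fun i => √(l i), fun i => Real.sqrt_nonneg _, fun i => by
    rw [Real.sq_sqrt (hl i)]; exact h i⟩

theorem inner_singular {ι : Type*} {A : H →L[ℂ] H} (g : HilbertBasis ι ℂ H) {l : ι → ℝ}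
    (h : ∀ i, (star A * A) (g i) = (l i ^ 2) • g i) (i j : ι) :
    ⟪A (g i), A (g j)⟫_ℂ = (l j ^ 2 : ℝ) • ⟪g i, g j⟫_ℂ := by
  rw [← ContinuousLinearMap.adjoint_inner_right, ← inner_smul_right_eq_smul, ← h j]
  rfl

/-- The normalized images of the singular vectors are orthonormal. -/
theorem orthonormal_singular {ι : Type*} {A : H →L[ℂ] H} (g : HilbertBasis ι ℂ H) {l : ι → ℝ}
    (h : ∀ i, (star A * A) (g i) = (l i ^ 2) • g i) :
    Orthonormal ℂ (fun i : {i // l i ≠ 0} => (l i)⁻¹ • A (g i)) := by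
  classical
  rw [orthonormal_iff_ite]
  rintro ⟨i, hi⟩ ⟨j, hj⟩
  rw [inner_smul_right_eq_smul, inner_smul_left_eq_smul, inner_singular g h,
    orthonormal_iff_ite.1 g.orthonormal]
  by_cases hij : i = j
  · subst hij
    simp
    field_simp
  · simp [hij]

theorem apply_eq_zero_of_singular {ι : Type*} {A : H →L[ℂ] H} (g : HilbertBasis ι ℂ H) {l : ι → ℝ}
    (h : ∀ i, (star A * A) (g i) = (l i ^ 2) • g i) {i : ι} (hi : l i = 0) : A (g i) = 0 := by
  have := inner_singular g h i i
  rw [hi] at this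
  simpa using this

theorem sum_le_eSchattenNorm {p : ℝ} (hp : 1 ≤ p) {A : H →L[ℂ] H} (hA : IsCompactOperator A)
    {κ : Type*} [Fintype κ] {e f : κ → H} (he : Orthonormal ℂ e) (hf : Orthonormal ℂ f) :
    (∑ i, ‖⟪f i, A (e i)⟫_ℂ‖ₑ ^ p) ^ (1 / p) ≤ eSchattenNorm p A := by
  obtain ⟨w, g, l, hl, h⟩ := exists_singular_basis hA
  have hp0 : 0 < p := by linarith
  rw [eSchattenNorm_of_eigen hp g hl h]
  have ho := orthonormal_singular g h
  let W : κ → {i // l i ≠ 0} → ℝ≥0∞ :=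
    fun i k => ‖⟪g k, e i⟫_ℂ‖ₑ * ‖⟪(l k)⁻¹ • A (g k), f i⟫_ℂ‖ₑ
  have key : ∀ i, ‖⟪f i, A (e i)⟫_ℂ‖ₑ ≤
      ∑' k : {i // l i ≠ 0}, W i k * ENNReal.ofReal (l k) := by
    intro i
    have h1 : HasSum (fun k => ⟪g k, e i⟫_ℂ * ⟪f i, A (g k)⟫_ℂ) ⟪f i, A (e i)⟫_ℂ := by
      have := ((g.hasSum_repr (e i)).mapL A).mapL (innerSL ℂ (f i))
      simpa [HilbertBasis.repr_apply_apply, inner_smul_right] using this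
    have h2 : HasSum (fun k : {i // l i ≠ 0} => ⟪g k, e i⟫_ℂ * ⟪f i, A (g k)⟫_ℂ)
        ⟪f i, A (e i)⟫_ℂ := by
      refine (hasSum_subtype_iff_of_support_subset (s := {i | l i ≠ 0}) ?_).2 h1
      intro k hk
      simp only [Function.mem_support] at hk
      intro h0
      apply hk
      rw [apply_eq_zero_of_singular g h h0]; simp
    rw [← h2.tsum_eq]
    refine enorm_tsum_le_tsum_enorm.trans (le_of_eq (tsum_congr fun k => ?_))
    have hk : 0 < l k := lt_of_le_of_ne (hl k) (Ne.symm k.2)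
    have h3 : ‖⟪f i, A (g k)⟫_ℂ‖ₑ =
        ‖⟪(l k)⁻¹ • A (g k), f i⟫_ℂ‖ₑ * ENNReal.ofReal (l k) := by
      rw [inner_smul_left_eq_smul, enorm_smul, enorm_inner_symm,
        mul_comm, ← mul_assoc, ← Real.enorm_of_nonneg hk.le, ← enorm_mul, mul_inv_cancel₀ hk.ne']
      simp
    rw [enorm_mul, h3, ← mul_assoc]
  have hnorm : ∀ i, ‖e i‖ₑ = 1 := fun i => by rw [← ofReal_norm, he.1]; simp
  have hnormf : ∀ i, ‖f i‖ₑ = 1 := fun i => by rw [← ofReal_norm, hf.1]; simp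
  have hnormg : ∀ i, ‖g i‖ₑ = 1 := fun i => by rw [← ofReal_norm, g.orthonormal.1]; simp
  have hnormo : ∀ k : {i // l i ≠ 0}, ‖(l k)⁻¹ • A (g k)‖ₑ = 1 :=
    fun i => by rw [← ofReal_norm, ho.1]; simp
  have hW1 : ∀ i, ∑' k, W i k ≤ 1 := by
    intro i
    have b1 := bessel (g.orthonormal.comp (Subtype.val : {i // l i ≠ 0} → w)
      Subtype.val_injective) (e i)
    have b2 := bessel ho (f i)
    rw [hnorm, one_pow] at b1
    rw [hnormf, one_pow] at b2
    exact tsum_mul_le_one b1 b2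
  have hW2 : ∀ k, ∑' i, W i k ≤ 1 := by
    intro k
    have b1 := bessel he (g k)
    have b2 := bessel hf ((l k)⁻¹ • A (g k))
    rw [hnormg, one_pow] at b1
    rw [hnormo, one_pow] at b2
    refine tsum_mul_le_one (le_of_eq_of_le ?_ b1) (le_of_eq_of_le ?_ b2)
    · exact tsum_congr fun i => by rw [enorm_inner_symm (e i)]
    · exact tsum_congr fun i => by rw [enorm_inner_symm (f i)]
  refine ENNReal.rpow_le_rpow ?_ (by positivity)
  calc ∑ i, ‖⟪f i, A (e i)⟫_ℂ‖ₑ ^ p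
      ≤ ∑ i, (∑' k : {i // l i ≠ 0}, W i k * ENNReal.ofReal (l k)) ^ p :=
        Finset.sum_le_sum fun i _ => ENNReal.rpow_le_rpow (key i) hp0.le
    _ = ∑' i, (∑' k : {i // l i ≠ 0}, W i k * ENNReal.ofReal (l k)) ^ p :=
        (tsum_fintype _).symm
    _ ≤ ∑' k : {i // l i ≠ 0}, ENNReal.ofReal (l k) ^ p :=
        doubly_substochastic hp W _ hW1 hW2
    _ ≤ ∑' k, ENNReal.ofReal (l k) ^ p :=
        ENNReal.tsum_comp_le_tsum_of_injective (f := Subtype.val) Subtype.val_injective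
          (fun k => ENNReal.ofReal (l k) ^ p)

theorem eSchattenNorm_le {p : ℝ} (hp : 1 ≤ p) {A : H →L[ℂ] H} (hA : IsCompactOperator A)
    {C : ℝ≥0∞}
    (hC : ∀ (n : ℕ) (e f : Fin n → H), Orthonormal ℂ e → Orthonormal ℂ f →
      (∑ i, ‖⟪f i, A (e i)⟫_ℂ‖ₑ ^ p) ^ (1 / p) ≤ C) :
    eSchattenNorm p A ≤ C := by
  classical
  obtain ⟨w, g, l, hl, h⟩ := exists_singular_basis hA
  have hp0 : 0 < p := by linarith
  rw [eSchattenNorm_of_eigen hp g hl h, one_div, ENNReal.rpow_inv_le_iff hp0]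
  rw [ENNReal.tsum_eq_iSup_sum]
  refine iSup_le fun s => ?_
  let t : Finset {i // l i ≠ 0} := s.subtype _
  have ho := orthonormal_singular g h
  let eq := t.equivFin.symm
  have h1 := hC _ (fun i => g (eq i).1) (fun i => (l (eq i).1)⁻¹ • A (g (eq i).1))
    (g.orthonormal.comp _ (Subtype.val_injective.comp
      (Subtype.val_injective.comp eq.injective)))
    (ho.comp _ (Subtype.val_injective.comp eq.injective))
  rw [one_div, ENNReal.rpow_inv_le_iff hp0] at h1
  refine le_trans (le_of_eq ?_) h1
  have h2 : ∀ k : {i // l i ≠ 0}, ‖⟪(l k)⁻¹ • A (g k), A (g k)⟫_ℂ‖ₑ ^ p =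
      ENNReal.ofReal (l k) ^ p := by
    intro k
    rw [inner_smul_left_eq_smul, inner_singular g h, inner_self_eq_norm_sq_to_K, g.orthonormal.1,
      smul_smul, ← Real.enorm_of_nonneg (hl k)]
    have : (l k)⁻¹ * (l k) ^ 2 = l k := by have := k.2; field_simp
    rw [this, enorm_smul]; simp
  rw [eq.sum_comp (fun k : t => ‖⟪(l k.1)⁻¹ • A (g k.1), A (g k.1)⟫_ℂ‖ₑ ^ p)]
  simp_rw [h2]
  rw [Finset.sum_coe_sort t (fun k => ENNReal.ofReal (l k) ^ p)]
  simp only [t]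
  rw [Finset.sum_subtype_eq_sum_filter (f := fun k => ENNReal.ofReal (l k) ^ p),
    Finset.sum_filter_of_ne]
  intro i _ hi h0
  apply hi
  rw [h0]
  simp [hp0]

theorem eSchattenNorm_zero {p : ℝ} (hp : 1 ≤ p) : eSchattenNorm p (0 : H →L[ℂ] H) = 0 := by
  have hp0 : 0 < p := by linarith
  refine le_antisymm (eSchattenNorm_le hp isCompactOperator_zero fun n e f _ _ => ?_) bot_le
  simp [hp0]

theorem eSchattenNorm_add_le {p : ℝ} (hp : 1 ≤ p) {A B : H →L[ℂ] H}
    (hA : IsCompactOperator A) (hB : IsCompactOperator B) :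
    eSchattenNorm p (A + B) ≤ eSchattenNorm p A + eSchattenNorm p B := by
  have hp0 : 0 < p := by linarith
  refine eSchattenNorm_le hp (hA.add hB) fun n e f he hf => ?_
  calc _ ≤ (∑ i, (‖⟪f i, A (e i)⟫_ℂ‖ₑ + ‖⟪f i, B (e i)⟫_ℂ‖ₑ) ^ p) ^ (1 / p) := by
        gcongr with i
        rw [add_apply, inner_add_right]
        exact enorm_add_le _ _
    _ ≤ _ := (ENNReal.Lp_add_le _ _ _ hp).trans
        (add_le_add (sum_le_eSchattenNorm hp hA he hf) (sum_le_eSchattenNorm hp hB he hf))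

theorem eSchattenNorm_smul_le {p : ℝ} (hp : 1 ≤ p) {A : H →L[ℂ] H} (hA : IsCompactOperator A)
    (c : ℂ) : eSchattenNorm p (c • A) ≤ ‖c‖ₑ * eSchattenNorm p A := by
  have hp0 : 0 < p := by linarith
  refine eSchattenNorm_le hp (hA.smul c) fun n e f he hf => ?_
  refine le_trans (le_of_eq ?_) (mul_le_mul_right (sum_le_eSchattenNorm hp hA he hf) _)
  have : ∀ i, ‖⟪f i, (c • A) (e i)⟫_ℂ‖ₑ ^ p = ‖c‖ₑ ^ p * ‖⟪f i, A (e i)⟫_ℂ‖ₑ ^ p := fun i => by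
    rw [smul_apply, inner_smul_right, enorm_mul, ENNReal.mul_rpow_of_nonneg _ _ hp0.le]
  simp_rw [this]
  rw [← Finset.mul_sum, ENNReal.mul_rpow_of_nonneg _ _ (by positivity), one_div,
    ENNReal.rpow_rpow_inv hp0.ne']

theorem eSchattenNorm_neg {p : ℝ} (A : H →L[ℂ] H) : eSchattenNorm p (-A) = eSchattenNorm p A := by
  rw [eSchattenNorm, CFC.abs_neg, eSchattenNorm]

theorem enorm_apply_le {p : ℝ} (hp : 1 ≤ p) {A : H →L[ℂ] H} (hA : IsCompactOperator A) (x : H) :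
    ‖A x‖ₑ ≤ eSchattenNorm p A * ‖x‖ₑ := by
  have hp0 : 0 < p := by linarith
  rcases eq_or_ne (A x) 0 with h0 | h0
  · simp [h0]
  have hx : x ≠ 0 := fun h => h0 (by simp [h])
  have ho : ∀ y : H, y ≠ 0 → Orthonormal ℂ (fun _ : Unit => ((‖y‖ : ℂ))⁻¹ • y) := fun y hy => by
    refine ⟨fun _ => ?_, fun i j hij => absurd (Subsingleton.elim i j) hij⟩
    rw [norm_smul, norm_inv, Complex.norm_real, norm_norm,
      inv_mul_cancel₀ (norm_ne_zero_iff.2 hy)]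
  have := sum_le_eSchattenNorm hp hA (ho x hx) (ho (A x) h0)
  simp only [Finset.univ_unique, Finset.sum_singleton, one_div] at this
  rw [ENNReal.rpow_rpow_inv hp0.ne', map_smul, inner_smul_left, inner_smul_right,
    inner_self_eq_norm_sq_to_K] at this
  have h2 : ((starRingEnd ℂ) (‖A x‖ : ℂ)⁻¹ * ((‖x‖ : ℂ)⁻¹ * (‖A x‖ : ℂ) ^ 2)) =
      ((‖A x‖ / ‖x‖ : ℝ) : ℂ) := by
    have : (‖A x‖ : ℂ) ≠ 0 := by exact_mod_cast norm_ne_zero_iff.2 h0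
    simp
    field_simp
  erw [h2] at this
  have h3 : ‖((‖A x‖ / ‖x‖ : ℝ) : ℂ)‖ₑ * ‖x‖ₑ = ‖A x‖ₑ := by
    rw [← ofReal_norm, ← ofReal_norm x, ← ENNReal.ofReal_mul (norm_nonneg _), Complex.norm_real,
      Real.norm_of_nonneg (by positivity), div_mul_cancel₀ _ (norm_ne_zero_iff.2 hx), ofReal_norm]
  rw [← h3]
  gcongr

theorem eSchattenNorm_rankOne_le {p : ℝ} (hp : 1 ≤ p) (x y : H) :
    eSchattenNorm p (InnerProductSpace.rankOne ℂ x y) ≤ ‖x‖ₑ * ‖y‖ₑ := by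
  have hp0 : 0 < p := by linarith
  refine eSchattenNorm_le hp (rankOne_compact x y) fun n e f he hf => ?_
  have h1 : ∀ i, ‖⟪f i, InnerProductSpace.rankOne ℂ x y (e i)⟫_ℂ‖ₑ =
      ‖⟪f i, x⟫_ℂ‖ₑ * ‖⟪e i, y⟫_ℂ‖ₑ := fun i => by
    rw [InnerProductSpace.rankOne_apply, inner_smul_right, enorm_mul, mul_comm,
      enorm_inner_symm (e i) y]
  simp_rw [h1]
  have h2 : ∑ i, ‖⟪f i, x⟫_ℂ‖ₑ * ‖⟪e i, y⟫_ℂ‖ₑ ≤ ‖x‖ₑ * ‖y‖ₑ := by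
    refine (ENNReal.inner_le_Lp_mul_Lq Finset.univ _ _ (p := 2) (q := 2)
        (by constructor <;> norm_num)).trans ?_
    have b1 := bessel hf x
    have b2 := bessel he y
    rw [tsum_fintype] at b1 b2
    simp only [ENNReal.rpow_ofNat]
    have : ∀ a : ℝ≥0∞, (a ^ 2) ^ (1 / 2 : ℝ) = a := fun a => by
      rw [← ENNReal.rpow_natCast, ← ENNReal.rpow_mul]; norm_num
    calc _ ≤ (‖x‖ₑ ^ 2) ^ (1 / 2 : ℝ) * (‖y‖ₑ ^ 2) ^ (1 / 2 : ℝ) := by gcongr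
      _ = _ := by rw [this, this]
  set M := ‖x‖ₑ * ‖y‖ₑ with hM
  have hM' : M ≠ ⊤ := ENNReal.mul_ne_top enorm_ne_top enorm_ne_top
  rw [one_div, ENNReal.rpow_inv_le_iff hp0]
  calc ∑ i, (‖⟪f i, x⟫_ℂ‖ₑ * ‖⟪e i, y⟫_ℂ‖ₑ) ^ p
      ≤ ∑ i, M ^ (p - 1) * (‖⟪f i, x⟫_ℂ‖ₑ * ‖⟪e i, y⟫_ℂ‖ₑ) := by
        refine Finset.sum_le_sum fun i _ => ?_
        set a := ‖⟪f i, x⟫_ℂ‖ₑ * ‖⟪e i, y⟫_ℂ‖ₑ with ha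
        have haM : a ≤ M := le_trans (Finset.single_le_sum
          (f := fun i => ‖⟪f i, x⟫_ℂ‖ₑ * ‖⟪e i, y⟫_ℂ‖ₑ) (fun _ _ => bot_le) (Finset.mem_univ i)) h2
        calc a ^ p = a ^ ((p - 1) + 1) := by ring_nf
          _ = a ^ (p - 1) * a := by
            rw [ENNReal.rpow_add_of_nonneg _ _ (by linarith) zero_le_one, ENNReal.rpow_one]
          _ ≤ _ := by gcongr
    _ = M ^ (p - 1) * ∑ i, ‖⟪f i, x⟫_ℂ‖ₑ * ‖⟪e i, y⟫_ℂ‖ₑ := by rw [Finset.mul_sum]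
    _ ≤ M ^ (p - 1) * M := by gcongr
    _ = M ^ p := by
        conv_rhs => rw [show p = (p - 1) + 1 by ring]
        rw [ENNReal.rpow_add_of_nonneg _ _ (by linarith) zero_le_one, ENNReal.rpow_one]

/-- Finite sums of rank one operators are dense in the Schatten class. -/
theorem exists_sum_rankOne {p : ℝ} (hp : 1 ≤ p) {A : H →L[ℂ] H} (hA : eSchattenNorm p A < ⊤)
    {ε : ℝ≥0∞} (hε : 0 < ε) :
    ∃ (n : ℕ) (x y : Fin n → H),
      eSchattenNorm p (A - ∑ i, InnerProductSpace.rankOne ℂ (x i) (y i)) < ε := by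
  classical
  have hp0 : 0 < p := by linarith
  obtain ⟨w, g, l, hl, h⟩ := exists_singular_basis (compact_of_eSchattenNorm_lt_top hp hA)
  let D : Finset w → (H →L[ℂ] H) := fun s => ∑ k ∈ s, InnerProductSpace.rankOne ℂ (A (g k)) (g k)
  have hD : ∀ s k, (A - D s) (g k) = if k ∈ s then 0 else A (g k) := by
    intro s k
    have : ∀ j, ⟪g j, g k⟫_ℂ = if j = k then 1 else 0 := fun j =>
      orthonormal_iff_ite.1 g.orthonormal j k
    simp only [D, sub_apply, FunLike.coe_sum, Finset.sum_apply,
      InnerProductSpace.rankOne_apply, this, ite_smul, one_smul, zero_smul,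
      Finset.sum_ite_eq']
    split_ifs <;> simp
  have heig : ∀ s k, (star (A - D s) * (A - D s)) (g k) =
      ((if k ∈ s then 0 else l k) ^ 2 : ℝ) • g k := by
    intro s k
    rw [mul_apply_eq_comp, hD]
    split_ifs with hk
    · simp
    · refine g.repr.injective ?_
      ext j
      rw [HilbertBasis.repr_apply_apply, HilbertBasis.repr_apply_apply,
        ContinuousLinearMap.star_eq_adjoint, ContinuousLinearMap.adjoint_inner_right, hD,
        inner_smul_right_eq_smul]
      split_ifs with hj
      · have : j ≠ k := fun h => hk (h ▸ hj)
        rw [orthonormal_iff_ite.1 g.orthonormal, if_neg this]; simp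
      · exact inner_singular g h j k
  have hnorm : ∀ s, eSchattenNorm p (A - D s) =
      (∑' k : {k // k ∉ s}, ENNReal.ofReal (l k) ^ p) ^ (1 / p) := by
    intro s
    rw [eSchattenNorm_of_eigen hp g (l := fun k => if k ∈ s then 0 else l k)
      (fun k => by split_ifs <;> simp [hl]) (heig s)]
    congr 1
    have : ∀ k, ENNReal.ofReal (if k ∈ s then 0 else l k) ^ p =
        Set.indicator {k | k ∉ s} (fun k => ENNReal.ofReal (l k) ^ p) k := fun k => by
      by_cases hk : k ∈ s <;> simp [hk, hp0]
    simp_rw [this]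
    exact (tsum_subtype {k | k ∉ s} (fun k => ENNReal.ofReal (l k) ^ p)).symm
  have hfin : ∑' k, ENNReal.ofReal (l k) ^ p ≠ ⊤ := by
    rw [eSchattenNorm_of_eigen hp g hl h, ENNReal.rpow_lt_top_iff_of_pos (by positivity)] at hA
    exact hA.ne
  have h1 := (ENNReal.tendsto_tsum_compl_atTop_zero hfin).ennrpow_const (1 / p)
  rw [ENNReal.zero_rpow_of_pos (by positivity)] at h1
  obtain ⟨s, hs⟩ := ((tendsto_order.1 h1).2 ε hε).exists
  refine ⟨s.card, fun i => A (g (s.equivFin.symm i)), fun i => g (s.equivFin.symm i), ?_⟩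
  rw [s.equivFin.symm.sum_comp (fun k : s => InnerProductSpace.rankOne ℂ (A (g k)) (g k)),
    Finset.sum_coe_sort s (fun k => InnerProductSpace.rankOne ℂ (A (g k)) (g k))]
  exact (hnorm s).trans_lt hs

end Variational

section SchattenClass

variable (p : ℝ) [Fact (1 ≤ p)] (H : Type*) [NormedAddCommGroup H] [InnerProductSpace ℂ H]
  [CompleteSpace H]

/-- The bounded operators `A` on `H` with `‖A‖_p < ∞`, as a subspace of `B(H)`. -/
noncomputable def schattenSubmodule : Submodule ℂ (H →L[ℂ] H) where
  carrier := {A | eSchattenNorm p A < ⊤}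
  add_mem' {A B} hA hB := by
    have hp : 1 ≤ p := Fact.out
    exact (eSchattenNorm_add_le hp (compact_of_eSchattenNorm_lt_top hp hA)
      (compact_of_eSchattenNorm_lt_top hp hB)).trans_lt (ENNReal.add_lt_top.2 ⟨hA, hB⟩)
  zero_mem' := by
    change eSchattenNorm p (0 : H →L[ℂ] H) < ⊤
    rw [eSchattenNorm_zero Fact.out]; exact ENNReal.zero_lt_top
  smul_mem' c A hA := by
    have hp : 1 ≤ p := Fact.out
    exact (eSchattenNorm_smul_le hp (compact_of_eSchattenNorm_lt_top hp hA) c).trans_lt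
      (ENNReal.mul_lt_top enorm_lt_top hA)

/-- The Schatten class `S^p(H)`. It is a type of its own, because its norm is not the operator
norm. -/
def SchattenClass : Type _ := schattenSubmodule p H

variable {p H}

namespace SchattenClass

noncomputable instance : AddCommGroup (SchattenClass p H) :=
  inferInstanceAs (AddCommGroup (schattenSubmodule p H))

noncomputable instance : Module ℂ (SchattenClass p H) :=
  inferInstanceAs (Module ℂ (schattenSubmodule p H))

/-- The operator underlying an element of `S^p(H)`. -/
noncomputable def toOp : SchattenClass p H →ₗ[ℂ] (H →L[ℂ] H) := (schattenSubmodule p H).subtype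

/-- An operator with `‖A‖_p < ∞` as an element of `S^p(H)`. -/
def mk (A : H →L[ℂ] H) (hA : eSchattenNorm p A < ⊤) : SchattenClass p H := ⟨A, hA⟩

theorem toOp_mk (A : H →L[ℂ] H) (hA : eSchattenNorm p A < ⊤) : toOp (mk A hA) = A := rfl

theorem toOp_injective : Function.Injective (toOp : SchattenClass p H → (H →L[ℂ] H)) :=
  Subtype.val_injective

theorem lt_top (x : SchattenClass p H) : eSchattenNorm p (toOp x) < ⊤ := x.2

theorem compact (x : SchattenClass p H) : IsCompactOperator (toOp x) :=
  compact_of_eSchattenNorm_lt_top Fact.out x.lt_top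

/-- The norm of `S^p(H)` is `‖A‖_p = Tr(|A|^p)^(1/p)`. -/
noncomputable instance : NormedAddCommGroup (SchattenClass p H) :=
  AddGroupNorm.toNormedAddCommGroup
    { toFun := fun x => (eSchattenNorm p (toOp x)).toReal
      map_zero' := by rw [map_zero, eSchattenNorm_zero Fact.out, ENNReal.toReal_zero]
      add_le' := fun x y => by
        rw [map_add, ← ENNReal.toReal_add x.lt_top.ne y.lt_top.ne]
        exact ENNReal.toReal_mono (ENNReal.add_lt_top.2 ⟨x.lt_top, y.lt_top⟩).ne
          (eSchattenNorm_add_le Fact.out x.compact y.compact)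
      neg' := fun x => by rw [map_neg, eSchattenNorm_neg]
      eq_zero_of_map_eq_zero' := fun x hx => by
        apply toOp_injective
        rw [map_zero]
        have h0 : eSchattenNorm p (toOp x) = 0 :=
          ((ENNReal.toReal_eq_zero_iff _).1 hx).resolve_right x.lt_top.ne
        ext v
        have := enorm_apply_le (p := p) Fact.out x.compact v
        rw [h0, zero_mul] at this
        simpa using this }

theorem norm_def (x : SchattenClass p H) : ‖x‖ = (eSchattenNorm p (toOp x)).toReal := rfl

theorem enorm_def (x : SchattenClass p H) : ‖x‖ₑ = eSchattenNorm p (toOp x) := by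
  rw [← ofReal_norm, norm_def, ENNReal.ofReal_toReal x.lt_top.ne]

noncomputable instance : NormedSpace ℂ (SchattenClass p H) where
  norm_smul_le c x := by
    rw [norm_def, norm_def, map_smul, ← toReal_enorm c, ← ENNReal.toReal_mul]
    exact ENNReal.toReal_mono (ENNReal.mul_lt_top enorm_lt_top x.lt_top).ne
      (eSchattenNorm_smul_le Fact.out x.compact c)

/-- The rank one operator `v ↦ ⟪y, v⟫ x` as an element of `S^p(H)`. -/
noncomputable def rankOne (x y : H) : SchattenClass p H :=
  mk (InnerProductSpace.rankOne ℂ x y) ((eSchattenNorm_rankOne_le Fact.out x y).trans_lt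
    (ENNReal.mul_lt_top enorm_lt_top enorm_lt_top))

theorem norm_rankOne_le (x y : H) : ‖(rankOne x y : SchattenClass p H)‖ ≤ ‖x‖ * ‖y‖ := by
  rw [norm_def, ← toReal_enorm x, ← toReal_enorm y, ← ENNReal.toReal_mul]
  exact ENNReal.toReal_mono (ENNReal.mul_lt_top enorm_lt_top enorm_lt_top).ne
    (eSchattenNorm_rankOne_le Fact.out x y)

theorem rankOne_add_left (x x' y : H) :
    (rankOne (x + x') y : SchattenClass p H) = rankOne x y + rankOne x' y := by
  apply toOp_injective
  rw [map_add]
  simp only [rankOne, toOp_mk]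
  rw [map_add]; rfl

theorem rankOne_add_right (x y y' : H) :
    (rankOne x (y + y') : SchattenClass p H) = rankOne x y + rankOne x y' := by
  apply toOp_injective
  rw [map_add]
  simp only [rankOne, toOp_mk]
  rw [map_add]

theorem rankOne_sub_left (x x' y : H) :
    (rankOne (x - x') y : SchattenClass p H) = rankOne x y - rankOne x' y := by
  rw [eq_sub_iff_add_eq, ← rankOne_add_left, sub_add_cancel]

theorem rankOne_sub_right (x y y' : H) :
    (rankOne x (y - y') : SchattenClass p H) = rankOne x y - rankOne x y' := by
  rw [eq_sub_iff_add_eq, ← rankOne_add_right, sub_add_cancel]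

/-- A closed subspace of `S^p(H)` that contains the rank one operators is everything. -/
theorem mem_of_rankOne_mem {M : Submodule ℂ (SchattenClass p H)}
    (hM : IsClosed (M : Set (SchattenClass p H))) (h : ∀ x y, rankOne x y ∈ M)
    (z : SchattenClass p H) : z ∈ M := by
  rw [← SetLike.mem_coe, ← hM.closure_eq, Metric.mem_closure_iff]
  intro ε hε
  obtain ⟨n, x, y, hxy⟩ := exists_sum_rankOne (p := p) Fact.out z.lt_top
    (ENNReal.ofReal_pos.2 hε)
  refine ⟨∑ i, rankOne (x i) (y i), M.sum_mem fun i _ => h _ _, ?_⟩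
  rw [dist_eq_norm, norm_def, map_sub, map_sum]
  simp only [rankOne, toOp_mk]
  exact (ENNReal.toReal_lt_of_lt_ofReal hxy)

end SchattenClass

end SchattenClass

section Tensor

variable (K H : Type*) [NormedAddCommGroup K] [InnerProductSpace ℂ K]
  [NormedAddCommGroup H] [InnerProductSpace ℂ H]

/-- The Hilbert space tensor product `K ⊗₂ H`. -/
abbrev HilbertTensor : Type _ := UniformSpace.Completion (K ⊗[ℂ] H)

variable {K H}

/-- The elementary tensor `ξ ⊗ h` in `K ⊗₂ H`. -/
noncomputable def tmul (ξ : K) (h : H) : HilbertTensor K H := ((ξ ⊗ₜ[ℂ] h : K ⊗[ℂ] H) : _)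

/-- `z` is the operator `a ⊗ b` on `K ⊗₂ H`: it maps `ξ ⊗ h` to `a ξ ⊗ b h`. -/
def IsTensor (a : K →L[ℂ] K) (b : H →L[ℂ] H) (z : HilbertTensor K H →L[ℂ] HilbertTensor K H) :
    Prop :=
  ∀ ξ h, z (tmul ξ h) = tmul (a ξ) (b h)

/-- A closed subspace of `K ⊗₂ H` that contains the elementary tensors is everything. -/
theorem mem_of_tmul_mem {M : Submodule ℂ (HilbertTensor K H)}
    (hM : IsClosed (M : Set (HilbertTensor K H))) (h : ∀ ξ k, tmul ξ k ∈ M)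
    (z : HilbertTensor K H) : z ∈ M := by
  induction z using UniformSpace.Completion.induction_on with
  | hp => exact hM
  | ih u =>
    induction u using TensorProduct.induction_on with
    | zero => rw [UniformSpace.Completion.coe_zero]; exact M.zero_mem
    | tmul x y => exact h x y
    | add x y hx hy => rw [UniformSpace.Completion.coe_add]; exact M.add_mem hx hy

theorem IsTensor.unique {a : K →L[ℂ] K} {b : H →L[ℂ] H}
    {z z' : HilbertTensor K H →L[ℂ] HilbertTensor K H} (hz : IsTensor a b z)
    (hz' : IsTensor a b z') : z = z' := by
  ext u
  have := mem_of_tmul_mem (M := LinearMap.ker ((z - z' : HilbertTensor K H →L[ℂ] _) :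
      HilbertTensor K H →ₗ[ℂ] HilbertTensor K H)) (z - z').isClosed_ker
    (fun ξ k => by
      rw [LinearMap.mem_ker]
      change z (tmul ξ k) - z' (tmul ξ k) = 0
      rw [hz, hz', sub_self]) u
  exact sub_eq_zero.1 this

theorem isTensor_rankOne (ξ η : K) (h k : H) :
    IsTensor (InnerProductSpace.rankOne ℂ ξ η) (InnerProductSpace.rankOne ℂ h k)
      (InnerProductSpace.rankOne ℂ (tmul ξ h) (tmul η k)) := by
  intro ξ' h'
  rw [InnerProductSpace.rankOne_apply, InnerProductSpace.rankOne_apply,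
    InnerProductSpace.rankOne_apply]
  simp only [tmul]
  rw [UniformSpace.Completion.inner_coe, TensorProduct.inner_tmul, TensorProduct.smul_tmul_smul,
    UniformSpace.Completion.coe_smul]

theorem isTensor_add_right {a : K →L[ℂ] K} {b b' : H →L[ℂ] H} {z z' : HilbertTensor K H →L[ℂ] HilbertTensor K H}
    (hz : IsTensor a b z) (hz' : IsTensor a b' z') : IsTensor a (b + b') (z + z') := by
  intro ξ h
  rw [add_apply, hz, hz', add_apply]
  simp only [tmul]
  rw [TensorProduct.tmul_add, UniformSpace.Completion.coe_add]

theorem isTensor_smul_right {a : K →L[ℂ] K} {b : H →L[ℂ] H} {z : HilbertTensor K H →L[ℂ] HilbertTensor K H}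
    (hz : IsTensor a b z) (c : ℂ) : IsTensor a (c • b) (c • z) := by
  intro ξ h
  rw [smul_apply, hz, smul_apply]
  simp only [tmul]
  rw [TensorProduct.tmul_smul, UniformSpace.Completion.coe_smul]

theorem rankOne_tmul_mem {p : ℝ} [Fact (1 ≤ p)]
    {M : Submodule ℂ (SchattenClass p (HilbertTensor K H))}
    (hM : IsClosed (M : Set (SchattenClass p (HilbertTensor K H))))
    (h : ∀ ξ η h k, SchattenClass.rankOne (tmul ξ h) (tmul η k) ∈ M)
    (z : SchattenClass p (HilbertTensor K H)) : z ∈ M := by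
  have smul_left : ∀ (c : ℂ) (x y : HilbertTensor K H),
      (SchattenClass.rankOne (c • x) y : SchattenClass p _) = c • SchattenClass.rankOne x y := by
    intro c x y
    apply SchattenClass.toOp_injective
    rw [map_smul]
    simp only [SchattenClass.rankOne, SchattenClass.toOp_mk]
    rw [map_smul]; rfl
  have smul_right : ∀ (c : ℂ) (x y : HilbertTensor K H),
      (SchattenClass.rankOne x (c • y) : SchattenClass p _) =
        (starRingEnd ℂ c) • SchattenClass.rankOne x y := by
    intro c x y
    apply SchattenClass.toOp_injective
    rw [map_smul]
    simp only [SchattenClass.rankOne, SchattenClass.toOp_mk]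
    rw [map_smulₛₗ]
  have zero_left : ∀ y : HilbertTensor K H,
      (SchattenClass.rankOne 0 y : SchattenClass p _) = 0 := fun y => by
    have := smul_left 0 0 y
    simpa using this
  have zero_right : ∀ y : HilbertTensor K H,
      (SchattenClass.rankOne y 0 : SchattenClass p _) = 0 := fun y => by
    have := smul_right 0 y 0
    simpa using this
  have cont_left : ∀ y : HilbertTensor K H, Continuous fun x : HilbertTensor K H =>
      (SchattenClass.rankOne x y : SchattenClass p _) := fun y => by
    refine (LipschitzWith.of_dist_le_mul (K := ‖y‖₊) fun x x' => ?_).continuous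
    rw [dist_eq_norm, ← SchattenClass.rankOne_sub_left, dist_eq_norm, mul_comm]
    exact SchattenClass.norm_rankOne_le _ _
  have cont_right : ∀ x : HilbertTensor K H, Continuous fun y : HilbertTensor K H =>
      (SchattenClass.rankOne x y : SchattenClass p _) := fun x => by
    refine (LipschitzWith.of_dist_le_mul (K := ‖x‖₊) fun y y' => ?_).continuous
    rw [dist_eq_norm, ← SchattenClass.rankOne_sub_right, dist_eq_norm]
    exact SchattenClass.norm_rankOne_le _ _
  have h1 : ∀ x η k, SchattenClass.rankOne x (tmul η k) ∈ M := by
    intro x η k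
    let N : Submodule ℂ (HilbertTensor K H) :=
      { carrier := {x | SchattenClass.rankOne x (tmul η k) ∈ M}
        add_mem' := fun {x y} hx hy => by
          simp only [Set.mem_ofPred_eq] at hx hy ⊢
          rw [SchattenClass.rankOne_add_left]; exact M.add_mem hx hy
        zero_mem' := by
          simp only [Set.mem_ofPred_eq]
          rw [zero_left]; exact M.zero_mem
        smul_mem' := fun c x hx => by
          simp only [Set.mem_ofPred_eq] at hx ⊢
          rw [smul_left]; exact M.smul_mem _ hx }
    exact mem_of_tmul_mem (M := N) (hM.preimage (cont_left _)) (fun ξ h' => h ξ η h' k) x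
  refine SchattenClass.mem_of_rankOne_mem hM (fun x y => ?_) z
  let N : Submodule ℂ (HilbertTensor K H) :=
    { carrier := {y | SchattenClass.rankOne x y ∈ M}
      add_mem' := fun {y y'} hx hy => by
        simp only [Set.mem_ofPred_eq] at hx hy ⊢
        rw [SchattenClass.rankOne_add_right]; exact M.add_mem hx hy
      zero_mem' := by
        simp only [Set.mem_ofPred_eq]
        rw [zero_right]; exact M.zero_mem
      smul_mem' := fun c y hx => by
        simp only [Set.mem_ofPred_eq] at hx ⊢
        rw [smul_right]; exact M.smul_mem _ hx }
  exact mem_of_tmul_mem (M := N) (hM.preimage (cont_right _)) (fun η k => h1 x η k) y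

end Tensor

section CompletelyBounded

variable {p : ℝ} [Fact (1 ≤ p)]
variable {H : Type*} [NormedAddCommGroup H] [InnerProductSpace ℂ H] [CompleteSpace H]

/-- `Φ` is a bounded operator on `S^p(K ⊗₂ H)` that extends `id ⊗ T`, that is, `Φ (a ⊗ b) = a ⊗ T b`
for all `a ∈ S^p(K)` and `b ∈ S^p(H)`. Here the algebraic tensor product `S^p(K) ⊗ S^p(H)` is viewed
as a dense subspace of `S^p(K ⊗₂ H)`; so there is at most one such `Φ`, see
`IsAmpliation.unique`. -/
def IsAmpliation (K : Type*) [NormedAddCommGroup K] [InnerProductSpace ℂ K] [CompleteSpace K]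
    (T : SchattenClass p H →L[ℂ] SchattenClass p H)
    (Φ : SchattenClass p (HilbertTensor K H) →L[ℂ] SchattenClass p (HilbertTensor K H)) : Prop :=
  ∀ (a : SchattenClass p K) (b : SchattenClass p H) (z : SchattenClass p (HilbertTensor K H)),
    IsTensor a.toOp b.toOp z.toOp → IsTensor a.toOp (T b).toOp (Φ z).toOp

/-- The bounded extension of `id ⊗ T` is unique. -/
theorem IsAmpliation.unique {K : Type*} [NormedAddCommGroup K] [InnerProductSpace ℂ K]
    [CompleteSpace K] {T : SchattenClass p H →L[ℂ] SchattenClass p H}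
    {Φ Φ' : SchattenClass p (HilbertTensor K H) →L[ℂ] SchattenClass p (HilbertTensor K H)}
    (h : IsAmpliation K T Φ) (h' : IsAmpliation K T Φ') : Φ = Φ' := by
  ext1 z
  have := rankOne_tmul_mem (M := LinearMap.ker ((Φ - Φ' : SchattenClass p (HilbertTensor K H) →L[ℂ]
      SchattenClass p (HilbertTensor K H)) : SchattenClass p (HilbertTensor K H) →ₗ[ℂ]
      SchattenClass p (HilbertTensor K H))) (Φ - Φ').isClosed_ker (fun ξ η k l => by
    rw [LinearMap.mem_ker]
    change Φ _ - Φ' _ = 0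
    rw [sub_eq_zero]
    apply SchattenClass.toOp_injective
    have ht : IsTensor (SchattenClass.rankOne ξ η : SchattenClass p K).toOp
        (SchattenClass.rankOne k l : SchattenClass p H).toOp
        (SchattenClass.rankOne (tmul ξ k) (tmul η l) :
          SchattenClass p (HilbertTensor K H)).toOp := isTensor_rankOne ξ η k l
    exact (h _ _ _ ht).unique (h' _ _ _ ht)) z
  exact sub_eq_zero.1 this

theorem IsAmpliation.add {K : Type*} [NormedAddCommGroup K] [InnerProductSpace ℂ K]
    [CompleteSpace K] {T T' : SchattenClass p H →L[ℂ] SchattenClass p H}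
    {Φ Φ' : SchattenClass p (HilbertTensor K H) →L[ℂ] SchattenClass p (HilbertTensor K H)}
    (h : IsAmpliation K T Φ) (h' : IsAmpliation K T' Φ') : IsAmpliation K (T + T') (Φ + Φ') :=
  fun a b z hz => by
    rw [add_apply, add_apply, map_add, map_add]
    exact isTensor_add_right (h a b z hz) (h' a b z hz)

theorem IsAmpliation.smul {K : Type*} [NormedAddCommGroup K] [InnerProductSpace ℂ K]
    [CompleteSpace K] {T : SchattenClass p H →L[ℂ] SchattenClass p H}
    {Φ : SchattenClass p (HilbertTensor K H) →L[ℂ] SchattenClass p (HilbertTensor K H)}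
    (h : IsAmpliation K T Φ) (c : ℂ) : IsAmpliation K (c • T) (c • Φ) :=
  fun a b z hz => by
    rw [smul_apply, smul_apply, map_smul, map_smul]
    exact isTensor_smul_right (h a b z hz) c

variable (p H)

/-- The space `CB(S^p(H), S^p(H))` of completely bounded maps: for every Hilbert space `K`, the map
`id ⊗ T` on `S^p(K) ⊗ S^p(H)` extends to a bounded map on `S^p(K ⊗₂ H)`. The universe of `K` is no
restriction, since `K = ℓ²` already gives both the condition and the norm `‖T‖_cb`. -/
noncomputable def CB : Submodule ℂ (SchattenClass p H →L[ℂ] SchattenClass p H) where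
  carrier := {T | ∀ (K : Type) [NormedAddCommGroup K] [InnerProductSpace ℂ K] [CompleteSpace K],
    ∃ Φ, IsAmpliation K T Φ}
  add_mem' := fun hT hT' K _ _ _ => by
    obtain ⟨Φ, h⟩ := hT K
    obtain ⟨Φ', h'⟩ := hT' K
    exact ⟨_, h.add h'⟩
  zero_mem' := fun K _ _ _ => ⟨0, fun a b z _ ξ h => by
    change (SchattenClass.toOp (0 : SchattenClass p (HilbertTensor K H))) (tmul ξ h) =
      tmul (a.toOp ξ) ((SchattenClass.toOp (0 : SchattenClass p H)) h)
    rw [map_zero, map_zero]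
    simp only [tmul, zero_apply, TensorProduct.tmul_zero]
    exact UniformSpace.Completion.coe_zero.symm⟩
  smul_mem' := fun c T hT K _ _ _ => by
    obtain ⟨Φ, h⟩ := hT K
    exact ⟨_, h.smul c⟩

variable {p H}

/-- The identity map of `S^p(H)` as an element of `CB(S^p(H), S^p(H))`. -/
noncomputable def idCB : CB p H :=
  ⟨ContinuousLinearMap.id ℂ _, fun _ _ _ _ => ⟨ContinuousLinearMap.id ℂ _, fun _ _ _ h => h⟩⟩

/-- The bounded extension of `id ⊗ T` to `S^p(K ⊗₂ H)`, as a linear function of the completely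
bounded map `T`. -/
noncomputable def ampliation (K : Type) [NormedAddCommGroup K] [InnerProductSpace ℂ K]
    [CompleteSpace K] :
    CB p H →ₗ[ℂ]
      (SchattenClass p (HilbertTensor K H) →L[ℂ] SchattenClass p (HilbertTensor K H)) where
  toFun T := (T.2 K).choose
  map_add' T T' := ((T + T').2 K).choose_spec.unique
    ((T.2 K).choose_spec.add (T'.2 K).choose_spec)
  map_smul' c T := ((c • T).2 K).choose_spec.unique ((T.2 K).choose_spec.smul c)

theorem ampliation_spec (K : Type) [NormedAddCommGroup K] [InnerProductSpace ℂ K]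
    [CompleteSpace K] (T : CB p H) :
    IsAmpliation K (T : SchattenClass p H →L[ℂ] SchattenClass p H) (ampliation K T) :=
  (T.2 K).choose_spec

/-- The completely bounded norm `‖T‖_cb`, the supremum over all Hilbert spaces `K` of the norm of
`id ⊗ T` on `S^p(K ⊗₂ H)`. -/
noncomputable def cbNorm (T : CB p H) : ℝ≥0∞ :=
  ⨆ (K : Type) (_ : NormedAddCommGroup K) (_ : InnerProductSpace ℂ K) (_ : CompleteSpace K),
    ‖ampliation K T‖ₑ

/-- The Hilbert space `ℓ²`. -/
abbrev EllTwo : Type := lp (fun _ : ℕ => ℂ) 2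

variable (p H)

/-- The sequences `(x_i)` in `c₀(S^p(ℓ² ⊗₂ H))`. -/
def NullSeq : Type _ :=
  {x : ℕ → SchattenClass p (HilbertTensor EllTwo H) // Filter.Tendsto x Filter.atTop (𝓝 0)}

variable {p H}

theorem bddAbove_stable (x : NullSeq p H) (T : CB p H) :
    BddAbove (Set.range fun i => ‖ampliation EllTwo T (x.1 i)‖) := by
  obtain ⟨C, hC⟩ := (Metric.isBounded_range_of_tendsto x.1 x.2).exists_norm_le
  refine ⟨‖ampliation EllTwo T‖ * C, ?_⟩
  rintro _ ⟨i, rfl⟩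
  exact (ContinuousLinearMap.le_opNorm _ _).trans (by gcongr; exact hC _ ⟨i, rfl⟩)

/-- The seminorm `T ↦ sup_i ‖(id ⊗ T)(x_i)‖_p` on `CB(S^p(H), S^p(H))`. -/
noncomputable def stableSeminorm (x : NullSeq p H) : Seminorm ℂ (CB p H) :=
  Seminorm.of (fun T => ⨆ i, ‖ampliation EllTwo T (x.1 i)‖)
    (fun T T' => by
      refine ciSup_le fun i => ?_
      rw [map_add, add_apply]
      exact (norm_add_le _ _).trans (add_le_add (le_ciSup (bddAbove_stable x T) i)
        (le_ciSup (bddAbove_stable x T') i)))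
    (fun c T => by
      simp_rw [map_smul, smul_apply, norm_smul]
      exact (Real.mul_iSup_of_nonneg (norm_nonneg c) _).symm)

noncomputable instance : Nonempty (NullSeq p H) := ⟨⟨fun _ => 0, tendsto_const_nhds⟩⟩

variable (p H)

/-- The stable point-norm topology on `CB(S^p(H), S^p(H))`: the locally convex topology defined by
the seminorms `T ↦ sup_i ‖(id ⊗ T)(x_i)‖_p`, for `(x_i)` in `c₀(S^p(ℓ² ⊗₂ H))`. -/
@[reducible] noncomputable def stableTopology : TopologicalSpace (CB p H) :=
  (SeminormFamily.moduleFilterBasis (fun x : NullSeq p H => stableSeminorm x)).topology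

end CompletelyBounded

end Schatten

/-! Suppose the identity is not in the stable closure of the cb-unit ball of `F₀`. Hahn–Banach gives
a stably continuous real functional `f` and `u > 0` with `f < u` on that ball and `u < f(id)`. By
homogeneity `f ≤ u ‖·‖` on `F₀`, so `f` restricted to `F₀` extends to a functional `φ ≤ u ‖·‖` on
all completely bounded maps. This `φ` is only norm bounded. The heart of the proof
(`exists_stable_extension`) replaces it by a stably continuous `g` that has the same values on
finite rank operators and satisfies `g(id) ≤ u`. Then `f = g` on `F₀`, hence at the identity, which
lies in the stable closure of `F₀`; so `f(id) ≤ u`, a contradiction.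

The functional `g` is a limit of `T ↦ φ(P T P)`, where `P` is a compression `z ↦ Q z Q` by a finite
rank projection `Q`. The operators `P T P` fill a finite-dimensional space, so their norms are
tested at finitely many points and each `T ↦ φ(P T P)` is stably continuous. If `φ(P · P)` is close
to `φ` in norm on finite rank operators, at a geometric rate along a sequence of projections, the
limit exists on all completely bounded maps and is dominated by a single stable seminorm. As `P` is
a contraction, `φ(P P) ≤ u`, which gives `g(id) ≤ u`.

The norm approximation (`exists_finProj_sub_conj_le`) rests on the geometry of `S^p`. Splitting an
operator along a projection obeys estimates of power type: with exponent `max p 2` from below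
(`norm_compress_add_le`) and `min p 2` from above (`norm_le_compress_add`). As `min p 2 > 1`, adding
to a compressed contraction a small multiple `t` of something outside the compression increases the
norm by at most `δ t` (`exists_smooth`, `exists_convex`). If `φ` almost attains its norm on the
finite rank operators at a compressed operator, it therefore cannot be large on what lies outside
the compression. Such a compressed operator exists because finite rank operators are norm limits of
their compressions (`tendsto_norm_ampliation_sub_conj`), which uses the same argument on the dual of
`S^p`.

All these estimates apply to `S^p(ℓ² ⊗₂ H)` with the projection `1 ⊗ Q`, and the ampliation by `ℓ²`
already dominates the cb norm (`IsAmpliation.norm_le_ellTwo`), so the norm of that single ampliation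
is used throughout. -/

namespace Schatten

/-! ### Bessel families, contractions and adjoints -/

section Bessel

variable {H : Type*} [NormedAddCommGroup H] [InnerProductSpace ℂ H]

/-- A family of vectors that satisfies Bessel's inequality. -/
def IsBessel {κ : Type*} (e : κ → H) : Prop :=
  ∀ x, ∑' i, ‖⟪e i, x⟫_ℂ‖ₑ ^ 2 ≤ ‖x‖ₑ ^ 2

theorem isBessel_of_orthonormal {κ : Type*} {e : κ → H} (he : Orthonormal ℂ e) : IsBessel e :=
  fun x => bessel he x

/-- Bessel's inequality tested on `e i` itself gives `‖e i‖⁴ ≤ ‖e i‖²`. -/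
theorem IsBessel.enorm_sq_le_one {κ : Type*} {e : κ → H} (he : IsBessel e) (i : κ) :
    ‖e i‖ₑ ^ 2 ≤ 1 := by
  have h := (ENNReal.le_tsum (f := fun j => ‖⟪e j, e i⟫_ℂ‖ₑ ^ 2) i).trans (he (e i))
  have h1 : ‖⟪e i, e i⟫_ℂ‖ₑ = ‖e i‖ₑ ^ 2 := by
    rw [← ofReal_norm, inner_self_eq_norm_sq_to_K]
    simp [ENNReal.ofReal_pow]
  simp only [h1] at h
  rcases eq_or_ne (‖e i‖ₑ ^ 2) 0 with h0 | h0
  · simp [h0]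
  · have ht : ‖e i‖ₑ ^ 2 ≠ ⊤ := by simp
    rw [sq (‖e i‖ₑ ^ 2)] at h
    by_contra hc
    push Not at hc
    exact absurd h (not_le.2 (by simpa using ENNReal.mul_lt_mul_right h0 ht hc))

variable [CompleteSpace H]

/-- Passing to the adjoint moves `B` onto the test vector. Orthonormality does not survive a
contraction, but Bessel's inequality does; this is the reason for working with Bessel families. -/
theorem IsBessel.map {κ : Type*} {K : Type*} [NormedAddCommGroup K] [InnerProductSpace ℂ K]
    [CompleteSpace K] {e : κ → H} (he : IsBessel e) {B : H →L[ℂ] K} (hB : ‖B‖ ≤ 1) :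
    IsBessel fun i => B (e i) := by
  intro x
  have h : ∀ i, ⟪B (e i), x⟫_ℂ = ⟪e i, B.adjoint x⟫_ℂ := fun i =>
    (B.adjoint_inner_right _ _).symm
  simp_rw [h]
  refine (he _).trans ?_
  gcongr
  rw [enorm_le_iff_norm_le]
  exact (B.adjoint.le_opNorm x).trans (by
    rw [LinearIsometryEquiv.norm_map]
    exact mul_le_of_le_one_left (norm_nonneg _) hB)

/-- Matrix coefficients are averages of singular values with doubly substochastic weights, and `t ↦
t ^ p` is convex. Only Bessel's inequality for the two families enters. -/
theorem tsum_le_of_isBessel {p : ℝ} (hp : 1 ≤ p) {A : H →L[ℂ] H} (hA : IsCompactOperator A)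
    {κ : Type*} {e f : κ → H} (he : IsBessel e) (hf : IsBessel f) :
    ∑' i, ‖⟪f i, A (e i)⟫_ℂ‖ₑ ^ p ≤ eSchattenNorm p A ^ p := by
  obtain ⟨w, g, l, hl, h⟩ := exists_singular_basis hA
  have hp0 : 0 < p := by linarith
  rw [eSchattenNorm_of_eigen hp g hl h, one_div, ENNReal.rpow_inv_rpow hp0.ne']
  have ho := orthonormal_singular g h
  -- Weights from the expansion of `A` in its singular vectors `g k` and `(l k)⁻¹ • A (g k)`.
  -- Cauchy–Schwarz and Bessel bound the row and column sums by one.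
  let W : κ → {i // l i ≠ 0} → ℝ≥0∞ :=
    fun i k => ‖⟪g k, e i⟫_ℂ‖ₑ * ‖⟪(l k)⁻¹ • A (g k), f i⟫_ℂ‖ₑ
  have key : ∀ i, ‖⟪f i, A (e i)⟫_ℂ‖ₑ ≤
      ∑' k : {i // l i ≠ 0}, W i k * ENNReal.ofReal (l k) := by
    intro i
    have h1 : HasSum (fun k => ⟪g k, e i⟫_ℂ * ⟪f i, A (g k)⟫_ℂ) ⟪f i, A (e i)⟫_ℂ := by
      have := ((g.hasSum_repr (e i)).mapL A).mapL (innerSL ℂ (f i))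
      simpa [HilbertBasis.repr_apply_apply, inner_smul_right] using this
    have h2 : HasSum (fun k : {i // l i ≠ 0} => ⟪g k, e i⟫_ℂ * ⟪f i, A (g k)⟫_ℂ)
        ⟪f i, A (e i)⟫_ℂ := by
      refine (hasSum_subtype_iff_of_support_subset (s := {i | l i ≠ 0}) ?_).2 h1
      intro k hk
      simp only [Function.mem_support] at hk
      intro h0
      apply hk
      rw [apply_eq_zero_of_singular g h h0]; simp
    rw [← h2.tsum_eq]
    refine enorm_tsum_le_tsum_enorm.trans (le_of_eq (tsum_congr fun k => ?_))
    have hk : 0 < l k := lt_of_le_of_ne (hl k) (Ne.symm k.2)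
    have h3 : ‖⟪f i, A (g k)⟫_ℂ‖ₑ =
        ‖⟪(l k)⁻¹ • A (g k), f i⟫_ℂ‖ₑ * ENNReal.ofReal (l k) := by
      rw [inner_smul_left_eq_smul, enorm_smul, enorm_inner_symm,
        mul_comm, ← mul_assoc, ← Real.enorm_of_nonneg hk.le, ← enorm_mul, mul_inv_cancel₀ hk.ne']
      simp
    rw [enorm_mul, h3, ← mul_assoc]
  have hW1 : ∀ i, ∑' k, W i k ≤ 1 := fun i =>
    tsum_mul_le_one ((bessel (g.orthonormal.comp (Subtype.val : {i // l i ≠ 0} → w)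
      Subtype.val_injective) (e i)).trans (he.enorm_sq_le_one i))
      ((bessel ho (f i)).trans (hf.enorm_sq_le_one i))
  have hW2 : ∀ k, ∑' i, W i k ≤ 1 := by
    intro k
    refine tsum_mul_le_one (le_of_eq_of_le ?_ ((he (g k)).trans
      ((isBessel_of_orthonormal g.orthonormal).enorm_sq_le_one k)))
      (le_of_eq_of_le ?_ ((hf ((l k)⁻¹ • A (g k))).trans
      ((isBessel_of_orthonormal ho).enorm_sq_le_one k)))
    · exact tsum_congr fun i => by rw [enorm_inner_symm (e i)]
    · exact tsum_congr fun i => by rw [enorm_inner_symm (f i)]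
  calc ∑' i, ‖⟪f i, A (e i)⟫_ℂ‖ₑ ^ p
      ≤ ∑' i, (∑' k : {i // l i ≠ 0}, W i k * ENNReal.ofReal (l k)) ^ p :=
        ENNReal.tsum_le_tsum fun i => ENNReal.rpow_le_rpow (key i) hp0.le
    _ ≤ ∑' k : {i // l i ≠ 0}, ENNReal.ofReal (l k) ^ p :=
        doubly_substochastic hp W _ hW1 hW2
    _ ≤ ∑' k, ENNReal.ofReal (l k) ^ p :=
        ENNReal.tsum_comp_le_tsum_of_injective (f := Subtype.val) Subtype.val_injective
          (fun k => ENNReal.ofReal (l k) ^ p)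

variable {K : Type*} [NormedAddCommGroup K] [InnerProductSpace ℂ K] [CompleteSpace K]

/-- The coefficients of `A z B` along orthonormal families are those of `z` along the Bessel
families `B e` and `A* f`. -/
theorem eSchattenNorm_sandwich_le_of_contraction {p : ℝ} (hp : 1 ≤ p) {z : H →L[ℂ] H}
    (hz : IsCompactOperator z) {A : H →L[ℂ] K} {B : K →L[ℂ] H} (hA : ‖A‖ ≤ 1) (hB : ‖B‖ ≤ 1) :
    eSchattenNorm p (A ∘L z ∘L B) ≤ eSchattenNorm p z := by
  have hp0 : 0 < p := by linarith
  refine eSchattenNorm_le hp ((hz.comp_clm B).clm_comp A) fun n e f he hf => ?_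
  rw [one_div, ENNReal.rpow_inv_le_iff hp0]
  have := tsum_le_of_isBessel hp hz ((isBessel_of_orthonormal he).map hB)
    ((isBessel_of_orthonormal hf).map (B := A.adjoint) (by rwa [LinearIsometryEquiv.norm_map]))
  rw [tsum_fintype] at this
  simpa only [ContinuousLinearMap.adjoint_inner_left, ContinuousLinearMap.comp_apply] using this

theorem isCompactOperator_star {z : H →L[ℂ] H} (hz : IsCompactOperator z) :
    IsCompactOperator (star z : H →L[ℂ] H) := by
  apply compact_of_star_mul_self
  rw [star_star]
  exact hz.comp_clm (star z)

/-- Adjunction exchanges the two test families and leaves the moduli of the coefficients unchanged.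
-/
theorem eSchattenNorm_star_le {p : ℝ} (hp : 1 ≤ p) {z : H →L[ℂ] H}
    (hz : IsCompactOperator z) : eSchattenNorm p z ≤ eSchattenNorm p (star z) := by
  have hp0 : 0 < p := by linarith
  refine eSchattenNorm_le hp hz fun n e f he hf => ?_
  rw [one_div, ENNReal.rpow_inv_le_iff hp0]
  have := tsum_le_of_isBessel hp (isCompactOperator_star hz)
    (isBessel_of_orthonormal hf) (isBessel_of_orthonormal he)
  rw [tsum_fintype] at this
  refine le_of_eq_of_le (Finset.sum_congr rfl fun i _ => ?_) this
  rw [ContinuousLinearMap.star_eq_adjoint, ContinuousLinearMap.adjoint_inner_right,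
    enorm_inner_symm]

theorem eSchattenNorm_star {p : ℝ} (hp : 1 ≤ p) {z : H →L[ℂ] H} (hz : IsCompactOperator z) :
    eSchattenNorm p (star z) = eSchattenNorm p z := by
  refine le_antisymm ?_ (eSchattenNorm_star_le hp hz)
  have := eSchattenNorm_star_le hp (isCompactOperator_star hz)
  rwa [star_star] at this

end Bessel

/-! ### Two-sided multiplication on the Schatten class -/

section Sandwich

variable {p : ℝ} [Fact (1 ≤ p)]
variable {H : Type*} [NormedAddCommGroup H] [InnerProductSpace ℂ H] [CompleteSpace H]
variable {K : Type*} [NormedAddCommGroup K] [InnerProductSpace ℂ K] [CompleteSpace K]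

namespace SchattenClass

theorem eSchattenNorm_sandwich_le (A : H →L[ℂ] K) (B : K →L[ℂ] H) (z : SchattenClass p H) :
    eSchattenNorm p (A ∘L z.toOp ∘L B) ≤ ‖A‖ₑ * ‖B‖ₑ * eSchattenNorm p z.toOp := by
  have hp : 1 ≤ p := Fact.out
  rcases eq_or_ne A 0 with rfl | hA
  · simp [eSchattenNorm_zero hp]
  rcases eq_or_ne B 0 with rfl | hB
  · simp [eSchattenNorm_zero hp]
  have hA' : ‖A‖ ≠ 0 := norm_ne_zero_iff.2 hA
  have hB' : ‖B‖ ≠ 0 := norm_ne_zero_iff.2 hB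
  have h1 := eSchattenNorm_sandwich_le_of_contraction hp z.compact
    (A := ((‖A‖ : ℂ)⁻¹) • A) (B := ((‖B‖ : ℂ)⁻¹) • B)
    (by rw [norm_smul]; simp [hA']) (by rw [norm_smul]; simp [hB'])
  have hc : IsCompactOperator ((((‖A‖ : ℂ)⁻¹) • A) ∘L z.toOp ∘L (((‖B‖ : ℂ)⁻¹) • B)) :=
    (z.compact.comp_clm (((‖B‖ : ℂ)⁻¹) • B)).clm_comp (((‖A‖ : ℂ)⁻¹) • A)
  have h2 := eSchattenNorm_smul_le hp hc ((‖A‖ : ℂ) * (‖B‖ : ℂ))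
  have h3 : ((‖A‖ : ℂ) * (‖B‖ : ℂ)) •
      ((((‖A‖ : ℂ)⁻¹) • A) ∘L z.toOp ∘L (((‖B‖ : ℂ)⁻¹) • B)) = A ∘L z.toOp ∘L B := by
    have hA2 : (‖A‖ : ℂ) ≠ 0 := by exact_mod_cast hA'
    have hB2 : (‖B‖ : ℂ) ≠ 0 := by exact_mod_cast hB'
    ext x
    simp only [smul_apply, ContinuousLinearMap.comp_apply, map_smul, smul_smul]
    convert one_smul ℂ _ using 2
    field_simp
  rw [h3] at h2
  refine h2.trans ?_
  rw [enorm_mul]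
  have hn : ∀ r : ℝ, 0 ≤ r → ‖(r : ℂ)‖ₑ = ENNReal.ofReal r := fun r hr => by
    rw [← ofReal_norm, Complex.norm_real, Real.norm_of_nonneg hr]
  rw [hn _ (norm_nonneg _), hn _ (norm_nonneg _), ofReal_norm, ofReal_norm]
  gcongr

/-- The operator `z ↦ A z B` from `S^p(H)` to `S^p(K)`. -/
noncomputable def sandwich (A : H →L[ℂ] K) (B : K →L[ℂ] H) :
    SchattenClass p H →L[ℂ] SchattenClass p K :=
  LinearMap.mkContinuous
    { toFun := fun z => mk (A ∘L z.toOp ∘L B) ((eSchattenNorm_sandwich_le A B z).trans_lt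
        (ENNReal.mul_lt_top (ENNReal.mul_lt_top enorm_lt_top enorm_lt_top) z.lt_top))
      map_add' := fun x y => by
        apply toOp_injective
        ext v
        change A (toOp (x + y) (B v)) = A (toOp x (B v)) + A (toOp y (B v))
        rw [map_add, add_apply, map_add]
      map_smul' := fun c x => by
        apply toOp_injective
        ext v
        change A (toOp (c • x) (B v)) = c • A (toOp x (B v))
        rw [map_smul, smul_apply, map_smul] }
    (‖A‖ * ‖B‖) (fun z => by
      rw [norm_def, norm_def, ← toReal_enorm A, ← toReal_enorm B, ← ENNReal.toReal_mul,
        ← ENNReal.toReal_mul]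
      exact ENNReal.toReal_mono (ENNReal.mul_lt_top (ENNReal.mul_lt_top enorm_lt_top enorm_lt_top)
        z.lt_top).ne (eSchattenNorm_sandwich_le A B z))

theorem toOp_sandwich (A : H →L[ℂ] K) (B : K →L[ℂ] H) (z : SchattenClass p H) :
    (sandwich A B z).toOp = A ∘L z.toOp ∘L B := rfl

theorem norm_sandwich_le (A : H →L[ℂ] K) (B : K →L[ℂ] H) :
    ‖(sandwich A B : SchattenClass p H →L[ℂ] SchattenClass p K)‖ ≤ ‖A‖ * ‖B‖ :=
  LinearMap.mkContinuous_norm_le _ (by positivity) _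

theorem norm_sandwich_apply_le {A : H →L[ℂ] K} {B : K →L[ℂ] H} (hA : ‖A‖ ≤ 1) (hB : ‖B‖ ≤ 1)
    (z : SchattenClass p H) : ‖sandwich A B z‖ ≤ ‖z‖ :=
  ((sandwich A B).le_opNorm z).trans (mul_le_of_le_one_left (norm_nonneg _)
    ((norm_sandwich_le A B).trans (mul_le_one₀ hA (norm_nonneg _) hB)))

theorem sandwich_rankOne (A : H →L[ℂ] K) (B : K →L[ℂ] H) (x y : H) :
    sandwich A B (rankOne x y : SchattenClass p H) = rankOne (A x) (B.adjoint y) := by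
  apply toOp_injective
  rw [toOp_sandwich]
  simp only [rankOne, toOp_mk]
  ext v
  simp [InnerProductSpace.rankOne_apply, ContinuousLinearMap.adjoint_inner_left]

end SchattenClass

end Sandwich

/-! ### Jensen and Minkowski inequalities, and power sums of `‖A eᵢ‖` -/

section PowerSums

/-- The convex Jensen inequality with exponent `r⁻¹`, applied to `l ^ r`. -/
theorem jensen_tsum_concave {ι : Type*} {r : ℝ} (hr0 : 0 < r) (hr : r ≤ 1) (w l : ι → ℝ≥0∞)
    (hw : ∑' k, w k ≤ 1) : ∑' k, w k * l k ^ r ≤ (∑' k, w k * l k) ^ r := by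
  have h := jensen_tsum (one_le_inv_iff₀.2 ⟨hr0, hr⟩) w (fun k => l k ^ r) hw
  simp_rw [ENNReal.rpow_rpow_inv hr0.ne'] at h
  rwa [ENNReal.rpow_inv_le_iff hr0] at h

theorem minkowski_tsum {ι : Type*} {σ : ℝ} (hσ : 1 ≤ σ) (a b : ι → ℝ≥0∞) :
    (∑' i, (a i + b i) ^ σ) ^ σ⁻¹ ≤ (∑' i, a i ^ σ) ^ σ⁻¹ + (∑' i, b i ^ σ) ^ σ⁻¹ := by
  have h0 : 0 < σ := by linarith
  rw [ENNReal.rpow_inv_le_iff h0, ENNReal.tsum_eq_iSup_sum]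
  refine iSup_le fun s => ?_
  rw [← ENNReal.rpow_inv_le_iff h0]
  have := ENNReal.Lp_add_le s a b hσ
  rw [one_div] at this
  refine this.trans ?_
  gcongr <;> exact ENNReal.sum_le_tsum s

theorem minkowski_two_add {σ : ℝ} (hσ : 1 ≤ σ) (a b a' b' : ℝ≥0∞) :
    ((a + a') ^ σ + (b + b') ^ σ) ^ σ⁻¹ ≤ (a ^ σ + b ^ σ) ^ σ⁻¹ + (a' ^ σ + b' ^ σ) ^ σ⁻¹ := by
  have := ENNReal.Lp_add_le (Finset.univ : Finset (Fin 2)) ![a, b] ![a', b'] hσ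
  simpa [Fin.sum_univ_two] using this

/-- The triangle inequality for a series of vectors `(a i, b i)` in the two-dimensional `ℓ^σ`. -/
theorem minkowski_two_tsum {ι : Type*} {σ : ℝ} (hσ : 1 ≤ σ) (a b : ι → ℝ≥0∞) :
    ((∑' i, a i) ^ σ + (∑' i, b i) ^ σ) ^ σ⁻¹ ≤ ∑' i, (a i ^ σ + b i ^ σ) ^ σ⁻¹ := by
  classical
  have h0 : 0 < σ := by linarith
  have hfin : ∀ s : Finset ι, ((∑ i ∈ s, a i) ^ σ + (∑ i ∈ s, b i) ^ σ) ^ σ⁻¹ ≤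
      ∑ i ∈ s, (a i ^ σ + b i ^ σ) ^ σ⁻¹ := by
    intro s
    induction s using Finset.induction_on with
    | empty => simp [h0]
    | insert i s hi ih =>
      rw [Finset.sum_insert hi, Finset.sum_insert hi, Finset.sum_insert hi]
      exact (minkowski_two_add hσ _ _ _ _).trans (by gcongr)
  have ha : Filter.Tendsto (fun s : Finset ι => ∑ i ∈ s, a i) Filter.atTop (𝓝 (∑' i, a i)) :=
    ENNReal.summable.hasSum
  have hb : Filter.Tendsto (fun s : Finset ι => ∑ i ∈ s, b i) Filter.atTop (𝓝 (∑' i, b i)) :=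
    ENNReal.summable.hasSum
  exact le_of_tendsto (((ha.ennrpow_const σ).add (hb.ennrpow_const σ)).ennrpow_const σ⁻¹)
    (.of_forall fun s => (hfin s).trans (ENNReal.sum_le_tsum s))

variable {H : Type*} [NormedAddCommGroup H] [InnerProductSpace ℂ H] [CompleteSpace H]

/-- Writes `‖A x‖²` as a weighted mean of squared singular values. Raising to the power `p / 2` then
calls for Jensen, convex when `p ≥ 2` and concave when `p ≤ 2`; this is the source of the case
distinctions at `2`. -/
theorem enorm_sq_apply_eq_tsum {ι : Type*} {A : H →L[ℂ] H} (g : HilbertBasis ι ℂ H) {l : ι → ℝ}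
    (h : ∀ i, (star A * A) (g i) = (l i ^ 2) • g i) (x : H) :
    ‖A x‖ₑ ^ 2 = ∑' k, ‖⟪g k, x⟫_ℂ‖ₑ ^ 2 * ENNReal.ofReal (l k ^ 2) := by
  have h1 : HasSum (fun k => ⟪g k, x⟫_ℂ * ((l k ^ 2 : ℝ) * ⟪x, g k⟫_ℂ)) ⟪x, (star A * A) x⟫_ℂ := by
    have := ((g.hasSum_repr x).mapL (star A * A)).mapL (innerSL ℂ x)
    have h0 : ∀ k, innerSL ℂ x ((star A * A) (g.repr x k • g k)) =
        ⟪g k, x⟫_ℂ * ((l k ^ 2 : ℝ) * ⟪x, g k⟫_ℂ) := fun k => by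
      rw [map_smul, h, HilbertBasis.repr_apply_apply, innerSL_apply_apply, inner_smul_right,
        inner_smul_right_eq_smul, Complex.real_smul]
    simp_rw [h0] at this
    exact this
  have h2 : HasSum (fun k => ‖⟪g k, x⟫_ℂ‖ ^ 2 * l k ^ 2) (‖A x‖ ^ 2) := by
    have := RCLike.hasSum_re ℂ h1
    convert this using 1
    · ext k
      rw [← inner_conj_symm x (g k), mul_left_comm, RCLike.mul_conj]
      rw [mul_comm]
      norm_cast
      exact ((Complex.re_ofReal_mul (l k ^ 2) _).trans (congrArg _ (Complex.ofReal_re _))).symm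
    · rw [mul_apply_eq_comp, ContinuousLinearMap.star_eq_adjoint,
        ContinuousLinearMap.adjoint_inner_right, inner_self_eq_norm_sq]
  have h3 : ∀ y : H, ‖y‖ₑ ^ 2 = ENNReal.ofReal (‖y‖ ^ 2) := fun y => by
    rw [ENNReal.ofReal_pow (norm_nonneg _), ofReal_norm]
  have h4 : ∀ y : ℂ, ‖y‖ₑ ^ 2 = ENNReal.ofReal (‖y‖ ^ 2) := fun y => by
    rw [ENNReal.ofReal_pow (norm_nonneg _), ofReal_norm]
  simp_rw [h3, h4, ← ENNReal.ofReal_mul (sq_nonneg (‖_‖ : ℝ))]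
  rw [← ENNReal.ofReal_tsum_of_nonneg (fun _ => by positivity) h2.summable, h2.tsum_eq]

theorem enorm_apply_singular {ι : Type*} {A : H →L[ℂ] H} (g : HilbertBasis ι ℂ H) {l : ι → ℝ}
    (hl : ∀ i, 0 ≤ l i) (h : ∀ i, (star A * A) (g i) = (l i ^ 2) • g i) (i : ι) :
    ‖A (g i)‖ₑ = ENNReal.ofReal (l i) := by
  have h1 := inner_singular g h i i
  rw [inner_self_eq_norm_sq_to_K, inner_self_eq_norm_sq_to_K, g.orthonormal.1] at h1
  have h2 : ‖A (g i)‖ ^ 2 = l i ^ 2 := by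
    simp at h1
    exact_mod_cast h1
  rw [← ofReal_norm, (pow_left_inj₀ (norm_nonneg _) (hl i) two_ne_zero).1 h2]

theorem rpow_eq_sq_rpow (a : ℝ≥0∞) (p : ℝ) : a ^ p = (a ^ 2) ^ (p / 2) := by
  rw [← ENNReal.rpow_natCast, ← ENNReal.rpow_mul]
  congr 1
  push_cast
  ring

theorem ofReal_rpow_eq (l : ℝ) (hl : 0 ≤ l) (p : ℝ) :
    ENNReal.ofReal l ^ p = ENNReal.ofReal (l ^ 2) ^ (p / 2) := by
  rw [ENNReal.ofReal_pow hl, ← rpow_eq_sq_rpow]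

/-- For `p ≥ 2`, `∑ ‖A eᵢ‖ᵖ ≤ ‖A‖_p^p` for every Bessel family. -/
theorem tsum_enorm_apply_le {p : ℝ} (hp : 2 ≤ p) {A : H →L[ℂ] H} (hA : IsCompactOperator A)
    {κ : Type*} {e : κ → H} (he : IsBessel e) :
    ∑' i, ‖A (e i)‖ₑ ^ p ≤ eSchattenNorm p A ^ p := by
  obtain ⟨w, g, l, hl, h⟩ := exists_singular_basis hA
  have hp0 : 0 < p := by linarith
  rw [eSchattenNorm_of_eigen (by linarith) g hl h, one_div, ENNReal.rpow_inv_rpow hp0.ne']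
  simp_rw [rpow_eq_sq_rpow ‖A _‖ₑ, ofReal_rpow_eq _ (hl _), enorm_sq_apply_eq_tsum g h]
  -- The exponent is `p / 2 ≥ 1`, and the squared coefficients are doubly substochastic by Bessel
  -- for `g` and for `e`.
  refine doubly_substochastic (by linarith) (fun i k => ‖⟪g k, e i⟫_ℂ‖ₑ ^ 2) _ (fun i => ?_)
    fun k => ?_
  · exact (bessel g.orthonormal (e i)).trans (he.enorm_sq_le_one i)
  · refine le_of_eq_of_le (tsum_congr fun i => ?_) ((he (g k)).trans
      ((isBessel_of_orthonormal g.orthonormal).enorm_sq_le_one k))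
    rw [enorm_inner_symm]

/-- For `p ≤ 2`, `‖A‖_p^p ≤ ∑ ‖A eᵢ‖ᵖ` for every Hilbert basis. -/
theorem le_tsum_enorm_apply {p : ℝ} (hp1 : 1 ≤ p) (hp : p ≤ 2) {A : H →L[ℂ] H}
    (hA : IsCompactOperator A) {κ : Type*} (e : HilbertBasis κ ℂ H) :
    eSchattenNorm p A ^ p ≤ ∑' i, ‖A (e i)‖ₑ ^ p := by
  obtain ⟨w, g, l, hl, h⟩ := exists_singular_basis hA
  have hp0 : 0 < p := by linarith
  -- Here a genuine Hilbert basis is needed: the column sums must equal one, since they enter from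
  -- below.
  have hn : ∀ k, ∑' i, ‖⟪g k, e i⟫_ℂ‖ₑ ^ 2 = 1 := fun k => by
    simp_rw [enorm_inner_symm (g k)]
    rw [parseval, ← ofReal_norm, g.orthonormal.1]; simp
  rw [eSchattenNorm_of_eigen hp1 g hl h, one_div, ENNReal.rpow_inv_rpow hp0.ne']
  simp_rw [rpow_eq_sq_rpow ‖A _‖ₑ, ofReal_rpow_eq _ (hl _), enorm_sq_apply_eq_tsum g h]
  calc ∑' k, ENNReal.ofReal (l k ^ 2) ^ (p / 2)
      = ∑' k, (∑' i, ‖⟪g k, e i⟫_ℂ‖ₑ ^ 2) * ENNReal.ofReal (l k ^ 2) ^ (p / 2) := by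
        simp_rw [hn, one_mul]
    _ = ∑' i, ∑' k, ‖⟪g k, e i⟫_ℂ‖ₑ ^ 2 * ENNReal.ofReal (l k ^ 2) ^ (p / 2) := by
        rw [ENNReal.tsum_comm]; simp_rw [ENNReal.tsum_mul_right]
    _ ≤ _ := ENNReal.tsum_le_tsum fun i =>
        jensen_tsum_concave (by positivity) (by linarith) _ _
          ((bessel g.orthonormal (e i)).trans
            ((isBessel_of_orthonormal e.orthonormal).enorm_sq_le_one i))

/-- A singular basis attains `‖A‖_p^p = ∑ ‖A gᵢ‖ᵖ`. -/
theorem eSchattenNorm_rpow_of_singular {p : ℝ} (hp : 1 ≤ p) {ι : Type*} {A : H →L[ℂ] H}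
    (g : HilbertBasis ι ℂ H) {l : ι → ℝ} (hl : ∀ i, 0 ≤ l i)
    (h : ∀ i, (star A * A) (g i) = (l i ^ 2) • g i) :
    eSchattenNorm p A ^ p = ∑' i, ‖A (g i)‖ₑ ^ p := by
  rw [eSchattenNorm_of_eigen hp g hl h, one_div, ENNReal.rpow_inv_rpow (by linarith)]
  simp_rw [enorm_apply_singular g hl h]

end PowerSums

/-! ### Power type inequalities for splitting by a projection -/

section Projection

variable {H : Type*} [NormedAddCommGroup H] [InnerProductSpace ℂ H]

theorem orthonormal_sum_elim {ι κ : Type*} {v : ι → H} {w : κ → H} (hv : Orthonormal ℂ v)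
    (hw : Orthonormal ℂ w) (h : ∀ i j, ⟪v i, w j⟫_ℂ = 0) : Orthonormal ℂ (Sum.elim v w) := by
  refine ⟨fun i => ?_, fun i j hij => ?_⟩
  · cases i with
    | inl i => exact hv.1 i
    | inr i => exact hw.1 i
  · cases i with
    | inl i => cases j with
      | inl j => exact hv.2 (fun h => hij (h ▸ rfl))
      | inr j => exact h i j
    | inr i => cases j with
      | inl j => exact inner_eq_zero_symm.1 (h j i)
      | inr j => exact hw.2 (fun h => hij (h ▸ rfl))

variable [CompleteSpace H]

theorem enorm_sq_projection {Q : H →L[ℂ] H} (hQ : IsStarProjection Q) (x : H) :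
    ‖x‖ₑ ^ 2 = ‖Q x‖ₑ ^ 2 + ‖(1 - Q) x‖ₑ ^ 2 := by
  have h0 : ⟪Q x, (1 - Q) x⟫_ℂ = 0 := by
    have h1 : Q ((1 - Q) x) = 0 := by
      rw [← mul_apply_eq_comp, mul_sub, mul_one, hQ.isIdempotentElem.eq, sub_self]; rfl
    rw [← ContinuousLinearMap.adjoint_inner_right, ← ContinuousLinearMap.star_eq_adjoint,
      hQ.isSelfAdjoint.star_eq, h1, inner_zero_right]
  have h2 := norm_add_sq_eq_norm_sq_add_norm_sq_of_inner_eq_zero (Q x) ((1 - Q) x) h0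
  have h3 : Q x + (1 - Q) x = x := by simp
  rw [h3] at h2
  have h4 : ∀ y : H, ‖y‖ₑ ^ 2 = ENNReal.ofReal (‖y‖ ^ 2) := fun y => by
    rw [ENNReal.ofReal_pow (norm_nonneg _), ofReal_norm]
  rw [h4, h4, h4, ← ENNReal.ofReal_add (by positivity) (by positivity), sq, sq, sq, h2]

theorem apply_eq_zero_of_orthogonal_singular {ι : Type*} {A : H →L[ℂ] H} (g : HilbertBasis ι ℂ H)
    {l : ι → ℝ} (h : ∀ i, (star A * A) (g i) = (l i ^ 2) • g i) {x : H}
    (hx : ∀ i, l i ≠ 0 → ⟪g i, x⟫_ℂ = 0) : A x = 0 := by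
  have h1 := enorm_sq_apply_eq_tsum g h x
  have h2 : ∀ k, ‖⟪g k, x⟫_ℂ‖ₑ ^ 2 * ENNReal.ofReal (l k ^ 2) = 0 := fun k => by
    by_cases hk : l k = 0
    · simp [hk]
    · simp [hx k hk]
  simp_rw [h2, tsum_zero] at h1
  simpa using h1

/-- Since `A Q = A`, the operator `A* A` has range in that of `Q`, and so do its eigenvectors with
nonzero eigenvalue. -/
theorem projection_apply_singular {ι : Type*} {A Q : H →L[ℂ] H} (hQ : IsStarProjection Q)
    {g : ι → H} {l : ι → ℝ} (hA : A * Q = A)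
    (h : ∀ i, (star A * A) (g i) = (l i ^ 2) • g i) {i : ι} (hi : l i ≠ 0) : Q (g i) = g i := by
  have h1 : Q * (star A * A) = star A * A := by
    rw [← mul_assoc]
    congr 1
    conv_rhs => rw [← hA, star_mul, hQ.isSelfAdjoint.star_eq]
  have h2 : Q ((star A * A) (g i)) = (star A * A) (g i) := by
    rw [← mul_apply_eq_comp, h1]
  rw [h] at h2
  have h3 : (l i ^ 2) • Q (g i) = (l i ^ 2) • g i := by
    rw [← h2]; exact (Q.map_smul_of_tower _ _).symm
  exact smul_right_injective H (pow_ne_zero 2 hi) h3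

/-- A Hilbert basis adapted to the two halves `Q z` and `(1 - Q) z` of a compact operator. -/
theorem exists_adapted_basis {z Q : H →L[ℂ] H} (hz : IsCompactOperator z)
    (hQ : IsStarProjection Q) :
    ∃ (w : Set H) (b : HilbertBasis w ℂ H), ∀ p : ℝ, 1 ≤ p →
      ∑' i, ‖star z (b i)‖ₑ ^ p =
        eSchattenNorm p (Q * z) ^ p + eSchattenNorm p ((1 - Q) * z) ^ p := by
  classical
  have hQ' : IsStarProjection (1 - Q) := hQ.one_sub
  have hc : ∀ R : H →L[ℂ] H, IsCompactOperator (R * z : H →L[ℂ] H) := fun R => hz.clm_comp R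
  -- Adjoints are used because the right singular vectors of `(Q z)*` lie in the range of `Q` and
  -- those of `((1 - Q) z)*` in the range of `1 - Q`. The two systems are thus orthogonal and
  -- combine into one basis.
  set A := star (Q * z) with hAdef
  set B := star ((1 - Q) * z) with hBdef
  have hA : A = star z * Q := by rw [hAdef, star_mul, hQ.isSelfAdjoint.star_eq]
  have hB : B = star z * (1 - Q) := by rw [hBdef, star_mul, hQ'.isSelfAdjoint.star_eq]
  have hAQ : A * Q = A := by rw [hA, mul_assoc, hQ.isIdempotentElem.eq]
  have hBQ : B * (1 - Q) = B := by rw [hB, mul_assoc, hQ'.isIdempotentElem.eq]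
  obtain ⟨_, g, l, hl, hg⟩ := exists_singular_basis (isCompactOperator_star (hc Q))
  obtain ⟨_, g', l', hl', hg'⟩ := exists_singular_basis (isCompactOperator_star (hc (1 - Q)))
  rw [← hAdef] at hg
  rw [← hBdef] at hg'
  have hQg : ∀ i : {i // l i ≠ 0}, Q (g i) = g i := fun i =>
    projection_apply_singular hQ hAQ hg i.2
  have hQg' : ∀ i : {i // l' i ≠ 0}, (1 - Q) (g' i) = g' i := fun i =>
    projection_apply_singular hQ' hBQ hg' i.2
  let v : {i // l i ≠ 0} ⊕ {i // l' i ≠ 0} → H := Sum.elim (fun i => g i) (fun i => g' i)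
  have hv : Orthonormal ℂ v := by
    refine orthonormal_sum_elim (g.orthonormal.comp _ Subtype.val_injective)
      (g'.orthonormal.comp _ Subtype.val_injective) fun i j => ?_
    rw [← hQg i, ← ContinuousLinearMap.adjoint_inner_right, ← ContinuousLinearMap.star_eq_adjoint,
      hQ.isSelfAdjoint.star_eq, ← hQg' j, ← mul_apply_eq_comp, mul_sub, mul_one,
      hQ.isIdempotentElem.eq, sub_self]
    simp
  obtain ⟨w, b, hsub, hb⟩ := hv.toSubtypeRange.exists_hilbertBasis_extension
  refine ⟨w, b, fun p hp => ?_⟩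
  have hp0 : 0 < p := by linarith
  have hbi : ∀ i, b i = i := fun i => by rw [hb]
  have hzero : ∀ i : w, (i : H) ∉ Set.range v → star z (b i) = 0 := by
    intro i hi
    have hne : ∀ k, ⟪v k, (i : H)⟫_ℂ = 0 := fun k => by
      have hk : v k ∈ w := hsub ⟨k, rfl⟩
      have := b.orthonormal.2 (i := ⟨v k, hk⟩) (j := i) (fun h => hi ⟨k, congrArg Subtype.val h⟩)
      simpa only [hbi] using this
    have h1 : A i = 0 := apply_eq_zero_of_orthogonal_singular g hg fun k hk => hne (.inl ⟨k, hk⟩)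
    have h2 : B i = 0 := apply_eq_zero_of_orthogonal_singular g' hg' fun k hk => hne (.inr ⟨k, hk⟩)
    -- On a basis vector orthogonal to both systems, both summands of `z*` vanish, so it adds
    -- nothing to the sum.
    have h3 : star z = A + B := by rw [hA, hB, ← mul_add, add_sub_cancel, mul_one]
    rw [hbi, h3, add_apply, h1, h2, add_zero]
  let j : {i // l i ≠ 0} ⊕ {i // l' i ≠ 0} → w := fun k => ⟨v k, hsub ⟨k, rfl⟩⟩
  have hj : Function.Injective j := fun a a' h => by
    exact hv.linearIndependent.injective (congrArg Subtype.val h)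
  have hs : ∑' i, ‖star z (b i)‖ₑ ^ p = ∑' k, ‖star z (b (j k))‖ₑ ^ p := by
    refine (hj.tsum_eq (f := fun i => ‖star z (b i)‖ₑ ^ p) ?_).symm
    intro i hi
    by_contra hni
    apply hi
    have : (i : H) ∉ Set.range v := by
      rintro ⟨k, hk⟩
      exact hni ⟨k, Subtype.ext hk⟩
    simp [hzero i this, hp0]
  rw [hs, Summable.tsum_sum ENNReal.summable ENNReal.summable]
  have hred : ∀ {ι : Type _} (m : ι → ℝ), (∑' i : {i // m i ≠ 0}, ENNReal.ofReal (m i) ^ p) =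
      ∑' i, ENNReal.ofReal (m i) ^ p := fun m => by
    refine Subtype.val_injective.tsum_eq (f := fun i => ENNReal.ofReal (m i) ^ p) ?_
    intro i hi
    refine ⟨⟨i, fun h0 => hi ?_⟩, rfl⟩
    simp [h0, hp0]
  congr 1
  · have h1 : ∀ k, ‖star z (b (j (.inl k)))‖ₑ = ENNReal.ofReal (l k) := fun k => by
      have : star z (g k) = A (g k) := by rw [hA, mul_apply_eq_comp, hQg]
      rw [hbi]
      change ‖star z (g k)‖ₑ = _
      rw [this, enorm_apply_singular g hl hg]
    simp_rw [h1]
    rw [hred, ← eSchattenNorm_star hp (hc Q), ← hAdef, eSchattenNorm_of_eigen hp g hl hg, one_div,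
      ENNReal.rpow_inv_rpow hp0.ne']
  · have h1 : ∀ k, ‖star z (b (j (.inr k)))‖ₑ = ENNReal.ofReal (l' k) := fun k => by
      have : star z (g' k) = B (g' k) := by rw [hB, mul_apply_eq_comp, hQg']
      rw [hbi]
      change ‖star z (g' k)‖ₑ = _
      rw [this, enorm_apply_singular g' hl' hg']
    simp_rw [h1]
    rw [hred, ← eSchattenNorm_star hp (hc (1 - Q)), ← hBdef, eSchattenNorm_of_eigen hp g' hl' hg',
      one_div, ENNReal.rpow_inv_rpow hp0.ne']

/-- For `p ≥ 2`, the adapted basis makes the left side equal to `∑ ‖z* bᵢ‖ᵖ`. For `p ≤ 2`,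
Pythagoras holds at each vector of a singular basis of `z`, and Minkowski with exponent `2 / p` sums
it up. -/
theorem eSchattenNorm_projection_add_le {p : ℝ} (hp : 1 ≤ p) {z Q : H →L[ℂ] H}
    (hz : IsCompactOperator z) (hQ : IsStarProjection Q) :
    eSchattenNorm p (Q * z) ^ max p 2 + eSchattenNorm p ((1 - Q) * z) ^ max p 2 ≤
      eSchattenNorm p z ^ max p 2 := by
  have hc : ∀ R : H →L[ℂ] H, IsCompactOperator (R * z : H →L[ℂ] H) := fun R => hz.clm_comp R
  have hp0 : 0 < p := by linarith
  rcases le_total 2 p with h2 | h2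
  · rw [max_eq_left h2]
    obtain ⟨w, b, hb⟩ := exists_adapted_basis hz hQ
    rw [← hb p hp, ← eSchattenNorm_star hp hz]
    exact tsum_enorm_apply_le h2 (isCompactOperator_star hz) (isBessel_of_orthonormal b.orthonormal)
  · rw [max_eq_right h2]
    obtain ⟨w, g, l, hl, hg⟩ := exists_singular_basis hz
    have hσ : 1 ≤ 2 / p := by rw [le_div_iff₀ hp0]; linarith
    -- Pythagoras turns the right side into `∑ ‖z gᵢ‖ᵖ = ‖z‖_p^p`, while each sum on the left
    -- dominates a `p`-th power norm because `p ≤ 2`.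
    have key := minkowski_two_tsum hσ (fun i => ‖(Q * z) (g i)‖ₑ ^ p)
      (fun i => ‖((1 - Q) * z) (g i)‖ₑ ^ p)
    have hr : ∀ a : ℝ≥0∞, (a ^ p) ^ (2 / p) = a ^ (2 : ℝ) := fun a => by
      rw [← ENNReal.rpow_mul, mul_div_cancel₀ _ hp0.ne']
    have hs : ∀ i, ((‖(Q * z) (g i)‖ₑ ^ p) ^ (2 / p) + (‖((1 - Q) * z) (g i)‖ₑ ^ p) ^ (2 / p)) ^
        (2 / p)⁻¹ = ‖z (g i)‖ₑ ^ p := fun i => by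
      rw [hr, hr, ENNReal.rpow_two, ENNReal.rpow_two, mul_apply_eq_comp, mul_apply_eq_comp,
        ← enorm_sq_projection hQ, inv_div, ← rpow_eq_sq_rpow]
    simp_rw [hs] at key
    rw [← eSchattenNorm_rpow_of_singular hp g hl hg, ENNReal.rpow_inv_le_iff (by positivity),
      hr] at key
    refine le_trans ?_ key
    rw [← hr, ← hr]
    gcongr <;> exact le_tsum_enorm_apply hp h2 (hc _) g

/-- The same two mechanisms with the ranges of `p` exchanged: the adapted basis serves `p ≤ 2`, and
Minkowski in `ℓ^(p/2)` serves `p ≥ 2`. -/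
theorem eSchattenNorm_le_projection_add {p : ℝ} (hp : 1 ≤ p) {z Q : H →L[ℂ] H}
    (hz : IsCompactOperator z) (hQ : IsStarProjection Q) :
    eSchattenNorm p z ^ min p 2 ≤
      eSchattenNorm p (Q * z) ^ min p 2 + eSchattenNorm p ((1 - Q) * z) ^ min p 2 := by
  have hc : ∀ R : H →L[ℂ] H, IsCompactOperator (R * z : H →L[ℂ] H) := fun R => hz.clm_comp R
  have hp0 : 0 < p := by linarith
  rcases le_total p 2 with h2 | h2
  · rw [min_eq_left h2]
    obtain ⟨w, b, hb⟩ := exists_adapted_basis hz hQ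
    rw [← hb p hp, ← eSchattenNorm_star hp hz]
    exact le_tsum_enorm_apply hp h2 (isCompactOperator_star hz) b
  · rw [min_eq_right h2]
    obtain ⟨w, g, l, hl, hg⟩ := exists_singular_basis hz
    have hσ : 1 ≤ p / 2 := by linarith
    have key := minkowski_tsum hσ (fun i => ‖(Q * z) (g i)‖ₑ ^ 2)
      (fun i => ‖((1 - Q) * z) (g i)‖ₑ ^ 2)
    have hr : ∀ a : ℝ≥0∞, (a ^ p) ^ (p / 2)⁻¹ = a ^ (2 : ℝ) := fun a => by
      rw [← ENNReal.rpow_mul, inv_div, mul_div_cancel₀ _ hp0.ne']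
    simp_rw [mul_apply_eq_comp, ← enorm_sq_projection hQ, ← rpow_eq_sq_rpow] at key
    rw [← eSchattenNorm_rpow_of_singular hp g hl hg, hr] at key
    refine key.trans ?_
    rw [← hr, ← hr]
    gcongr
    · exact tsum_enorm_apply_le h2 (hc Q) (isBessel_of_orthonormal g.orthonormal)
    · exact tsum_enorm_apply_le h2 (hc (1 - Q)) (isBessel_of_orthonormal g.orthonormal)

end Projection

/-! ### Convexity and smoothness of `S^p` with respect to compressions -/

section Compression

variable {p : ℝ} [Fact (1 ≤ p)]
variable {H : Type*} [NormedAddCommGroup H] [InnerProductSpace ℂ H] [CompleteSpace H]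

theorem norm_le_one_of_isStarProjection {Q : H →L[ℂ] H} (hQ : IsStarProjection Q) : ‖Q‖ ≤ 1 := by
  refine ContinuousLinearMap.opNorm_le_bound _ zero_le_one fun x => ?_
  have h := enorm_sq_projection hQ x
  have h1 : ‖Q x‖ₑ ^ 2 ≤ ‖x‖ₑ ^ 2 := by rw [h]; exact le_self_add
  rw [one_mul, ← enorm_le_iff_norm_le]
  exact (ENNReal.pow_le_pow_left_iff two_ne_zero).1 h1

namespace SchattenClass

/-- The compression `z ↦ Q z Q` of `S^p(H)`. -/
noncomputable def compress (Q : H →L[ℂ] H) : SchattenClass p H →L[ℂ] SchattenClass p H :=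
  sandwich Q Q

theorem toOp_compress (Q : H →L[ℂ] H) (z : SchattenClass p H) :
    (compress Q z).toOp = Q * z.toOp * Q := rfl

theorem compress_mul (Q R : H →L[ℂ] H) (h : Q * R = R * Q) (z : SchattenClass p H) :
    compress (Q * R) z = compress Q (compress R z) := by
  apply toOp_injective
  rw [toOp_compress, toOp_compress, toOp_compress]
  conv_lhs => rw [mul_assoc _ _ (Q * R), h]
  rw [← h]
  simp only [mul_assoc]
  rw [h]

theorem norm_compress_le {Q : H →L[ℂ] H} (hQ : IsStarProjection Q) (z : SchattenClass p H) :
    ‖compress Q z‖ ≤ ‖z‖ :=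
  norm_sandwich_apply_le (norm_le_one_of_isStarProjection hQ) (norm_le_one_of_isStarProjection hQ) z

theorem norm_rpow_add_le_of_enorm {E : Type*} [SeminormedAddCommGroup E] {s : ℝ} (hs : 0 ≤ s)
    {x y z : E} (h : ‖x‖ₑ ^ s + ‖y‖ₑ ^ s ≤ ‖z‖ₑ ^ s) : ‖x‖ ^ s + ‖y‖ ^ s ≤ ‖z‖ ^ s := by
  simp only [← ofReal_norm, ENNReal.ofReal_rpow_of_nonneg (norm_nonneg _) hs] at h
  rw [← ENNReal.ofReal_add (by positivity) (by positivity)] at h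
  exact (ENNReal.ofReal_le_ofReal_iff (by positivity)).1 h

theorem norm_rpow_le_add_of_enorm {E : Type*} [SeminormedAddCommGroup E] {s : ℝ} (hs : 0 ≤ s)
    {x y z : E} (h : ‖z‖ₑ ^ s ≤ ‖x‖ₑ ^ s + ‖y‖ₑ ^ s) : ‖z‖ ^ s ≤ ‖x‖ ^ s + ‖y‖ ^ s := by
  simp only [← ofReal_norm, ENNReal.ofReal_rpow_of_nonneg (norm_nonneg _) hs] at h
  rw [← ENNReal.ofReal_add (by positivity) (by positivity)] at h
  exact (ENNReal.ofReal_le_ofReal_iff (by positivity)).1 h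

theorem enorm_sandwich_one_right (Q : H →L[ℂ] H) (z : SchattenClass p H) :
    ‖sandwich Q 1 z‖ₑ = eSchattenNorm p (Q * z.toOp) := by
  rw [enorm_def, toOp_sandwich]; rfl

theorem enorm_sandwich_one_left {Q : H →L[ℂ] H} (hQ : IsSelfAdjoint Q) (z : SchattenClass p H) :
    ‖sandwich 1 Q z‖ₑ = eSchattenNorm p (Q * star z.toOp) := by
  rw [enorm_def, toOp_sandwich]
  have h : IsCompactOperator (z.toOp * Q : H →L[ℂ] H) := z.compact.comp_clm Q
  rw [show Q * star z.toOp = star (z.toOp * Q) by rw [star_mul, hQ.star_eq],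
    eSchattenNorm_star Fact.out h]
  rfl

theorem norm_left_add_le {Q : H →L[ℂ] H} (hQ : IsStarProjection Q) (z : SchattenClass p H) :
    ‖sandwich Q 1 z‖ ^ max p 2 + ‖sandwich (1 - Q) 1 z‖ ^ max p 2 ≤ ‖z‖ ^ max p 2 := by
  refine norm_rpow_add_le_of_enorm (by positivity) ?_
  rw [enorm_sandwich_one_right, enorm_sandwich_one_right, enorm_def]
  exact eSchattenNorm_projection_add_le Fact.out z.compact hQ

theorem norm_right_add_le {Q : H →L[ℂ] H} (hQ : IsStarProjection Q) (z : SchattenClass p H) :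
    ‖sandwich 1 Q z‖ ^ max p 2 + ‖sandwich 1 (1 - Q) z‖ ^ max p 2 ≤ ‖z‖ ^ max p 2 := by
  refine norm_rpow_add_le_of_enorm (by positivity) ?_
  rw [enorm_sandwich_one_left hQ.isSelfAdjoint, enorm_sandwich_one_left hQ.one_sub.isSelfAdjoint,
    enorm_def, ← eSchattenNorm_star Fact.out z.compact]
  exact eSchattenNorm_projection_add_le Fact.out (isCompactOperator_star z.compact) hQ

theorem norm_le_left_add {Q : H →L[ℂ] H} (hQ : IsStarProjection Q) (z : SchattenClass p H) :
    ‖z‖ ^ min p 2 ≤ ‖sandwich Q 1 z‖ ^ min p 2 + ‖sandwich (1 - Q) 1 z‖ ^ min p 2 := by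
  have hp : 1 ≤ p := Fact.out
  refine norm_rpow_le_add_of_enorm (by positivity) ?_
  rw [enorm_sandwich_one_right, enorm_sandwich_one_right, enorm_def]
  exact eSchattenNorm_le_projection_add Fact.out z.compact hQ

theorem norm_le_right_add {Q : H →L[ℂ] H} (hQ : IsStarProjection Q) (z : SchattenClass p H) :
    ‖z‖ ^ min p 2 ≤ ‖sandwich 1 Q z‖ ^ min p 2 + ‖sandwich 1 (1 - Q) z‖ ^ min p 2 := by
  have hp : 1 ≤ p := Fact.out
  refine norm_rpow_le_add_of_enorm (by positivity) ?_
  rw [enorm_sandwich_one_left hQ.isSelfAdjoint, enorm_sandwich_one_left hQ.one_sub.isSelfAdjoint,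
    enorm_def, ← eSchattenNorm_star Fact.out z.compact]
  exact eSchattenNorm_le_projection_add Fact.out (isCompactOperator_star z.compact) hQ

theorem right_left (Q : H →L[ℂ] H) (z : SchattenClass p H) :
    sandwich 1 Q (sandwich Q 1 z) = compress Q z := by
  apply toOp_injective
  ext v
  rfl

/-- The power type convexity of `S^p(H)` with respect to compressions. -/
theorem norm_compress_add_le {Q : H →L[ℂ] H} (hQ : IsStarProjection Q) (z : SchattenClass p H) :
    ‖compress Q z‖ ^ max p 2 + (‖z - compress Q z‖ / 2) ^ max p 2 ≤ ‖z‖ ^ max p 2 := by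
  have h1 := norm_left_add_le hQ z
  have h2 := norm_right_add_le hQ (sandwich Q 1 z)
  rw [right_left] at h2
  set a := ‖sandwich (1 - Q) 1 z‖
  set b := ‖sandwich 1 (1 - Q) (sandwich Q 1 z)‖
  have h3 : ‖z - compress Q z‖ ≤ a + b := by
    -- The splitting `z - Q z Q = (1 - Q) z + Q z (1 - Q)`: the left and then the right estimate
    -- each release one of the two terms.
    have : z - compress Q z = sandwich (1 - Q) 1 z + sandwich 1 (1 - Q) (sandwich Q 1 z) := by
      apply toOp_injective
      rw [map_sub, map_add]
      ext v
      change z.toOp v - Q (z.toOp (Q v)) =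
        (z.toOp v - Q (z.toOp v)) + Q (z.toOp (v - Q v))
      rw [map_sub, map_sub]; abel
    rw [this]
    exact norm_add_le _ _
  have hs : 0 ≤ max p 2 := by positivity
  have h4 : (‖z - compress Q z‖ / 2) ^ max p 2 ≤ a ^ max p 2 + b ^ max p 2 := by
    have ha : 0 ≤ a := norm_nonneg _
    have hb : 0 ≤ b := norm_nonneg _
    -- One of two numbers is at least half of any lower bound for their sum; this is the origin of
    -- the factor `1 / 2`.
    have h5 : ‖z - compress Q z‖ / 2 ≤ max a b := by
      have := le_max_left a b
      have := le_max_right a b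
      linarith
    refine (Real.rpow_le_rpow (by positivity) h5 hs).trans ?_
    have ha' := Real.rpow_nonneg ha (max p 2)
    have hb' := Real.rpow_nonneg hb (max p 2)
    rcases max_cases a b with h | h <;> rw [h.1] <;> linarith
  linarith

/-- The power type smoothness of `S^p(H)` with respect to compressions. -/
theorem norm_le_compress_add {Q : H →L[ℂ] H} (hQ : IsStarProjection Q) (z : SchattenClass p H) :
    ‖z‖ ^ min p 2 ≤ ‖compress Q z‖ ^ min p 2 + 2 * ‖z - compress Q z‖ ^ min p 2 := by
  have hp : 1 ≤ p := Fact.out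
  have hr : 0 ≤ min p 2 := by positivity
  have h1 := norm_le_left_add hQ z
  have h2 := norm_le_right_add hQ (sandwich Q 1 z)
  rw [right_left] at h2
  have hQ1 := norm_le_one_of_isStarProjection hQ
  have hQ2 := norm_le_one_of_isStarProjection hQ.one_sub
  have hone : ‖(1 : H →L[ℂ] H)‖ ≤ 1 := ContinuousLinearMap.norm_id_le
  have hQQ : ∀ v, Q (Q v) = Q v := fun v => by
    rw [← mul_apply_eq_comp, hQ.isIdempotentElem.eq]
  have h3 : ‖sandwich (1 - Q) 1 z‖ ≤ ‖z - compress Q z‖ := by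
    -- The compressed part is annihilated, so the off-compression terms are contractive images of `z
    -- - Q z Q`. The two of them give the factor `2`.
    have : sandwich (1 - Q) 1 z = sandwich (1 - Q) 1 (z - compress Q z) := by
      apply toOp_injective
      rw [map_sub, map_sub]
      ext v
      change z.toOp v - Q (z.toOp v) = (z.toOp v - Q (z.toOp v)) -
        (Q (z.toOp (Q v)) - Q (Q (z.toOp (Q v))))
      rw [hQQ]; abel
    rw [this]
    exact norm_sandwich_apply_le hQ2 hone _
  have h4 : ‖sandwich 1 (1 - Q) (sandwich Q 1 z)‖ ≤ ‖z - compress Q z‖ := by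
    have : sandwich 1 (1 - Q) (sandwich Q 1 z) = sandwich Q (1 - Q) (z - compress Q z) := by
      apply toOp_injective
      rw [map_sub, map_sub]
      ext v
      change Q (z.toOp (v - Q v)) = Q (z.toOp (v - Q v)) - Q (Q (z.toOp (Q (v - Q v))))
      rw [map_sub Q v, hQQ v, sub_self, map_zero, map_zero, map_zero, sub_zero]
    rw [this]
    exact norm_sandwich_apply_le hQ1 hQ2 _
  have h5 := Real.rpow_le_rpow (norm_nonneg _) h3 hr
  have h6 := Real.rpow_le_rpow (norm_nonneg _) h4 hr
  linarith

/-- For an upper estimate with exponent `r = min p 2 > 1`, a perturbation of size `t` costs only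
`O(t ^ r) = o(t)`. The choice of `t` is uniform in `Q`, `a` and `z`, so `t` can be fixed before the
projection. -/
theorem exists_smooth (hp : 1 < p) {δ : ℝ} (hδ : 0 < δ) :
    ∃ t : ℝ, 0 < t ∧ ∀ Q : H →L[ℂ] H, IsStarProjection Q → ∀ a z : SchattenClass p H,
      compress Q a = a → ‖a‖ ≤ 1 → compress Q z = 0 → ‖z‖ ≤ 1 → ‖a + (t : ℂ) • z‖ ≤ 1 + δ * t := by
  set r := min p 2 with hr
  have hr1 : 1 < r := lt_min hp (by norm_num)
  have htend : Filter.Tendsto (fun t : ℝ => 2 * t ^ (r - 1)) (𝓝[>] 0) (𝓝 0) := by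
    have h := ((Real.continuous_rpow_const (by linarith : 0 ≤ r - 1)).const_mul 2).tendsto 0
    rw [Real.zero_rpow (by linarith), mul_zero] at h
    exact h.mono_left nhdsWithin_le_nhds
  obtain ⟨t, ht, ht0⟩ := ((htend.eventually (gt_mem_nhds hδ)).and self_mem_nhdsWithin).exists
  refine ⟨t, ht0, fun Q hQ a z ha ha1 hz hz1 => ?_⟩
  have h := norm_le_compress_add hQ (a + (t : ℂ) • z)
  rw [map_add, ha, map_smul, hz, smul_zero, add_zero, add_sub_cancel_left, norm_smul,
    Complex.norm_real, Real.norm_of_nonneg ht0.le] at h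
  have h1 : ‖a‖ ^ r ≤ 1 := Real.rpow_le_one (norm_nonneg _) ha1 (by linarith)
  have h2 : (t * ‖z‖) ^ r ≤ t ^ (r - 1) * t := by
    rw [← Real.rpow_add_one ht0.ne', sub_add_cancel]
    exact Real.rpow_le_rpow (by positivity) (mul_le_of_le_one_right ht0.le hz1) (by linarith)
  -- The bound `2 t ^ (r - 1) < δ` yields `1 + δ t`, which is at most its own `r`-th power.
  have h3 : ‖a + (t : ℂ) • z‖ ^ r ≤ (1 + δ * t) ^ r := by
    refine h.trans ?_
    calc ‖a‖ ^ r + 2 * (t * ‖z‖) ^ r ≤ 1 + 2 * (t ^ (r - 1) * t) := by gcongr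
      _ ≤ 1 + δ * t := by nlinarith
      _ ≤ (1 + δ * t) ^ r := by
        conv_lhs => rw [← Real.rpow_one (1 + δ * t)]
        exact Real.rpow_le_rpow_of_exponent_le (by nlinarith) hr1.le
  exact (Real.rpow_le_rpow_iff (norm_nonneg _) (by positivity) (by linarith)).1 h3

-- The dual form of smoothness. Young's inequality with exponent `s = max p 2` turns the lower power
-- type estimate into a linear one with error `(2 t) ^ q / q = o(t)`, where `q > 1` is conjugate to
-- `s`.
variable (p H) in
theorem exists_convex {δ : ℝ} (hδ : 0 < δ) :
    ∃ t : ℝ, 0 < t ∧ ∀ Q : H →L[ℂ] H, IsStarProjection Q → ∀ z : SchattenClass p H,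
      ‖z‖ ≤ 1 → ‖compress Q z‖ + t * ‖z - compress Q z‖ ≤ 1 + δ * t := by
  set s := max p 2 with hs
  have hs1 : 2 ≤ s := le_max_right _ _
  have hconj : s.HolderConjugate s.conjExponent := .conjExponent (by linarith)
  set q := s.conjExponent
  have hq1 : 1 < q := hconj.symm.lt
  have htend : Filter.Tendsto (fun t : ℝ => 2 ^ q * t ^ (q - 1)) (𝓝[>] 0) (𝓝 0) := by
    have h := ((Real.continuous_rpow_const (by linarith : 0 ≤ q - 1)).const_mul (2 ^ q)).tendsto 0
    rw [Real.zero_rpow (by linarith), mul_zero] at h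
    exact h.mono_left nhdsWithin_le_nhds
  obtain ⟨t, ht, ht0⟩ := ((htend.eventually (gt_mem_nhds hδ)).and self_mem_nhdsWithin).exists
  refine ⟨t, ht0, fun Q hQ z hz => ?_⟩
  have h := norm_compress_add_le hQ z
  set a := ‖compress Q z‖
  set b := ‖z - compress Q z‖ / 2 with hb
  have ha0 : 0 ≤ a := norm_nonneg _
  have hb0 : 0 ≤ b := by positivity
  have h1 : ‖z‖ ^ s ≤ 1 := Real.rpow_le_one (norm_nonneg _) hz (by linarith)
  -- The summands `a · 1` and `b · 2t` are bounded separately. The `s`-th powers add up to at most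
  -- `1 / s`, and `1 / s + 1 / q = 1` supplies the leading term.
  have h2 := Real.young_inequality_of_nonneg ha0 zero_le_one hconj
  have h3 := Real.young_inequality_of_nonneg hb0 (by positivity : 0 ≤ 2 * t) hconj
  have h4 : (2 * t) ^ q / q ≤ δ * t := by
    have h5 : (2 * t) ^ q = 2 ^ q * t ^ (q - 1) * t := by
      rw [mul_assoc, ← Real.rpow_add_one ht0.ne', sub_add_cancel,
        Real.mul_rpow zero_le_two ht0.le]
    calc (2 * t) ^ q / q ≤ (2 * t) ^ q := div_le_self (by positivity) hq1.le
      _ ≤ δ * t := by rw [h5]; gcongr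
  have h6 : s⁻¹ + q⁻¹ = 1 := hconj.inv_add_inv_eq_one
  have h7 : a ^ s / s + b ^ s / s ≤ s⁻¹ := by
    rw [← add_div, div_le_iff₀ (by linarith), inv_mul_cancel₀ (by linarith)]
    exact h.trans h1
  rw [Real.one_rpow, one_div] at h2
  have h8 : t * ‖z - compress Q z‖ = b * (2 * t) := by rw [hb]; ring
  rw [h8]
  linarith

end SchattenClass

end Compression

/-! ### Tensor products of operators and the cross norm -/

section TensorOperators

variable {K H K' H' K'' H'' : Type*} [NormedAddCommGroup K] [InnerProductSpace ℂ K]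
  [NormedAddCommGroup H] [InnerProductSpace ℂ H] [NormedAddCommGroup K'] [InnerProductSpace ℂ K']
  [NormedAddCommGroup H'] [InnerProductSpace ℂ H'] [NormedAddCommGroup K'']
  [InnerProductSpace ℂ K''] [NormedAddCommGroup H''] [InnerProductSpace ℂ H'']

theorem inner_tmul (ξ η : K) (h k : H) :
    ⟪tmul ξ h, tmul η k⟫_ℂ = ⟪ξ, η⟫_ℂ * ⟪h, k⟫_ℂ := by
  simp only [tmul]
  rw [UniformSpace.Completion.inner_coe, TensorProduct.inner_tmul]

theorem ext_tmul {E : Type*} [NormedAddCommGroup E] [NormedSpace ℂ E]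
    {A B : HilbertTensor K H →L[ℂ] E} (h : ∀ ξ k, A (tmul ξ k) = B (tmul ξ k)) : A = B := by
  ext1 u
  have := mem_of_tmul_mem (M := LinearMap.ker ((A - B : HilbertTensor K H →L[ℂ] E) :
      HilbertTensor K H →ₗ[ℂ] E)) (A - B).isClosed_ker
    (fun ξ k => by
      rw [LinearMap.mem_ker]
      change A (tmul ξ k) - B (tmul ξ k) = 0
      rw [h, sub_self]) u
  exact sub_eq_zero.1 this

theorem ext_inner_tmul {x y : HilbertTensor K H}
    (h : ∀ ξ k, ⟪x, tmul ξ k⟫_ℂ = ⟪y, tmul ξ k⟫_ℂ) : x = y :=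
  (innerSL_inj (𝕜 := ℂ)).1 (ext_tmul (A := innerSL ℂ x) (B := innerSL ℂ y) h)

/-- The operator `a ⊗ b : K ⊗₂ H → K' ⊗₂ H'`. -/
noncomputable def tensorMap (a : K →L[ℂ] K') (b : H →L[ℂ] H') :
    HilbertTensor K H →L[ℂ] HilbertTensor K' H' :=
  (TensorProduct.mapL a b).completion

theorem tensorMap_tmul (a : K →L[ℂ] K') (b : H →L[ℂ] H') (ξ : K) (h : H) :
    tensorMap a b (tmul ξ h) = tmul (a ξ) (b h) := by
  simp only [tensorMap, tmul]
  rw [ContinuousLinearMap.completion_apply_coe, TensorProduct.mapL_tmul]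

theorem norm_tensorMap_le (a : K →L[ℂ] K') (b : H →L[ℂ] H') : ‖tensorMap a b‖ ≤ ‖a‖ * ‖b‖ := by
  refine ContinuousLinearMap.opNorm_le_bound _ (by positivity) fun x => ?_
  induction x using UniformSpace.Completion.induction_on with
  | hp => exact isClosed_le (by fun_prop) (by fun_prop)
  | ih x =>
    rw [tensorMap, ContinuousLinearMap.completion_apply_coe, UniformSpace.Completion.norm_coe,
      UniformSpace.Completion.norm_coe]
    exact ((TensorProduct.mapL a b).le_opNorm x).trans
      (by gcongr; exact TensorProduct.norm_mapL_le a b)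

theorem tensorMap_comp (a' : K' →L[ℂ] K'') (b' : H' →L[ℂ] H'') (a : K →L[ℂ] K') (b : H →L[ℂ] H') :
    tensorMap a' b' ∘L tensorMap a b = tensorMap (a' ∘L a) (b' ∘L b) :=
  ext_tmul fun ξ k => by
    rw [ContinuousLinearMap.comp_apply, tensorMap_tmul, tensorMap_tmul, tensorMap_tmul]; rfl

theorem tensorMap_mul (a' a : K →L[ℂ] K) (b' b : H →L[ℂ] H) :
    tensorMap a' b' * tensorMap a b = tensorMap (a' * a) (b' * b) :=
  tensorMap_comp a' b' a b

theorem isTensor_tensorMap (a : K →L[ℂ] K) (b : H →L[ℂ] H) : IsTensor a b (tensorMap a b) :=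
  tensorMap_tmul a b

theorem adjoint_tensorMap [CompleteSpace K] [CompleteSpace H] [CompleteSpace K']
    [CompleteSpace H'] (a : K →L[ℂ] K') (b : H →L[ℂ] H') :
    (tensorMap a b).adjoint = tensorMap a.adjoint b.adjoint := by
  refine ext_tmul fun ξ k => ext_inner_tmul fun η l => ?_
  rw [ContinuousLinearMap.adjoint_inner_left, tensorMap_tmul, tensorMap_tmul, inner_tmul,
    inner_tmul, ContinuousLinearMap.adjoint_inner_left, ContinuousLinearMap.adjoint_inner_left]

theorem isStarProjection_tensorMap [CompleteSpace K] [CompleteSpace H] {a : K →L[ℂ] K}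
    {b : H →L[ℂ] H} (ha : IsStarProjection a) (hb : IsStarProjection b) :
    IsStarProjection (tensorMap a b) where
  isIdempotentElem := by
    rw [IsIdempotentElem, tensorMap_mul, ha.isIdempotentElem.eq, hb.isIdempotentElem.eq]
  isSelfAdjoint := by
    rw [IsSelfAdjoint, ContinuousLinearMap.star_eq_adjoint, adjoint_tensorMap,
      ← ContinuousLinearMap.star_eq_adjoint, ← ContinuousLinearMap.star_eq_adjoint,
      ha.isSelfAdjoint.star_eq, hb.isSelfAdjoint.star_eq]

theorem tmul_add_left (ξ η : K) (h : H) : tmul (ξ + η) h = tmul ξ h + tmul η h := by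
  simp only [tmul]
  rw [TensorProduct.add_tmul, UniformSpace.Completion.coe_add]

theorem tmul_smul_left (c : ℂ) (ξ : K) (h : H) : tmul (c • ξ) h = c • tmul ξ h := by
  simp only [tmul]
  rw [← TensorProduct.smul_tmul', UniformSpace.Completion.coe_smul]

theorem tmul_smul_right (c : ℂ) (ξ : K) (h : H) : tmul ξ (c • h) = c • tmul ξ h := by
  simp only [tmul]
  rw [TensorProduct.tmul_smul, UniformSpace.Completion.coe_smul]

/-- The operator `h ↦ ξ ⊗ h`. -/
noncomputable def tmulLeft (ξ : K) : H →L[ℂ] HilbertTensor K H :=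
  UniformSpace.Completion.toComplL ∘L TensorProduct.mkL ℂ K H ξ

/-- The operator `ξ ↦ ξ ⊗ h`. -/
noncomputable def tmulRight (h : H) : K →L[ℂ] HilbertTensor K H :=
  UniformSpace.Completion.toComplL ∘L (TensorProduct.mkL ℂ K H).flip h

theorem tmulLeft_apply (ξ : K) (h : H) : tmulLeft ξ h = tmul ξ h := rfl

theorem tmulRight_apply (ξ : K) (h : H) : tmulRight h ξ = tmul ξ h := rfl

theorem adjoint_tmulLeft_tmul [CompleteSpace H] (ξ η : K) (h : H) :
    (tmulLeft ξ).adjoint (tmul η h) = ⟪ξ, η⟫_ℂ • h := by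
  refine ext_inner_left ℂ fun v => ?_
  rw [ContinuousLinearMap.adjoint_inner_right, tmulLeft_apply, inner_tmul, inner_smul_right]

/-- The second family may depend on the first index; the pinching inequality needs this, as each
diagonal entry has its own singular vectors. -/
theorem orthonormal_tmul_sigma {ι : Type*} {κ : ι → Type*} {e : ι → K} (he : Orthonormal ℂ e)
    {v : ∀ i, κ i → H} (hv : ∀ i, Orthonormal ℂ (v i)) :
    Orthonormal ℂ fun x : Σ i, κ i => tmul (e x.1) (v x.1 x.2) := by
  classical
  rw [orthonormal_iff_ite]
  rintro ⟨i, k⟩ ⟨j, l⟩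
  rw [inner_tmul, orthonormal_iff_ite.1 he]
  by_cases hij : i = j
  · subst hij
    simp only [if_true, one_mul]
    rw [orthonormal_iff_ite.1 (hv i)]
    simp
  · simp [hij]

theorem HilbertBasis.eq_zero_of_inner_eq_zero {ι : Type*} (g : HilbertBasis ι ℂ H) {x : H}
    (h : ∀ i, ⟪g i, x⟫_ℂ = 0) : x = 0 := by
  refine (g.hasSum_repr x).unique ?_
  simp [HilbertBasis.repr_apply_apply, h, hasSum_zero]

/-- The tensor product of two Hilbert bases. -/
noncomputable def tensorBasis [CompleteSpace K] [CompleteSpace H] {ι κ : Type*}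
    (g : HilbertBasis ι ℂ K) (g' : HilbertBasis κ ℂ H) :
    HilbertBasis (Σ _ : ι, κ) ℂ (HilbertTensor K H) :=
  HilbertBasis.mkOfOrthogonalEqBot
    (orthonormal_tmul_sigma g.orthonormal fun _ => g'.orthonormal) (by
      rw [eq_bot_iff]
      intro x hx
      rw [Submodule.mem_orthogonal] at hx
      have h0 : ∀ i j, ⟪tmul (g i) (g' j), x⟫_ℂ = 0 := fun i j =>
        hx _ (Submodule.subset_span ⟨⟨i, j⟩, rfl⟩)
      -- A vector orthogonal to all `g i ⊗ g' j` has zero partial pairing with each `g i`, hence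
      -- with every `h`, hence is orthogonal to all elementary tensors.
      have h1 : ∀ i, (tmulLeft (g i)).adjoint x = (0 : H) := fun i =>
        HilbertBasis.eq_zero_of_inner_eq_zero g' fun j => by
          rw [ContinuousLinearMap.adjoint_inner_right]; exact h0 i j
      have h2 : ∀ h : H, (tmulRight h).adjoint x = (0 : K) := fun h =>
        HilbertBasis.eq_zero_of_inner_eq_zero g fun i => by
          rw [ContinuousLinearMap.adjoint_inner_right, tmulRight_apply, ← tmulLeft_apply,
            ← ContinuousLinearMap.adjoint_inner_right, h1, inner_zero_right]
      rw [Submodule.mem_bot]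
      refine ext_inner_tmul fun ξ h => ?_
      rw [inner_zero_left, ← tmulRight_apply, inner_eq_zero_symm,
        ← ContinuousLinearMap.adjoint_inner_right, h2, inner_zero_right])

theorem tensorBasis_apply [CompleteSpace K] [CompleteSpace H] {ι κ : Type*}
    (g : HilbertBasis ι ℂ K) (g' : HilbertBasis κ ℂ H) (x : Σ _ : ι, κ) :
    tensorBasis g g' x = tmul (g x.1) (g' x.2) := by
  simp [tensorBasis]

/-- The Schatten norm is a cross norm. -/
theorem eSchattenNorm_tensorMap [CompleteSpace K] [CompleteSpace H] {p : ℝ} (hp : 1 ≤ p)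
    {a : K →L[ℂ] K} {b : H →L[ℂ] H} (ha : IsCompactOperator a) (hb : IsCompactOperator b) :
    eSchattenNorm p (tensorMap a b) = eSchattenNorm p a * eSchattenNorm p b := by
  obtain ⟨w, g, l, hl, h⟩ := exists_singular_basis ha
  obtain ⟨w', g', l', hl', h'⟩ := exists_singular_basis hb
  -- The tensor basis diagonalizes `|a ⊗ b|²` with singular values `l l'`, and the sum of their
  -- powers factors.
  have key := eSchattenNorm_of_eigen hp (A := tensorMap a b) (tensorBasis g g')
    (l := fun x => l x.1 * l' x.2) (fun x => mul_nonneg (hl x.1) (hl' x.2)) (fun x => by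
      rw [ContinuousLinearMap.star_eq_adjoint, adjoint_tensorMap, tensorMap_mul, tensorBasis_apply,
        tensorMap_tmul, ← ContinuousLinearMap.star_eq_adjoint,
        ← ContinuousLinearMap.star_eq_adjoint, h, h', ← Complex.coe_smul, ← Complex.coe_smul,
        tmul_smul_left, tmul_smul_right, smul_smul, ← Complex.ofReal_mul, ← mul_pow]
      exact Complex.coe_smul _ _)
  have hp0 : 0 < p := by linarith
  rw [key, eSchattenNorm_of_eigen hp g hl h, eSchattenNorm_of_eigen hp g' hl' h',
    ← ENNReal.mul_rpow_of_nonneg _ _ (by positivity), ENNReal.tsum_sigma', ← ENNReal.tsum_mul_right]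
  congr 1
  refine tsum_congr fun i => ?_
  rw [← ENNReal.tsum_mul_left]
  refine tsum_congr fun j => ?_
  rw [ENNReal.ofReal_mul (hl i), ENNReal.mul_rpow_of_nonneg _ _ hp0.le]

namespace SchattenClass

variable {p : ℝ} [Fact (1 ≤ p)] [CompleteSpace K] [CompleteSpace H]

/-- The element `a ⊗ b` of `S^p(K ⊗₂ H)`. -/
noncomputable def tensor (a : SchattenClass p K) (b : SchattenClass p H) :
    SchattenClass p (HilbertTensor K H) :=
  mk (tensorMap a.toOp b.toOp) (by
    rw [eSchattenNorm_tensorMap Fact.out a.compact b.compact]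
    exact ENNReal.mul_lt_top a.lt_top b.lt_top)

theorem isTensor_tensor (a : SchattenClass p K) (b : SchattenClass p H) :
    IsTensor a.toOp b.toOp (tensor a b).toOp := isTensor_tensorMap _ _

theorem norm_tensor (a : SchattenClass p K) (b : SchattenClass p H) :
    ‖tensor a b‖ = ‖a‖ * ‖b‖ := by
  rw [norm_def, norm_def, norm_def, ← ENNReal.toReal_mul,
    ← eSchattenNorm_tensorMap Fact.out a.compact b.compact]
  rfl

theorem tensor_add_left (a a' : SchattenClass p K) (b : SchattenClass p H) :
    tensor (a + a') b = tensor a b + tensor a' b := by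
  refine toOp_injective ((isTensor_tensor _ _).unique fun ξ h => ?_)
  rw [map_add, map_add, add_apply, isTensor_tensor, isTensor_tensor, add_apply, tmul_add_left]

theorem tensor_smul_left (c : ℂ) (a : SchattenClass p K) (b : SchattenClass p H) :
    tensor (c • a) b = c • tensor a b := by
  refine toOp_injective ((isTensor_tensor _ _).unique fun ξ h => ?_)
  rw [map_smul, map_smul, smul_apply, isTensor_tensor, smul_apply, tmul_smul_left]

end SchattenClass

end TensorOperators

/-! ### Matrix entries and slices by functionals -/

section Slices

variable {K H : Type*} [NormedAddCommGroup K] [InnerProductSpace ℂ K] [CompleteSpace K]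
  [NormedAddCommGroup H] [InnerProductSpace ℂ H] [CompleteSpace H]

namespace SchattenClass

variable {p : ℝ} [Fact (1 ≤ p)]

/-- The matrix entry `(⟨f| ⊗ 1) z (|e⟩ ⊗ 1)` of `z`. -/
noncomputable def entry (f e : K) :
    SchattenClass p (HilbertTensor K H) →L[ℂ] SchattenClass p H :=
  sandwich (tmulLeft f).adjoint (tmulLeft e)

omit [CompleteSpace K] in
theorem inner_entry (f e : K) (z : SchattenClass p (HilbertTensor K H)) (h k : H) :
    ⟪h, (entry f e z).toOp k⟫_ℂ = ⟪tmul f h, z.toOp (tmul e k)⟫_ℂ := by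
  rw [entry, toOp_sandwich, ContinuousLinearMap.comp_apply, ContinuousLinearMap.comp_apply,
    ContinuousLinearMap.adjoint_inner_right]
  rfl

omit [CompleteSpace K] in
/-- Pinching: the diagonal entries of `z` are `p`-summable. -/
theorem sum_enorm_entry_le {n : ℕ} {e f : Fin n → K} (he : Orthonormal ℂ e)
    (hf : Orthonormal ℂ f) (z : SchattenClass p (HilbertTensor K H)) :
    ∑ i, ‖entry (f i) (e i) z‖ₑ ^ p ≤ ‖z‖ₑ ^ p := by
  have hp : 1 ≤ p := Fact.out
  have hp0 : 0 < p := by linarith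
  choose w g l hl h using fun i => exists_singular_basis (entry (f i) (e i) z).compact
  have ho := fun i => orthonormal_singular (g i) (h i)
  -- Tensoring the singular vectors of the `i`-th entry with `e i` and `f i` gives orthonormal
  -- systems. The coefficients of `z` along them are exactly the nonzero singular values of all the
  -- entries.
  have hE := orthonormal_tmul_sigma he
    (v := fun i (k : {k // l i k ≠ 0}) => g i k)
    fun i => (g i).orthonormal.comp _ Subtype.val_injective
  have hF := orthonormal_tmul_sigma hf ho
  have key := tsum_le_of_isBessel hp z.compact (isBessel_of_orthonormal hE)
    (isBessel_of_orthonormal hF)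
  rw [← enorm_def, ENNReal.tsum_sigma', tsum_fintype] at key
  refine le_of_eq_of_le (Finset.sum_congr rfl fun i _ => ?_) key
  rw [enorm_def, eSchattenNorm_of_eigen hp (g i) (hl i) (h i), one_div,
    ENNReal.rpow_inv_rpow hp0.ne']
  have hsub : ∑' k, ENNReal.ofReal (l i k) ^ p =
      ∑' k : {k // l i k ≠ 0}, ENNReal.ofReal (l i k) ^ p := by
    refine (Subtype.val_injective.tsum_eq (f := fun k => ENNReal.ofReal (l i k) ^ p) ?_).symm
    intro k hk
    refine ⟨⟨k, fun h0 => hk ?_⟩, rfl⟩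
    simp [h0, hp0]
  rw [hsub]
  refine tsum_congr fun k => ?_
  rw [← inner_entry, inner_smul_left_eq_smul, inner_singular (g i) (h i),
    inner_self_eq_norm_sq_to_K, (g i).orthonormal.1, smul_smul, ← Real.enorm_of_nonneg (hl i k)]
  have : (l i k)⁻¹ * (l i k) ^ 2 = l i k := by have := k.2; field_simp
  rw [this, enorm_smul]; simp

/-- `s` is the slice `(id ⊗ ψ)(z)`. -/
def IsSlice (ψ : SchattenClass p H →L[ℂ] ℂ) (z : SchattenClass p (HilbertTensor K H))
    (s : SchattenClass p K) : Prop :=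
  ∀ f e, ⟪f, s.toOp e⟫_ℂ = ψ (entry f e z)

/-- The diagonal coefficients of the slice are the values of `ψ` on diagonal entries of `z`, so
pinching bounds their `p`-sum. In effect a functional on `S^p` has cb norm at most its norm. -/
theorem IsSlice.norm_le {ψ : SchattenClass p H →L[ℂ] ℂ} {z : SchattenClass p (HilbertTensor K H)}
    {s : SchattenClass p K} (h : IsSlice ψ z s) : ‖s‖ ≤ ‖ψ‖ * ‖z‖ := by
  have hp : 1 ≤ p := Fact.out
  have hp0 : 0 < p := by linarith
  have key : eSchattenNorm p s.toOp ≤ ‖ψ‖ₑ * ‖z‖ₑ := by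
    refine eSchattenNorm_le hp s.compact fun n e f he hf => ?_
    rw [one_div, ENNReal.rpow_inv_le_iff hp0, ENNReal.mul_rpow_of_nonneg _ _ hp0.le]
    calc ∑ i, ‖⟪f i, s.toOp (e i)⟫_ℂ‖ₑ ^ p
        ≤ ∑ i, ‖ψ‖ₑ ^ p * ‖entry (f i) (e i) z‖ₑ ^ p := by
          refine Finset.sum_le_sum fun i _ => ?_
          rw [h, ← ENNReal.mul_rpow_of_nonneg _ _ hp0.le]
          gcongr
          exact ψ.le_opENorm _
      _ ≤ _ := by
          rw [← Finset.mul_sum]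
          gcongr
          exact sum_enorm_entry_le he hf z
  rw [← enorm_def, ← ofReal_norm, ← ofReal_norm, ← ofReal_norm, ← ENNReal.ofReal_mul
    (norm_nonneg _)] at key
  exact (ENNReal.ofReal_le_ofReal_iff (by positivity)).1 key

theorem IsSlice.add {ψ : SchattenClass p H →L[ℂ] ℂ} {z z' : SchattenClass p (HilbertTensor K H)}
    {s s' : SchattenClass p K} (h : IsSlice ψ z s) (h' : IsSlice ψ z' s') :
    IsSlice ψ (z + z') (s + s') := fun f e => by
  rw [map_add, map_add, map_add, add_apply, inner_add_right, h, h']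

theorem IsSlice.smul {ψ : SchattenClass p H →L[ℂ] ℂ} {z : SchattenClass p (HilbertTensor K H)}
    {s : SchattenClass p K} (h : IsSlice ψ z s) (c : ℂ) : IsSlice ψ (c • z) (c • s) := fun f e => by
  rw [map_smul, map_smul, map_smul, smul_apply, inner_smul_right, h, smul_eq_mul]

theorem isSlice_rankOne (ψ : SchattenClass p H →L[ℂ] ℂ) (ξ η : K) (h k : H) :
    IsSlice ψ (rankOne (tmul ξ h) (tmul η k)) (ψ (rankOne h k) • rankOne ξ η) := fun f e => by
  have h1 : entry f e (rankOne (tmul ξ h) (tmul η k) : SchattenClass p (HilbertTensor K H)) =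
      (⟪f, ξ⟫_ℂ * ⟪η, e⟫_ℂ) • rankOne h k := by
    rw [entry, sandwich_rankOne, adjoint_tmulLeft_tmul, adjoint_tmulLeft_tmul]
    apply toOp_injective
    rw [map_smul]
    simp only [rankOne, toOp_mk]
    ext v
    simp only [InnerProductSpace.rankOne_apply, smul_apply, inner_smul_left, smul_smul,
      inner_conj_symm]
    congr 1
    ring
  rw [h1, map_smul, map_smul, smul_apply, inner_smul_right]
  simp only [rankOne, toOp_mk, InnerProductSpace.rankOne_apply, inner_smul_right, smul_eq_mul]
  ring

end SchattenClass

end Slices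

/-! ### Ampliations of finite rank operators -/

section FiniteRank

open SchattenClass

variable {p : ℝ} [Fact (1 ≤ p)] {K H : Type*} [NormedAddCommGroup K] [InnerProductSpace ℂ K]
  [CompleteSpace K] [NormedAddCommGroup H] [InnerProductSpace ℂ H] [CompleteSpace H]

omit [CompleteSpace K] [CompleteSpace H] in
theorem mem_topologicalClosure_of_rankOne_tmul_mem
    {M : Submodule ℂ (SchattenClass p (HilbertTensor K H))}
    (h : ∀ ξ η h k, rankOne (tmul ξ h) (tmul η k) ∈ M)
    (z : SchattenClass p (HilbertTensor K H)) : z ∈ closure (M : Set (SchattenClass p _)) :=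
  rankOne_tmul_mem M.isClosed_topologicalClosure
    (fun ξ η k l => M.le_topologicalClosure (h ξ η k l)) z

omit [CompleteSpace K] [CompleteSpace H] in
theorem norm_apply_le_of_dense_rankOne_tmul {F : Type*} [SeminormedAddCommGroup F]
    [NormedSpace ℂ F] {Φ : SchattenClass p (HilbertTensor K H) →L[ℂ] F} {C : ℝ}
    {M : Submodule ℂ (SchattenClass p (HilbertTensor K H))}
    (h : ∀ ξ η h k, rankOne (tmul ξ h) (tmul η k) ∈ M) (hM : ∀ z ∈ M, ‖Φ z‖ ≤ C * ‖z‖)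
    (z : SchattenClass p (HilbertTensor K H)) : ‖Φ z‖ ≤ C * ‖z‖ := by
  have hcl : IsClosed {z | ‖Φ z‖ ≤ C * ‖z‖} := isClosed_le (by fun_prop) (by fun_prop)
  exact hcl.closure_subset_iff.2 hM (mem_topologicalClosure_of_rankOne_tmul_mem h z)

/-- The ampliation of a finite rank operator `∑ⱼ ψⱼ ⊗ bⱼ` has norm at most `∑ⱼ ‖ψⱼ‖ ‖bⱼ‖`. -/
theorem IsAmpliation.norm_le_of_finite_rank {T : SchattenClass p H →L[ℂ] SchattenClass p H}
    {Φ : SchattenClass p (HilbertTensor K H) →L[ℂ] SchattenClass p (HilbertTensor K H)}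
    (hΦ : IsAmpliation K T Φ) {ι : Type*} [Fintype ι] (ψ : ι → SchattenClass p H →L[ℂ] ℂ)
    (b : ι → SchattenClass p H) (hT : ∀ x, T x = ∑ j, ψ j x • b j) :
    ‖Φ‖ ≤ ∑ j, ‖ψ j‖ * ‖b j‖ := by
  refine ContinuousLinearMap.opNorm_le_bound _ (by positivity) fun z => ?_
  -- Slices are not constructed for every `z`. The elements that have slices and on which `Φ` has
  -- the expected form are a subspace containing the elementary rank one operators, which is dense.
  let M : Submodule ℂ (SchattenClass p (HilbertTensor K H)) :=
    { carrier := {z | ∃ s : ι → SchattenClass p K, (∀ j, IsSlice (ψ j) z (s j)) ∧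
        Φ z = ∑ j, tensor (s j) (b j)}
      add_mem' := by
        rintro z z' ⟨s, hs, hz⟩ ⟨s', hs', hz'⟩
        refine ⟨fun j => s j + s' j, fun j => (hs j).add (hs' j), ?_⟩
        simp_rw [map_add, hz, hz', tensor_add_left, Finset.sum_add_distrib]
      zero_mem' := by
        refine ⟨fun _ => 0, fun j f e => ?_, ?_⟩
        · rw [map_zero, map_zero, map_zero]; simp
        · have : ∀ j, tensor (0 : SchattenClass p K) (b j) = 0 := fun j => by
            have := tensor_smul_left 0 (0 : SchattenClass p K) (b j)
            simpa using this
          simp [this]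
      smul_mem' := by
        rintro c z ⟨s, hs, hz⟩
        refine ⟨fun j => c • s j, fun j => (hs j).smul c, ?_⟩
        simp_rw [map_smul, hz, tensor_smul_left, Finset.smul_sum] }
  refine norm_apply_le_of_dense_rankOne_tmul (M := M) (fun ξ η h k => ?_) (fun z hz => ?_) z
  · refine ⟨fun j => ψ j (rankOne h k) • rankOne ξ η, fun j => isSlice_rankOne _ _ _ _ _, ?_⟩
    have h1 := hΦ (rankOne ξ η) (rankOne h k) (rankOne (tmul ξ h) (tmul η k))
      (isTensor_rankOne ξ η h k)
    refine toOp_injective (h1.unique fun v x => ?_)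
    rw [hT, map_sum, map_sum]
    simp only [sum_apply, map_smul, smul_apply, tensor_smul_left]
    have h2 : ∀ j, (tensor (rankOne ξ η : SchattenClass p K) (b j)).toOp (tmul v x) =
      tmul ((rankOne ξ η : SchattenClass p K).toOp v) ((b j).toOp x) := fun j =>
        isTensor_tensor _ _ v x
    simp_rw [h2, ← tmulLeft_apply, map_sum, map_smul]
  · obtain ⟨s, hs, hz⟩ := hz
    rw [hz, Finset.sum_mul]
    refine (norm_sum_le _ _).trans (Finset.sum_le_sum fun j _ => ?_)
    rw [norm_tensor, mul_right_comm]
    gcongr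
    exact (hs j).norm_le

end FiniteRank

/-! ### The ampliation by `ℓ²` determines the cb norm -/

section CbNorm

open SchattenClass

variable {p : ℝ} [Fact (1 ≤ p)] {K K' H : Type*} [NormedAddCommGroup K] [InnerProductSpace ℂ K]
  [CompleteSpace K] [NormedAddCommGroup K'] [InnerProductSpace ℂ K'] [CompleteSpace K']
  [NormedAddCommGroup H] [InnerProductSpace ℂ H] [CompleteSpace H]

omit [CompleteSpace K] [CompleteSpace H] in
theorem ext_rankOne_tmul {F : Type*} [NormedAddCommGroup F] [NormedSpace ℂ F]
    {Φ Ψ : SchattenClass p (HilbertTensor K H) →L[ℂ] F}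
    (h : ∀ ξ η h k, Φ (rankOne (tmul ξ h) (tmul η k)) = Ψ (rankOne (tmul ξ h) (tmul η k))) :
    Φ = Ψ := by
  ext1 z
  have := rankOne_tmul_mem (M := LinearMap.ker ((Φ - Ψ : SchattenClass p (HilbertTensor K H) →L[ℂ]
      F) : SchattenClass p (HilbertTensor K H) →ₗ[ℂ] F)) (Φ - Ψ).isClosed_ker
    (fun ξ η k l => by
      rw [LinearMap.mem_ker]
      change Φ _ - Ψ _ = 0
      rw [h, sub_self]) z
  exact sub_eq_zero.1 this

theorem sandwich_tensorMap_rankOne (B : K →L[ℂ] K') (C : K' →L[ℂ] K) (ξ η : K) (h k : H) :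
    sandwich (tensorMap B 1) (tensorMap C 1) (rankOne (tmul ξ h) (tmul η k) :
      SchattenClass p (HilbertTensor K H)) = rankOne (tmul (B ξ) h) (tmul (C.adjoint η) k) := by
  have h1 : (1 : H →L[ℂ] H).adjoint = 1 := ContinuousLinearMap.adjoint_id
  rw [sandwich_rankOne, adjoint_tensorMap, tensorMap_tmul, tensorMap_tmul, h1]
  rfl

/-- Ampliations commute with operators on the first tensor factor. -/
theorem IsAmpliation.sandwich_comm {T : SchattenClass p H →L[ℂ] SchattenClass p H}
    {Φ : SchattenClass p (HilbertTensor K H) →L[ℂ] SchattenClass p (HilbertTensor K H)}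
    {Φ' : SchattenClass p (HilbertTensor K' H) →L[ℂ] SchattenClass p (HilbertTensor K' H)}
    (hΦ : IsAmpliation K T Φ) (hΦ' : IsAmpliation K' T Φ') (B : K →L[ℂ] K') (C : K' →L[ℂ] K)
    (z : SchattenClass p (HilbertTensor K H)) :
    Φ' (sandwich (tensorMap B 1) (tensorMap C 1) z) =
      sandwich (tensorMap B 1) (tensorMap C 1) (Φ z) := by
  suffices Φ' ∘L sandwich (tensorMap B 1) (tensorMap C 1) =
      sandwich (tensorMap B 1) (tensorMap C 1) ∘L Φ from congrArg (fun F => F z) this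
  refine ext_rankOne_tmul fun ξ η h k => ?_
  rw [ContinuousLinearMap.comp_apply, ContinuousLinearMap.comp_apply, sandwich_tensorMap_rankOne]
  have h1 := hΦ (rankOne ξ η) (rankOne h k) (rankOne (tmul ξ h) (tmul η k))
    (isTensor_rankOne ξ η h k)
  have h2 := hΦ' (rankOne (B ξ) (C.adjoint η)) (rankOne h k)
    (rankOne (tmul (B ξ) h) (tmul (C.adjoint η) k)) (isTensor_rankOne _ _ h k)
  refine toOp_injective (h2.unique fun v x => ?_)
  rw [toOp_sandwich, ContinuousLinearMap.comp_apply, ContinuousLinearMap.comp_apply,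
    tensorMap_tmul, h1, tensorMap_tmul]
  have h3 : (rankOne (B ξ) (C.adjoint η) : SchattenClass p K').toOp v =
      B ((rankOne ξ η : SchattenClass p K).toOp (C v)) := by
    simp only [rankOne, toOp_mk, InnerProductSpace.rankOne_apply, map_smul,
      ContinuousLinearMap.adjoint_inner_left]
  rw [h3]
  rfl

/-- A finite-dimensional subspace embeds isometrically into `ℓ²`. -/
theorem exists_adjoint_comp_eq_starProjection (L : Submodule ℂ K) [FiniteDimensional ℂ L] :
    ∃ W : K →L[ℂ] EllTwo, ‖W‖ ≤ 1 ∧ W.adjoint ∘L W = L.starProjection := by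
  let g : HilbertBasis ℕ ℂ EllTwo := HilbertBasis.ofRepr (LinearIsometryEquiv.refl ℂ _)
  let b := stdOrthonormalBasis ℂ L
  let f : L →ₗ[ℂ] EllTwo := b.toBasis.constr ℂ fun i => g i
  have hf : f ∘ b.toBasis = fun i : Fin (Module.finrank ℂ L) => g i := by
    ext1 i
    exact b.toBasis.constr_basis ℂ _ i
  let J : L →ₗᵢ[ℂ] EllTwo := f.isometryOfOrthonormal (v := b.toBasis)
    (by rw [OrthonormalBasis.coe_toBasis]; exact b.orthonormal)
    (by rw [hf]; exact g.orthonormal.comp _ Fin.val_injective)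
  refine ⟨J.toContinuousLinearMap ∘L L.orthogonalProjectionOnto, ?_, ?_⟩
  · refine ContinuousLinearMap.opNorm_le_bound _ zero_le_one fun x => ?_
    rw [one_mul, ContinuousLinearMap.comp_apply]
    exact (J.norm_map _).trans_le (L.norm_orthogonalProjectionOnto_apply_le x)
  · ext x
    refine ext_inner_left ℂ fun v => ?_
    rw [ContinuousLinearMap.comp_apply, ContinuousLinearMap.adjoint_inner_right]
    change ⟪J (L.orthogonalProjectionOnto v), J (L.orthogonalProjectionOnto x)⟫_ℂ = _
    -- With `P` the projection onto `L` and `J` isometric, `⟪J P v, J P x⟫ = ⟪P v, P x⟫ = ⟪v, P x⟫`.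
    rw [J.inner_map_map, Submodule.starProjection_apply, Submodule.coe_inner,
      ← Submodule.starProjection_apply, ← Submodule.starProjection_apply,
      Submodule.inner_starProjection_left_eq_right,
      Submodule.starProjection_eq_self_iff.2 (Submodule.starProjection_apply_mem _ _)]

omit [CompleteSpace K] in
theorem starProjection_mul_of_le {L M : Submodule ℂ K} [L.HasOrthogonalProjection]
    [M.HasOrthogonalProjection] (h : L ≤ M) :
    M.starProjection * L.starProjection = L.starProjection := by
  ext x
  rw [mul_apply_eq_comp, Submodule.starProjection_eq_self_iff]
  exact h (Submodule.starProjection_apply_mem _ _)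

theorem mul_starProjection_of_le {L M : Submodule ℂ K} [L.HasOrthogonalProjection]
    [M.HasOrthogonalProjection] (h : L ≤ M) :
    L.starProjection * M.starProjection = L.starProjection := by
  have h1 := congrArg star (starProjection_mul_of_le h)
  have h2 := (isStarProjection_starProjection (U := L)).isSelfAdjoint.star_eq
  have h3 := (isStarProjection_starProjection (U := M)).isSelfAdjoint.star_eq
  rwa [star_mul, h2, h3] at h1

/-- The `ℓ²`-ampliation dominates all ampliations. -/
theorem IsAmpliation.norm_le_ellTwo {T : SchattenClass p H →L[ℂ] SchattenClass p H}
    {Φ : SchattenClass p (HilbertTensor K H) →L[ℂ] SchattenClass p (HilbertTensor K H)}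
    {Ψ : SchattenClass p (HilbertTensor EllTwo H) →L[ℂ] SchattenClass p (HilbertTensor EllTwo H)}
    (hΦ : IsAmpliation K T Φ) (hΨ : IsAmpliation EllTwo T Ψ) : ‖Φ‖ ≤ ‖Ψ‖ := by
  refine ContinuousLinearMap.opNorm_le_bound _ (norm_nonneg _) fun z => ?_
  -- Enlarging the supporting subspace is harmless; this makes the finitely supported elements
  -- closed under addition.
  have hmono : ∀ (L L' : Submodule ℂ K) [FiniteDimensional ℂ L] [FiniteDimensional ℂ L'],
      L ≤ L' → ∀ z : SchattenClass p (HilbertTensor K H),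
      compress (tensorMap L.starProjection 1) z = z →
      compress (tensorMap L'.starProjection 1) z = z := by
    intro L L' _ _ hL z hz
    have h1 : tensorMap L'.starProjection (1 : H →L[ℂ] H) * tensorMap L.starProjection 1 =
        tensorMap L.starProjection 1 := by
      rw [tensorMap_mul, starProjection_mul_of_le hL, one_mul]
    have h2 : tensorMap L.starProjection (1 : H →L[ℂ] H) * tensorMap L'.starProjection 1 =
        tensorMap L.starProjection 1 := by
      rw [tensorMap_mul, mul_starProjection_of_le hL, one_mul]
    conv_lhs => rw [← hz, ← compress_mul _ _ (h1.trans h2.symm), h1, hz]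
  let M : Submodule ℂ (SchattenClass p (HilbertTensor K H)) :=
    { carrier := {z | ∃ (L : Submodule ℂ K) (_ : FiniteDimensional ℂ L),
        compress (tensorMap L.starProjection 1) z = z}
      add_mem' := by
        rintro z z' ⟨L, _, hz⟩ ⟨L', _, hz'⟩
        refine ⟨L ⊔ L', inferInstance, ?_⟩
        rw [map_add, hmono L _ le_sup_left _ hz, hmono L' _ le_sup_right _ hz']
      zero_mem' := ⟨⊥, inferInstance, map_zero _⟩
      smul_mem' := by
        rintro c z ⟨L, _, hz⟩
        exact ⟨L, inferInstance, by rw [map_smul, hz]⟩ }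
  refine norm_apply_le_of_dense_rankOne_tmul (M := M) (fun ξ η h k => ?_) (fun z hz => ?_) z
  · refine ⟨Submodule.span ℂ {ξ, η}, FiniteDimensional.span_of_finite ℂ (Set.toFinite _), ?_⟩
    have : FiniteDimensional ℂ (Submodule.span ℂ {ξ, η}) :=
      FiniteDimensional.span_of_finite ℂ (Set.toFinite _)
    rw [compress, sandwich_tensorMap_rankOne, ← ContinuousLinearMap.star_eq_adjoint,
      isStarProjection_starProjection.isSelfAdjoint.star_eq,
      Submodule.starProjection_eq_self_iff.2 (Submodule.subset_span (by simp)),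
      Submodule.starProjection_eq_self_iff.2 (Submodule.subset_span (by simp))]
  · obtain ⟨L, _, hL⟩ := hz
    obtain ⟨W, hW, hWL⟩ := exists_adjoint_comp_eq_starProjection L
    -- An element supported on a finite-dimensional `L` is moved into `S^p(ℓ² ⊗₂ H)` by `W` and
    -- recovered by `W*`, because `W* W` is the projection onto `L`. Both moves are contractive and
    -- commute with the ampliations.
    set y := sandwich (tensorMap W (1 : H →L[ℂ] H)) (tensorMap W.adjoint (1 : H →L[ℂ] H)) z with hy
    have hone : ‖(1 : H →L[ℂ] H)‖ ≤ 1 := ContinuousLinearMap.norm_id_le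
    have hW1 : ‖tensorMap W (1 : H →L[ℂ] H)‖ ≤ 1 :=
      (norm_tensorMap_le _ _).trans (mul_le_one₀ hW (norm_nonneg _) hone)
    have hW2 : ‖tensorMap W.adjoint (1 : H →L[ℂ] H)‖ ≤ 1 :=
      (norm_tensorMap_le _ _).trans (mul_le_one₀ (by rwa [LinearIsometryEquiv.norm_map])
        (norm_nonneg _) hone)
    have h1 :
        sandwich (tensorMap W.adjoint (1 : H →L[ℂ] H)) (tensorMap W (1 : H →L[ℂ] H)) y = z := by
      conv_rhs => rw [← hL]
      apply toOp_injective
      rw [toOp_compress, toOp_sandwich, hy, toOp_sandwich, ← hWL]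
      have h2 : tensorMap (W.adjoint ∘L W) (1 : H →L[ℂ] H) =
          tensorMap W.adjoint (1 : H →L[ℂ] H) ∘L tensorMap W 1 := by
        rw [tensorMap_comp]; rfl
      rw [h2]
      rfl
    rw [← h1, hΨ.sandwich_comm hΦ, h1]
    exact (norm_sandwich_apply_le hW2 hW1 _).trans ((Ψ.le_opNorm _).trans
      (by gcongr; exact norm_sandwich_apply_le hW1 hW2 _))

theorem cbNorm_le_enorm_ampliation (T : CB p H) : cbNorm T ≤ ‖ampliation EllTwo T‖ₑ := by
  refine iSup_le fun K => iSup_le fun _ => iSup_le fun _ => iSup_le fun _ => ?_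
  rw [enorm_le_iff_norm_le]
  exact (ampliation_spec K T).norm_le_ellTwo (ampliation_spec EllTwo T)

end CbNorm

/-! ### Composition, compression and finite rank in `CB` -/

section Algebra

open SchattenClass

variable {p : ℝ} [Fact (1 ≤ p)] {H : Type*} [NormedAddCommGroup H] [InnerProductSpace ℂ H]
  [CompleteSpace H]

namespace CB

/-- The composition of completely bounded maps. -/
noncomputable def comp (S T : CB p H) : CB p H :=
  ⟨(S : SchattenClass p H →L[ℂ] SchattenClass p H) ∘L T, fun K _ _ _ =>
    ⟨ampliation K S ∘L ampliation K T, fun a b z hz =>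
      ampliation_spec K S a _ _ (ampliation_spec K T a b z hz)⟩⟩

theorem ampliation_comp (K : Type) [NormedAddCommGroup K] [InnerProductSpace ℂ K]
    [CompleteSpace K] (S T : CB p H) :
    ampliation K (comp S T) = ampliation K S ∘L ampliation K T :=
  (ampliation_spec K (comp S T)).unique fun a b z hz =>
    ampliation_spec K S a _ _ (ampliation_spec K T a b z hz)

theorem ampliation_idCB (K : Type) [NormedAddCommGroup K] [InnerProductSpace ℂ K]
    [CompleteSpace K] : ampliation K (idCB : CB p H) = ContinuousLinearMap.id ℂ _ :=
  (ampliation_spec K idCB).unique fun _ _ _ h => h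

theorem isAmpliation_compress {K : Type*} [NormedAddCommGroup K] [InnerProductSpace ℂ K]
    [CompleteSpace K] (Q : H →L[ℂ] H) :
    IsAmpliation K (compress Q : SchattenClass p H →L[ℂ] _) (compress (tensorMap 1 Q)) :=
  fun a b z hz ξ h => by
    rw [toOp_compress, mul_apply_eq_comp, mul_apply_eq_comp, tensorMap_tmul, hz, tensorMap_tmul]
    rfl

/-- The compression `z ↦ Q z Q` as a completely bounded map. -/
noncomputable def compression (Q : H →L[ℂ] H) : CB p H :=
  ⟨compress Q, fun _ _ _ _ => ⟨_, isAmpliation_compress Q⟩⟩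

theorem ampliation_compression (K : Type) [NormedAddCommGroup K] [InnerProductSpace ℂ K]
    [CompleteSpace K] (Q : H →L[ℂ] H) :
    ampliation K (compression Q : CB p H) = compress (tensorMap 1 Q) :=
  (ampliation_spec K _).unique (isAmpliation_compress Q)

/-- The linear map `T ↦ Π T Π`, where `Π` is the compression by `Q`. -/
noncomputable def conj (Q : H →L[ℂ] H) : CB p H →ₗ[ℂ] CB p H where
  toFun T := comp (compression Q) (comp T (compression Q))
  map_add' S T := Subtype.ext <| by
    ext1 x
    exact map_add (compress Q) _ _
  map_smul' c T := Subtype.ext <| by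
    ext1 x
    exact map_smul (compress Q) _ _

theorem conj_apply_apply (Q : H →L[ℂ] H) (T : CB p H) (x : SchattenClass p H) :
    (conj Q T : SchattenClass p H →L[ℂ] SchattenClass p H) x =
      compress Q ((T : SchattenClass p H →L[ℂ] SchattenClass p H) (compress Q x)) := rfl

theorem ampliation_conj (K : Type) [NormedAddCommGroup K] [InnerProductSpace ℂ K]
    [CompleteSpace K] (Q : H →L[ℂ] H) (T : CB p H)
    (z : SchattenClass p (HilbertTensor K H)) :
    ampliation K (conj Q T) z =
      compress (tensorMap 1 Q) (ampliation K T (compress (tensorMap 1 Q) z)) := by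
  change ampliation K (comp (compression Q) (comp T (compression Q))) z = _
  rw [ampliation_comp, ampliation_comp, ampliation_compression]
  rfl

theorem isStarProjection_one_tensorMap {K : Type*} [NormedAddCommGroup K] [InnerProductSpace ℂ K]
    [CompleteSpace K] {Q : H →L[ℂ] H} (hQ : IsStarProjection Q) :
    IsStarProjection (tensorMap (1 : K →L[ℂ] K) Q) :=
  isStarProjection_tensorMap (.one _) hQ

theorem norm_ampliation_conj_apply_le (K : Type) [NormedAddCommGroup K] [InnerProductSpace ℂ K]
    [CompleteSpace K] {Q : H →L[ℂ] H} (hQ : IsStarProjection Q) (T : CB p H)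
    (z : SchattenClass p (HilbertTensor K H)) :
    ‖ampliation K (conj Q T) z‖ ≤ ‖ampliation K T (compress (tensorMap 1 Q) z)‖ := by
  rw [ampliation_conj]
  exact norm_compress_le (isStarProjection_one_tensorMap hQ) _

theorem norm_ampliation_conj_le (K : Type) [NormedAddCommGroup K] [InnerProductSpace ℂ K]
    [CompleteSpace K] {Q : H →L[ℂ] H} (hQ : IsStarProjection Q) (T : CB p H) :
    ‖ampliation K (conj Q T)‖ ≤ ‖ampliation K T‖ := by
  refine ContinuousLinearMap.opNorm_le_bound _ (norm_nonneg _) fun z => ?_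
  refine (norm_ampliation_conj_apply_le K hQ T z).trans
    ((ContinuousLinearMap.le_opNorm _ _).trans ?_)
  gcongr
  exact norm_compress_le (isStarProjection_one_tensorMap hQ) _

/-- The hypotheses say `Q ≤ R` when both are projections: compressing first to the larger range
changes nothing. -/
theorem conj_conj {Q R : H →L[ℂ] H} (h : Q * R = Q) (h' : R * Q = Q) (T : CB p H) :
    conj Q (conj R T) = conj Q T := by
  refine Subtype.ext ?_
  ext1 x
  rw [conj_apply_apply, conj_apply_apply, conj_apply_apply, ← compress_mul _ _ (h.trans h'.symm), h,
    ← compress_mul _ _ (h'.trans h.symm), h']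

variable (p H) in
/-- The completely bounded maps of finite rank. -/
noncomputable def finiteRank : Submodule ℂ (CB p H) where
  carrier := {T | FiniteDimensional ℂ
    (T : SchattenClass p H →L[ℂ] SchattenClass p H).toLinearMap.range}
  add_mem' {S T} hS hT := by
    simp only [Set.mem_ofPred_eq] at *
    refine Submodule.finiteDimensional_of_le (S₂ :=
      (S : SchattenClass p H →L[ℂ] SchattenClass p H).toLinearMap.range ⊔
      (T : SchattenClass p H →L[ℂ] SchattenClass p H).toLinearMap.range) ?_
    rintro _ ⟨x, rfl⟩
    exact Submodule.add_mem_sup ⟨x, rfl⟩ ⟨x, rfl⟩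
  zero_mem' := by
    simp only [Set.mem_ofPred_eq]
    refine Submodule.finiteDimensional_of_le (S₂ := ⊥) ?_
    rintro _ ⟨x, rfl⟩
    rfl
  smul_mem' c T hT := by
    simp only [Set.mem_ofPred_eq] at *
    refine Submodule.finiteDimensional_of_le (S₂ :=
      (T : SchattenClass p H →L[ℂ] SchattenClass p H).toLinearMap.range) ?_
    rintro _ ⟨x, rfl⟩
    exact Submodule.smul_mem _ c ⟨x, rfl⟩

theorem mem_finiteRank {T : CB p H} : T ∈ finiteRank p H ↔ FiniteDimensional ℂ
    (T : SchattenClass p H →L[ℂ] SchattenClass p H).toLinearMap.range := Iff.rfl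

theorem comp_mem_finiteRank_left {S : CB p H} (hS : S ∈ finiteRank p H) (T : CB p H) :
    comp S T ∈ finiteRank p H := by
  rw [mem_finiteRank] at *
  refine Submodule.finiteDimensional_of_le (S₂ :=
      (S : SchattenClass p H →L[ℂ] SchattenClass p H).toLinearMap.range) ?_
  rintro _ ⟨x, rfl⟩
  exact ⟨_, rfl⟩

theorem comp_mem_finiteRank_right (S : CB p H) {T : CB p H} (hT : T ∈ finiteRank p H) :
    comp S T ∈ finiteRank p H := by
  rw [mem_finiteRank] at *
  refine Submodule.finiteDimensional_of_le (S₂ :=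
      (T : SchattenClass p H →L[ℂ] SchattenClass p H).toLinearMap.range.map
      (S : SchattenClass p H →L[ℂ] SchattenClass p H).toLinearMap) ?_
  rintro _ ⟨x, rfl⟩
  exact ⟨_, ⟨x, rfl⟩, rfl⟩

/-- Coordinates of a finite rank operator. -/
theorem exists_eq_sum_of_mem_finiteRank {T : CB p H} (hT : T ∈ finiteRank p H) :
    ∃ (n : ℕ) (ψ : Fin n → SchattenClass p H →L[ℂ] ℂ) (b : Fin n → SchattenClass p H),
      ∀ x, (T : SchattenClass p H →L[ℂ] SchattenClass p H) x = ∑ j, ψ j x • b j := by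
  rw [mem_finiteRank] at hT
  set T' := (T : SchattenClass p H →L[ℂ] SchattenClass p H)
  let b := Module.finBasis ℂ T'.toLinearMap.range
  refine ⟨_, fun j => (b.coord j).toContinuousLinearMap ∘L
    T'.codRestrict T'.toLinearMap.range (LinearMap.mem_range_self T'.toLinearMap), fun j => b j,
    fun x => ?_⟩
  have h := congrArg Subtype.val (b.sum_repr ⟨T' x, LinearMap.mem_range_self T'.toLinearMap x⟩)
  refine h.symm.trans ?_
  rw [Submodule.coe_sum]
  rfl

end CB

end Algebra

/-! ### Convergence along finite rank projections -/

section FiniteProjections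

open SchattenClass Filter

variable {H : Type*} [NormedAddCommGroup H] [InnerProductSpace ℂ H]

/-- The orthogonal projection onto the span of a finite set. -/
noncomputable def finProj (s : Finset H) : H →L[ℂ] H :=
  (Submodule.span ℂ (s : Set H)).starProjection

theorem finProj_apply_of_mem {s : Finset H} {x : H} (hx : x ∈ s) : finProj s x = x :=
  Submodule.starProjection_eq_self_iff.2 (Submodule.subset_span hx)

theorem finProj_mul_of_subset' {s t : Finset H} (h : s ⊆ t) : finProj t * finProj s = finProj s :=
  starProjection_mul_of_le (Submodule.span_mono (by exact_mod_cast h))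

variable [CompleteSpace H]

theorem isStarProjection_finProj (s : Finset H) : IsStarProjection (finProj s) :=
  isStarProjection_starProjection

theorem finProj_mul_of_subset {s t : Finset H} (h : s ⊆ t) : finProj s * finProj t = finProj s :=
  mul_starProjection_of_le (Submodule.span_mono (by exact_mod_cast h))

variable {p : ℝ} [Fact (1 ≤ p)]

theorem compress_rankOne {Q : H →L[ℂ] H} (hQ : IsSelfAdjoint Q) (x y : H) :
    compress Q (rankOne x y : SchattenClass p H) = rankOne (Q x) (Q y) := by
  rw [compress, sandwich_rankOne, ← ContinuousLinearMap.star_eq_adjoint, hQ.star_eq]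

/-- Finite sums of rank one operators are dense and are eventually fixed by the compressions, which
are contractions. -/
theorem tendsto_compress_finProj (z : SchattenClass p H) :
    Tendsto (fun s : Finset H => compress (finProj s) z) atTop (𝓝 z) := by
  classical
  rw [Metric.tendsto_atTop]
  intro ε hε
  obtain ⟨n, x, y, hxy⟩ := exists_sum_rankOne (p := p) Fact.out z.lt_top
    (ENNReal.ofReal_pos.2 (half_pos hε))
  set a : SchattenClass p H := ∑ i, rankOne (x i) (y i) with ha
  have haz : ‖z - a‖ < ε / 2 := by
    rw [norm_def, map_sub, ha, map_sum]
    exact ENNReal.toReal_lt_of_lt_ofReal hxy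
  refine ⟨Finset.univ.image x ∪ Finset.univ.image y, fun s hs => ?_⟩
  have hfix : compress (finProj s) a = a := by
    rw [ha, map_sum]
    refine Finset.sum_congr rfl fun i _ => ?_
    rw [compress_rankOne (isStarProjection_finProj s).isSelfAdjoint,
      finProj_apply_of_mem (hs (by simp)), finProj_apply_of_mem (hs (by simp))]
  rw [dist_eq_norm]
  calc ‖compress (finProj s) z - z‖ = ‖compress (finProj s) (z - a) - (z - a)‖ := by
        rw [map_sub, hfix]; congr 1; abel
    _ ≤ ‖compress (finProj s) (z - a)‖ + ‖z - a‖ := norm_sub_le _ _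
    _ ≤ ‖z - a‖ + ‖z - a‖ := by
        gcongr; exact norm_compress_le (isStarProjection_finProj s) _
    _ < ε := by linarith

/-- A phase aligns the two numbers, so that a bound for a functional on a sum controls the sum of
moduli. -/
theorem exists_norm_add_mul_eq (a b : ℂ) : ∃ c : ℂ, ‖c‖ = 1 ∧ ‖a + c * b‖ = ‖a‖ + ‖b‖ := by
  obtain ⟨u, hu, hau⟩ := RCLike.exists_norm_eq_mul_self a
  obtain ⟨v, hv, hbv⟩ := RCLike.exists_norm_eq_mul_self b
  have hu0 : u ≠ 0 := fun h => by simp [h] at hu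
  refine ⟨u⁻¹ * v, by rw [norm_mul, norm_inv, hu, hv]; norm_num, ?_⟩
  have h : u * (a + u⁻¹ * v * b) = ((‖a‖ + ‖b‖ : ℝ) : ℂ) := by
    rw [mul_add, ← mul_assoc, ← mul_assoc, mul_inv_cancel₀ hu0, one_mul, ← hau, ← hbv]
    push_cast
    rfl
  have h2 := congrArg norm h
  rwa [norm_mul, hu, one_mul, Complex.norm_real, Real.norm_of_nonneg (by positivity)] at h2

/-- Compressions converge in norm on the dual of `S^p(H)`, `p > 1`. -/
theorem tendsto_comp_compress_finProj (hp : 1 < p) (ψ : SchattenClass p H →L[ℂ] ℂ) :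
    Tendsto (fun s : Finset H => ψ ∘L compress (finProj s)) atTop (𝓝 ψ) := by
  rw [Metric.tendsto_nhds]
  intro ε hε
  set N := ‖ψ‖ with hN
  have hN0 : 0 ≤ N := norm_nonneg _
  set δ := ε / (8 * (N + 1)) with hδ
  have hδ0 : 0 < δ := by positivity
  obtain ⟨t, ht0, ht⟩ := exists_smooth (p := p) (H := H) hp hδ0
  set η := ε * t / 16 with hη
  have hη0 : 0 < η := by positivity
  -- A vector that almost norms `ψ`. Its compressions converge to it and so almost norm `ψ` too from
  -- some finite set on; `η` is small compared with the perturbation size `t`.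
  obtain ⟨x, hx1, hx⟩ := ψ.exists_lt_apply_of_lt_opNorm (r := N - η) (by linarith)
  have htend : Tendsto (fun s : Finset H => ‖ψ (compress (finProj s) x)‖) atTop (𝓝 ‖ψ x‖) :=
    ((ψ.continuous.tendsto _).comp (tendsto_compress_finProj x)).norm
  filter_upwards [htend.eventually (lt_mem_nhds hx)] with s hs
  have hQ := isStarProjection_finProj s
  have hidem : ∀ y : SchattenClass p H,
      compress (finProj s) (compress (finProj s) y) = compress (finProj s) y := fun y => by
    rw [← compress_mul _ _ rfl, hQ.isIdempotentElem.eq]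
  rw [dist_eq_norm]
  refine lt_of_le_of_lt (ContinuousLinearMap.opNorm_le_of_unit_norm (C := ε / 2) (by positivity)
    fun v hv => ?_) (by linarith)
  set a := compress (finProj s) x with ha
  have ha1 : ‖a‖ ≤ 1 := (norm_compress_le hQ x).trans hx1.le
  -- The factor `1 / 2` puts the part of `v` outside the compression in the unit ball, as `‖v - P v‖
  -- ≤ 2`.
  set z : SchattenClass p H := (1 / 2 : ℂ) • (v - compress (finProj s) v) with hz
  have hz1 : ‖z‖ ≤ 1 := by
    rw [hz, norm_smul]
    have h1 := norm_sub_le v (compress (finProj s) v)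
    have h2 := norm_compress_le hQ v
    have h3 : ‖(1 / 2 : ℂ)‖ = 1 / 2 := by norm_num
    rw [h3]
    linarith
  have hz0 : compress (finProj s) z = 0 := by
    rw [hz, map_smul, map_sub, hidem, sub_self, smul_zero]
  obtain ⟨c, hc1, hc⟩ := exists_norm_add_mul_eq (ψ a) ((t : ℂ) * ψ z)
  have h1 := ht (finProj s) hQ a (c • z) (hidem x) ha1 (by rw [map_smul, hz0, smul_zero])
    (by rw [norm_smul, hc1, one_mul]; exact hz1)
  have h2 : ‖ψ a‖ + t * ‖ψ z‖ ≤ N * (1 + δ * t) := by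
    have h3 : ‖ψ (a + (t : ℂ) • c • z)‖ = ‖ψ a‖ + t * ‖ψ z‖ := by
      rw [map_add, map_smul, map_smul, smul_eq_mul, smul_eq_mul, mul_left_comm, hc, norm_mul,
        Complex.norm_real, Real.norm_of_nonneg ht0.le]
    rw [← h3]
    exact (ψ.le_opNorm _).trans (by gcongr)
  -- The value at `a` already exceeds `N - η`, while smoothness caps the total at `N (1 + δ t)`;
  -- only `N δ t + η` is left for `z`.
  have h4 : t * ‖ψ z‖ ≤ t * (N * δ + ε / 16) := by
    have : t * (N * δ + ε / 16) = N * (1 + δ * t) - (N - η) := by rw [hη]; ring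
    rw [this]
    linarith
  have h5 : ‖ψ z‖ ≤ N * δ + ε / 16 := le_of_mul_le_mul_left h4 ht0
  have h6 : N * δ ≤ ε / 8 := by
    rw [hδ, mul_div_assoc', div_le_div_iff₀ (by positivity) (by norm_num)]
    nlinarith
  have h7 : (ψ ∘L compress (finProj s) - ψ) v = -(2 * ψ z) := by
    rw [hz, map_smul, map_sub, smul_eq_mul, sub_apply, ContinuousLinearMap.comp_apply]
    ring
  rw [h7, norm_neg, norm_mul]
  have h8 : ‖(2 : ℂ)‖ = 2 := by norm_num
  rw [h8]
  linarith

open CB in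
/-- Finite rank operators are norm limits of their compressions. -/
theorem tendsto_norm_ampliation_sub_conj (hp : 1 < p) (K : Type) [NormedAddCommGroup K]
    [InnerProductSpace ℂ K] [CompleteSpace K] {T : CB p H} (hT : T ∈ finiteRank p H) :
    Tendsto (fun s : Finset H => ‖ampliation K (T - conj (finProj s) T)‖) atTop (𝓝 0) := by
  obtain ⟨n, ψ, b, hψ⟩ := exists_eq_sum_of_mem_finiteRank hT
  have hbound : ∀ s : Finset H, ‖ampliation K (T - conj (finProj s) T)‖ ≤
      ∑ j, (‖ψ j - ψ j ∘L compress (finProj s)‖ * ‖b j‖ +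
        ‖ψ j ∘L compress (finProj s)‖ * ‖b j - compress (finProj s) (b j)‖) := by
    intro s
    -- With `T = ∑ ψⱼ ⊗ bⱼ`, the difference `T - P T P` is `∑ (ψⱼ - ψⱼ P) ⊗ bⱼ + ∑ ψⱼ P ⊗ (bⱼ - P
    -- bⱼ)`. The first part needs norm convergence on the dual, which is where `p > 1` enters.
    have := (ampliation_spec K (T - conj (finProj s) T)).norm_le_of_finite_rank
      (Sum.elim (fun j => ψ j - ψ j ∘L compress (finProj s)) fun j => ψ j ∘L compress (finProj s))
      (Sum.elim b fun j => b j - compress (finProj s) (b j)) fun x => by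
        rw [Submodule.coe_sub, sub_apply, conj_apply_apply, hψ, hψ, map_sum,
          Fintype.sum_sum_type, ← Finset.sum_sub_distrib, ← Finset.sum_add_distrib]
        refine Finset.sum_congr rfl fun j _ => ?_
        simp only [Sum.elim_inl, Sum.elim_inr, sub_apply, ContinuousLinearMap.comp_apply, sub_smul,
          smul_sub, map_smul]
        abel
    rw [Fintype.sum_sum_type] at this
    rw [Finset.sum_add_distrib]
    exact this
  refine squeeze_zero (fun _ => norm_nonneg _) hbound ?_
  have h1 : ∀ j, Tendsto (fun s : Finset H => ‖ψ j - ψ j ∘L compress (finProj s)‖) atTop (𝓝 0) :=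
    fun j => by
      have := (tendsto_const_nhds (x := ψ j)).sub (tendsto_comp_compress_finProj hp (ψ j))
      rw [sub_self] at this
      exact tendsto_zero_iff_norm_tendsto_zero.1 this
  have h2 : ∀ j, Tendsto (fun s : Finset H => ‖b j - compress (finProj s) (b j)‖) atTop (𝓝 0) :=
    fun j => by
      have := (tendsto_const_nhds (x := b j)).sub (tendsto_compress_finProj (b j))
      rw [sub_self] at this
      exact tendsto_zero_iff_norm_tendsto_zero.1 this
  have h3 := tendsto_finsetSum Finset.univ fun j (_ : j ∈ Finset.univ) =>
    ((h1 j).mul_const ‖b j‖).add ((tendsto_comp_compress_finProj hp (ψ j)).norm.mul (h2 j))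
  simpa using h3

end FiniteProjections

/-! ### Norm approximation of functionals by their compressions -/

section Functionals

open SchattenClass Filter CB

variable {p : ℝ} [Fact (1 ≤ p)] {H : Type*} [NormedAddCommGroup H] [InnerProductSpace ℂ H]
  [CompleteSpace H]

theorem compress_compress {Q : H →L[ℂ] H} (hQ : IsStarProjection Q) (z : SchattenClass p H) :
    compress Q (compress Q z) = compress Q z := by
  rw [← compress_mul _ _ rfl, hQ.isIdempotentElem.eq]

theorem CB.real_smul_eq (r : ℝ) (T : CB p H) : r • T = (r : ℂ) • T :=
  (algebraMap_smul ℂ r T).symm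

theorem ampliation_real_smul (r : ℝ) (T : CB p H) :
    ampliation EllTwo (r • T) = (r : ℂ) • ampliation EllTwo T := by
  rw [CB.real_smul_eq, map_smul]

theorem norm_ampliation_real_smul (r : ℝ) (T : CB p H) :
    ‖ampliation EllTwo (r • T)‖ = |r| * ‖ampliation EllTwo T‖ := by
  rw [ampliation_real_smul, norm_smul, Complex.norm_real, Real.norm_eq_abs]

theorem real_smul_mem_finiteRank (r : ℝ) {T : CB p H} (hT : T ∈ finiteRank p H) :
    r • T ∈ finiteRank p H := by
  rw [CB.real_smul_eq]; exact (finiteRank p H).smul_mem _ hT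

theorem conj_mem_finiteRank (Q : H →L[ℂ] H) {T : CB p H} (hT : T ∈ finiteRank p H) :
    conj Q T ∈ finiteRank p H :=
  comp_mem_finiteRank_right _ (comp_mem_finiteRank_left hT _)

/-- If `φ ≤ N ‖·‖` on the unit ball of a subspace, then `φ ≤ N ‖·‖` on the subspace. -/
theorem le_mul_of_unit_ball {V : Submodule ℂ (CB p H)} {φ : CB p H →ₗ[ℝ] ℝ} {u N : ℝ}
    (hu : ∀ T, φ T ≤ u * ‖ampliation EllTwo T‖)
    (hN : ∀ T ∈ V, ‖ampliation EllTwo T‖ ≤ 1 → φ T ≤ N) {T : CB p H} (hT : T ∈ V) :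
    φ T ≤ N * ‖ampliation EllTwo T‖ := by
  -- An operator whose ampliation vanishes cannot be normalized; the a priori bound `hu` covers it.
  rcases (norm_nonneg (ampliation EllTwo T)).eq_or_lt with h0 | h0
  · have := hu T
    rw [← h0, mul_zero] at this ⊢
    exact this
  · set a := ‖ampliation EllTwo T‖ with ha
    have h1 := hN (a⁻¹ • T) (by rw [CB.real_smul_eq]; exact V.smul_mem _ hT) (by
      rw [norm_ampliation_real_smul, abs_of_pos (inv_pos.2 h0), ← ha, inv_mul_cancel₀ h0.ne'])
    rw [map_smul, smul_eq_mul, inv_mul_le_iff₀ h0] at h1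
    linarith

/-- A perturbation of a compressed contraction by a part that leaves the compression. -/
theorem norm_ampliation_add_left_le {Q : H →L[ℂ] H} (hQ : IsStarProjection Q) {t δ : ℝ}
    (ht0 : 0 < t)
    (ht : ∀ a z : SchattenClass p (HilbertTensor EllTwo H), compress (tensorMap 1 Q) a = a →
      ‖a‖ ≤ 1 → compress (tensorMap 1 Q) z = 0 → ‖z‖ ≤ 1 → ‖a + (t : ℂ) • z‖ ≤ 1 + δ * t)
    (hδ : 0 ≤ δ) {T S : CB p H} (hT : ‖ampliation EllTwo T‖ ≤ 1) (hS : ‖ampliation EllTwo S‖ ≤ 1) :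
    ‖ampliation EllTwo (conj Q T + (t / 2 : ℝ) • (S - comp (compression Q) S))‖ ≤ 1 + δ * t := by
  have hQ' := isStarProjection_one_tensorMap (K := EllTwo) hQ
  refine ContinuousLinearMap.opNorm_le_of_unit_norm (by positivity) fun x hx => ?_
  set Q' := tensorMap (1 : EllTwo →L[ℂ] EllTwo) Q
  set y := ampliation EllTwo S x with hy
  have hy1 : ‖y‖ ≤ 1 := (ContinuousLinearMap.le_opNorm _ _).trans (by rwa [hx, mul_one])
  -- At each point the value splits into a part fixed by the compression and `t` times a part
  -- annihilated by it, as `exists_smooth` requires.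
  have hval : ampliation EllTwo (conj Q T + (t / 2 : ℝ) • (S - comp (compression Q) S)) x =
      ampliation EllTwo (conj Q T) x + (t : ℂ) • ((1 / 2 : ℂ) • (y - compress Q' y)) := by
    rw [map_add, ampliation_real_smul, map_sub, ampliation_comp, ampliation_compression, add_apply,
      smul_apply, sub_apply, ContinuousLinearMap.comp_apply, smul_smul]
    congr 2
    push_cast
    ring
  rw [hval]
  refine ht _ _ ?_ ?_ ?_ ?_
  · rw [ampliation_conj, compress_compress hQ']
  · refine (ContinuousLinearMap.le_opNorm _ _).trans ?_
    rw [hx, mul_one]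
    exact (norm_ampliation_conj_le EllTwo hQ T).trans hT
  · rw [map_smul, map_sub, compress_compress hQ', sub_self, smul_zero]
  · rw [norm_smul]
    have h1 := norm_sub_le y (compress Q' y)
    have h2 := norm_compress_le hQ' y
    have h3 : ‖(1 / 2 : ℂ)‖ = 1 / 2 := by norm_num
    rw [h3]
    linarith

/-- A perturbation of a compressed contraction by a part that does not see the compression. -/
theorem norm_ampliation_add_right_le {Q : H →L[ℂ] H} (hQ : IsStarProjection Q) {t δ : ℝ}
    (ht0 : 0 < t) (hδ : 0 ≤ δ)
    (ht : ∀ z : SchattenClass p (HilbertTensor EllTwo H), ‖z‖ ≤ 1 →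
      ‖compress (tensorMap 1 Q) z‖ + t * ‖z - compress (tensorMap 1 Q) z‖ ≤ 1 + δ * t)
    {T S : CB p H} (hT : ‖ampliation EllTwo T‖ ≤ 1) (hS : ‖ampliation EllTwo S‖ ≤ 1) :
    ‖ampliation EllTwo (conj Q T + t • (comp (compression Q) S - conj Q S))‖ ≤ 1 + δ * t := by
  have hQ' := isStarProjection_one_tensorMap (K := EllTwo) hQ
  refine ContinuousLinearMap.opNorm_le_of_unit_norm (by positivity) fun x hx => ?_
  refine le_trans ?_ (ht x hx.le)
  set Q' := tensorMap (1 : EllTwo →L[ℂ] EllTwo) Q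
  -- The two summands see only `P x` and `x - P x`, so their norms add up to the left side of the
  -- convexity estimate.
  have hval : ampliation EllTwo (conj Q T + t • (comp (compression Q) S - conj Q S)) x =
      compress Q' (ampliation EllTwo T (compress Q' x)) +
        (t : ℂ) • compress Q' (ampliation EllTwo S (x - compress Q' x)) := by
    rw [map_add, ampliation_real_smul, map_sub, ampliation_comp, ampliation_compression, add_apply,
      smul_apply, sub_apply, ContinuousLinearMap.comp_apply, ampliation_conj, ampliation_conj]
    congr 2
    rw [map_sub, map_sub]
  have hle : ∀ R : CB p H, ‖ampliation EllTwo R‖ ≤ 1 → ∀ y,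
      ‖compress Q' (ampliation EllTwo R y)‖ ≤ ‖y‖ := fun R hR y =>
    (norm_compress_le hQ' _).trans ((ContinuousLinearMap.le_opNorm _ _).trans
      (mul_le_of_le_one_left (norm_nonneg _) hR))
  rw [hval]
  refine (norm_add_le _ _).trans ?_
  rw [norm_smul, Complex.norm_real, Real.norm_of_nonneg ht0.le]
  gcongr
  · exact hle T hT _
  · exact hle S hS _

/-- A bounded functional is approximated in norm, on the finite rank operators, by its
compressions. -/
theorem exists_finProj_sub_conj_le (hp : 1 < p) {φ : CB p H →ₗ[ℝ] ℝ} {u : ℝ} (hu0 : 0 ≤ u)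
    (hu : ∀ T, φ T ≤ u * ‖ampliation EllTwo T‖) {ε : ℝ} (hε : 0 < ε) :
    ∃ s : Finset H, ∀ T ∈ finiteRank p H,
      φ (T - conj (finProj s) T) ≤ ε * ‖ampliation EllTwo T‖ := by
  -- The supremum is over finite rank contractions only: the near-maximizer must be a norm limit of
  -- its compressions, and the perturbed operators below stay of finite rank.
  set B : Set ℝ := φ '' {T | T ∈ finiteRank p H ∧ ‖ampliation EllTwo T‖ ≤ 1} with hB
  have hbdd : BddAbove B := ⟨u, by
    rintro _ ⟨T, ⟨_, hT⟩, rfl⟩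
    exact (hu T).trans (mul_le_of_le_one_right hu0 hT)⟩
  have hne : B.Nonempty := ⟨φ 0, 0, ⟨Submodule.zero_mem _, by simp⟩, rfl⟩
  set N := sSup B with hN
  have hball : ∀ T ∈ finiteRank p H, ‖ampliation EllTwo T‖ ≤ 1 → φ T ≤ N := fun T hT h =>
    le_csSup hbdd ⟨T, ⟨hT, h⟩, rfl⟩
  have hN0 : 0 ≤ N := by
    have := hball 0 (Submodule.zero_mem _) (by simp)
    rwa [map_zero] at this
  set δ := ε / (8 * (N + 1)) with hδ
  have hδ0 : 0 < δ := by positivity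
  have hNδ : N * δ ≤ ε / 8 := by
    rw [hδ, mul_div_assoc', div_le_div_iff₀ (by positivity) (by norm_num)]
    nlinarith
  obtain ⟨t₁, ht₁, hsm⟩ := exists_smooth (p := p) (H := HilbertTensor EllTwo H) hp hδ0
  obtain ⟨t₂, ht₂, hcv⟩ := exists_convex p (HilbertTensor EllTwo H) hδ0
  set η := ε * min t₁ t₂ / 16 with hη
  have hη0 : 0 < η := by have := lt_min ht₁ ht₂; positivity
  have hη₁ : η ≤ ε * t₁ / 16 := by rw [hη]; gcongr; exact min_le_left _ _
  have hη₂ : η ≤ ε * t₂ / 16 := by rw [hη]; gcongr; exact min_le_right _ _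
  obtain ⟨_, ⟨T₀, ⟨hT₀, hT₀1⟩, rfl⟩, hlt⟩ := exists_lt_of_lt_csSup hne
    (show N - η < sSup B by rw [← hN]; linarith)
  obtain ⟨s, hs⟩ := ((tendsto_norm_ampliation_sub_conj hp EllTwo hT₀).eventually
    (gt_mem_nhds (show 0 < η / (u + 1) by positivity))).exists
  have hQ := isStarProjection_finProj s
  -- One `η` is lost to near-maximality and one to compressing `T₀`.
  have hT : N - 2 * η ≤ φ (conj (finProj s) T₀) := by
    have h1 := hu (T₀ - conj (finProj s) T₀)
    rw [map_sub] at h1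
    have h2 : u * ‖ampliation EllTwo (T₀ - conj (finProj s) T₀)‖ ≤ η := by
      calc _ ≤ u * (η / (u + 1)) := by gcongr
        _ ≤ η := by
          rw [mul_div_assoc', div_le_iff₀ (by positivity)]
          nlinarith
    linarith
  have hTmem := conj_mem_finiteRank (finProj s) hT₀
  refine ⟨s, fun T hTf => ?_⟩
  -- It suffices to treat contractions; `2 * u` is the crude bound for `φ` on `R - P R P`.
  have key := le_mul_of_unit_ball (V := finiteRank p H) (N := ε)
    (φ := φ ∘ₗ (LinearMap.id - (conj (finProj s)).restrictScalars ℝ)) (u := 2 * u) (fun R => ?_)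
    (fun S hS hS1 => ?_) hTf
  · exact key
  · refine (hu _).trans ?_
    rw [mul_comm 2 u, mul_assoc]
    gcongr
    change ‖ampliation EllTwo (R - conj (finProj s) R)‖ ≤ _
    rw [map_sub]
    have h1 := norm_sub_le (ampliation EllTwo R) (ampliation EllTwo (conj (finProj s) R))
    have h2 := norm_ampliation_conj_le EllTwo hQ R
    linarith
  · have hQ' := isStarProjection_one_tensorMap (K := EllTwo) hQ
    have hcomp := comp_mem_finiteRank_right (compression (finProj s)) hS
    have h1 := norm_ampliation_add_left_le hQ ht₁ (hsm _ hQ') hδ0.le hT₀1 hS1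
    have h2 := norm_ampliation_add_right_le hQ ht₂ hδ0.le (hcv _ hQ') hT₀1 hS1
    have h3 := le_mul_of_unit_ball hu hball (T := conj (finProj s) T₀ +
      (t₁ / 2 : ℝ) • (S - comp (compression (finProj s)) S))
      (add_mem hTmem (real_smul_mem_finiteRank _ (sub_mem hS hcomp)))
    have h4 := le_mul_of_unit_ball hu hball (T := conj (finProj s) T₀ +
      t₂ • (comp (compression (finProj s)) S - conj (finProj s) S))
      (add_mem hTmem (real_smul_mem_finiteRank _ (sub_mem hcomp (conj_mem_finiteRank _ hS))))
    have h5 := h3.trans (mul_le_mul_of_nonneg_left h1 hN0)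
    have h6 := h4.trans (mul_le_mul_of_nonneg_left h2 hN0)
    rw [map_add, map_smul, smul_eq_mul] at h5 h6
    -- The perturbed operator has norm at most `1 + δ t₁`, so `φ` gains at most `N δ t₁ + 2 η ≤ ε t₁
    -- / 4` from the part leaving the compression. The next bound does the same for the part that
    -- does not see it.
    have h7 : t₁ / 2 * φ (S - comp (compression (finProj s)) S) ≤ t₁ / 2 * (ε / 2) := by
      have : N * δ * t₁ ≤ ε / 8 * t₁ := by gcongr
      linarith
    have h8 : t₂ * φ (comp (compression (finProj s)) S - conj (finProj s) S) ≤ t₂ * (ε / 2) := by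
      have : N * δ * t₂ ≤ ε / 8 * t₂ := by gcongr
      linarith
    have h9 := le_of_mul_le_mul_left h7 (by positivity)
    have h10 := le_of_mul_le_mul_left h8 ht₂
    change φ (S - conj (finProj s) S) ≤ ε
    have h11 : S - conj (finProj s) S = (S - comp (compression (finProj s)) S) +
        (comp (compression (finProj s)) S - conj (finProj s) S) := by abel
    rw [h11, map_add]
    linarith

end Functionals

/-! ### Testing compressed operators on a single null sequence -/

section Selection

open SchattenClass Filter CB

/-- The unit sphere of `U` is compact and covered by the open sets of operators exceeding `1 / 2` in
norm at some point of the ball; finitely many points suffice. -/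
theorem exists_norming_sequence {E F : Type*} [NormedAddCommGroup E] [NormedSpace ℂ E]
    [NormedAddCommGroup F] [NormedSpace ℂ F] (U : Submodule ℂ (E →L[ℂ] F)) [FiniteDimensional ℂ U] :
    ∃ x : ℕ → E, (∀ k, ‖x k‖ ≤ 2) ∧ (∃ m, ∀ k ≥ m, x k = 0) ∧
      ∀ S ∈ U, ∃ k, ‖S‖ ≤ ‖S (x k)‖ := by
  classical
  have : ProperSpace U := FiniteDimensional.proper ℂ U
  obtain ⟨t, ht⟩ := (isCompact_sphere (0 : U) 1).elim_finite_subcover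
    (fun x : {x : E // ‖x‖ ≤ 1} => {S : U | 1 / 2 < ‖(S : E →L[ℂ] F) x‖})
    (fun x => isOpen_lt continuous_const
      ((ContinuousLinearMap.apply ℂ F (x : E)).continuous.comp continuous_subtype_val).norm)
    (fun S hS => by
      rw [mem_sphere_zero_iff_norm] at hS
      obtain ⟨x, hx, hlt⟩ := (S : E →L[ℂ] F).exists_lt_apply_of_lt_opNorm (r := 1 / 2) (by
        have : ‖(S : E →L[ℂ] F)‖ = 1 := hS
        rw [this]; norm_num)
      exact Set.mem_iUnion.2 ⟨⟨x, hx.le⟩, hlt⟩)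
  -- Doubling the points compensates for the `1 / 2`. The default value `0` of `getD` makes the list
  -- an eventually zero sequence.
  set l : List E := t.toList.map (fun x : {x : E // ‖x‖ ≤ 1} => (2 : ℂ) • (x : E)) with hl
  have h2 : ‖(2 : ℂ)‖ = 2 := by norm_num
  have hmem : ∀ x ∈ t, ∃ k, l.getD k 0 = (2 : ℂ) • (x : E) := fun x hx => by
    obtain ⟨k, hk, hkx⟩ := List.getElem_of_mem (show (2 : ℂ) • (x : E) ∈ l from
      List.mem_map.2 ⟨x, Finset.mem_toList.2 hx, rfl⟩)
    exact ⟨k, by rw [List.getD_eq_getElem _ _ hk]; exact hkx⟩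
  refine ⟨fun k => l.getD k 0, fun k => ?_, ⟨l.length, fun k hk => List.getD_eq_default _ _ hk⟩,
    fun S hS => ?_⟩
  · rcases lt_or_ge k l.length with hk | hk
    · change ‖l.getD k 0‖ ≤ 2
      rw [List.getD_eq_getElem _ _ hk]
      obtain ⟨x, -, hx⟩ := List.mem_map.1 (List.getElem_mem hk)
      rw [← hx, norm_smul, h2]
      linarith [x.2]
    · change ‖l.getD k 0‖ ≤ 2
      rw [List.getD_eq_default _ _ hk, norm_zero]
      norm_num
  · rcases eq_or_ne S 0 with rfl | hS0
    · exact ⟨0, by simp⟩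
    have hpos := norm_pos_iff.2 hS0
    have hmemS : ((‖S‖⁻¹ : ℝ) : ℂ) • (⟨S, hS⟩ : U) ∈ Metric.sphere (0 : U) 1 := by
      rw [mem_sphere_zero_iff_norm]
      change ‖((‖S‖⁻¹ : ℝ) : ℂ) • S‖ = 1
      rw [norm_smul, Complex.norm_real, norm_inv, norm_norm]
      exact inv_mul_cancel₀ hpos.ne'
    obtain ⟨x, hx, hlt⟩ := Set.mem_iUnion₂.1 (ht hmemS)
    obtain ⟨k, hk⟩ := hmem x hx
    refine ⟨k, ?_⟩
    change _ ≤ ‖S (l.getD k 0)‖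
    rw [hk, map_smul, norm_smul, h2]
    have h3 : (1 : ℝ) / 2 < ‖S‖⁻¹ * ‖S x‖ := by
      have h4 : ‖((‖S‖⁻¹ : ℝ) : ℂ) • S x‖ = ‖S‖⁻¹ * ‖S x‖ := by
        rw [norm_smul, Complex.norm_real, norm_inv, norm_norm]
      rw [← h4]
      exact hlt
    rw [inv_mul_eq_div, lt_div_iff₀ hpos] at h3
    linarith

variable {p : ℝ} [Fact (1 ≤ p)] {H : Type*} [NormedAddCommGroup H] [InnerProductSpace ℂ H]
  [CompleteSpace H]

/-- A compressed operator is determined by its block `L → L`. -/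
theorem finiteDimensional_range_compress (L : Submodule ℂ H) [FiniteDimensional ℂ L] :
    FiniteDimensional ℂ (LinearMap.range
      (compress L.starProjection : SchattenClass p H →L[ℂ] SchattenClass p H).toLinearMap) := by
  let f : SchattenClass p H →ₗ[ℂ] (L →ₗ[ℂ] L) :=
    { toFun z := L.orthogonalProjectionOnto.toLinearMap ∘ₗ z.toOp.toLinearMap ∘ₗ L.subtype
      map_add' x y := by ext v; simp
      map_smul' c x := by ext v; simp }
  refine FiniteDimensional.of_injective (f.domRestrict _)
    ((injective_iff_map_eq_zero _).2 fun y hy => ?_)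
  obtain ⟨_, z, rfl⟩ := y
  have hz := compress_compress (isStarProjection_starProjection (U := L)) z
  refine Subtype.ext (toOp_injective ?_)
  change (compress L.starProjection z).toOp = _
  rw [← hz, toOp_compress]
  ext v
  have h1 := congrArg (fun g : L →ₗ[ℂ] L => (g (L.orthogonalProjectionOnto v) : H)) hy
  exact h1

theorem compression_mem_finiteRank (L : Submodule ℂ H) [FiniteDimensional ℂ L] :
    compression L.starProjection ∈ finiteRank p H :=
  finiteDimensional_range_compress L

/-- An operator `P T P` is determined by its block on the finite-dimensional range of `P`. -/
theorem finiteDimensional_range_conj (L : Submodule ℂ H) [FiniteDimensional ℂ L] :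
    FiniteDimensional ℂ (LinearMap.range (conj L.starProjection : CB p H →ₗ[ℂ] CB p H)) := by
  have := finiteDimensional_range_compress (p := p) L
  set P := (compress L.starProjection : SchattenClass p H →L[ℂ] SchattenClass p H) with hP
  let f : CB p H →ₗ[ℂ] (LinearMap.range P.toLinearMap →ₗ[ℂ] LinearMap.range P.toLinearMap) :=
    { toFun T := P.toLinearMap.rangeRestrict ∘ₗ
        (T : SchattenClass p H →L[ℂ] SchattenClass p H).toLinearMap ∘ₗ Submodule.subtype _
      map_add' x y := by ext v; simp
      map_smul' c x := by ext v; simp }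
  have hQ := isStarProjection_starProjection (U := L)
  refine FiniteDimensional.of_injective (f.domRestrict _)
    ((injective_iff_map_eq_zero _).2 fun y hy => ?_)
  obtain ⟨_, T, rfl⟩ := y
  refine Subtype.ext ?_
  change conj L.starProjection T = 0
  rw [← conj_conj hQ.isIdempotentElem.eq hQ.isIdempotentElem.eq]
  refine Subtype.ext ?_
  ext1 v
  exact congrArg (fun g : LinearMap.range P.toLinearMap →ₗ[ℂ] LinearMap.range P.toLinearMap =>
    (g (P.toLinearMap.rangeRestrict v) : SchattenClass p H)) hy

/-- The norm of `id ⊗ conj Q T` is controlled by the values of `id ⊗ T` on finitely many points. -/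
theorem exists_norm_ampliation_conj_le (s : Finset H) :
    ∃ x : ℕ → SchattenClass p (HilbertTensor EllTwo H), (∀ k, ‖x k‖ ≤ 2) ∧
      (∃ m, ∀ k ≥ m, x k = 0) ∧ ∀ T : CB p H, ∃ k,
        ‖ampliation EllTwo (conj (finProj s) T)‖ ≤ ‖ampliation EllTwo T (x k)‖ := by
  have : FiniteDimensional ℂ (LinearMap.range (conj (finProj s) : CB p H →ₗ[ℂ] CB p H)) :=
    finiteDimensional_range_conj _
  obtain ⟨x, hx2, ⟨m, hm⟩, hx⟩ := exists_norming_sequence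
    ((LinearMap.range (conj (finProj s) : CB p H →ₗ[ℂ] CB p H)).map (ampliation EllTwo))
  have hQ := isStarProjection_finProj s
  refine ⟨fun k => compress (tensorMap 1 (finProj s)) (x k), fun k =>
    (norm_compress_le (isStarProjection_one_tensorMap hQ) _).trans (hx2 k),
    ⟨m, fun k hk => by simp only [hm k hk, map_zero]⟩, fun T => ?_⟩
  obtain ⟨k, hk⟩ := hx (ampliation EllTwo (conj (finProj s) T)) ⟨_, ⟨T, rfl⟩, rfl⟩
  exact ⟨k, hk.trans (norm_ampliation_conj_apply_le EllTwo hQ T _)⟩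

/-- The `n`-th finite set of test points is scaled by `2⁻ⁿ`, and all are merged into one null
sequence. The scaling costs the factor `2 ^ n`. -/
theorem exists_nullSeq_norm_ampliation_conj_le (s : ℕ → Finset H) :
    ∃ x : NullSeq p H, ∀ n (T : CB p H),
      ‖ampliation EllTwo (conj (finProj (s n)) T)‖ ≤ 2 ^ n * stableSeminorm x T := by
  choose x hx2 hm hx using fun n => exists_norm_ampliation_conj_le (p := p) (s n)
  choose m hm using hm
  set y : ℕ → SchattenClass p (HilbertTensor EllTwo H) := fun i =>
    ((2 : ℂ)⁻¹ ^ (Nat.unpair i).1) • x (Nat.unpair i).1 (Nat.unpair i).2 with hy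
  have h2 : ‖(2 : ℂ)⁻¹‖ = 2⁻¹ := by norm_num
  have hy0 : Tendsto y atTop (𝓝 0) := by
    rw [Metric.tendsto_nhds]
    intro ε hε
    obtain ⟨N, hN⟩ := exists_pow_lt_of_lt_one (half_pos hε) (show (2 : ℝ)⁻¹ < 1 by norm_num)
    rw [← Nat.cofinite_eq_atTop]
    -- Only finitely many terms can have norm at least `ε`: blocks from `N` on are bounded by `2 ·
    -- 2⁻ᴺ`, and each earlier block has finitely many nonzero points.
    refine Set.Finite.subset ((Set.finite_Iio N).biUnion fun n _ => (Set.finite_Iio (m n)).image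
      (Nat.pair n)) fun i hi => ?_
    by_contra hcon
    apply hi
    change dist (y i) 0 < ε
    rw [dist_zero_right, hy, norm_smul, norm_pow, h2]
    rcases lt_or_ge (Nat.unpair i).1 N with h | h
    · rcases lt_or_ge (Nat.unpair i).2 (m (Nat.unpair i).1) with h' | h'
      · exact (hcon (Set.mem_iUnion₂.2
          ⟨_, Set.mem_Iio.2 h, _, Set.mem_Iio.2 h', Nat.pair_unpair i⟩)).elim
      · rw [hm _ _ h', norm_zero, mul_zero]
        exact hε
    · calc _ ≤ (2 : ℝ)⁻¹ ^ N * 2 := by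
            gcongr ?_ * ?_
            · exact pow_le_pow_of_le_one (by norm_num) (by norm_num) h
            · exact hx2 _ _
        _ < ε := by linarith
  refine ⟨⟨y, hy0⟩, fun n T => ?_⟩
  obtain ⟨k, hk⟩ := hx n T
  have h3 : ‖ampliation EllTwo T (y (Nat.pair n k))‖ ≤ stableSeminorm ⟨y, hy0⟩ T :=
    le_ciSup (bddAbove_stable ⟨y, hy0⟩ T) (Nat.pair n k)
  simp only [hy, Nat.unpair_pair, map_smul, norm_smul, norm_pow, h2] at h3
  rw [inv_pow, inv_mul_le_iff₀ (by positivity)] at h3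
  exact hk.trans h3

end Selection

/-! ### Stably continuous replacement of a norm bounded functional -/

section Extension

open SchattenClass Filter CB

variable {p : ℝ} [Fact (1 ≤ p)] {H : Type*} [NormedAddCommGroup H] [InnerProductSpace ℂ H]
  [CompleteSpace H]

theorem abs_le_of_le_norm {V : Submodule ℂ (CB p H)} {φ : CB p H →ₗ[ℝ] ℝ} {u : ℝ}
    (hu : ∀ T ∈ V, φ T ≤ u * ‖ampliation EllTwo T‖) {T : CB p H} (hT : T ∈ V) :
    |φ T| ≤ u * ‖ampliation EllTwo T‖ := by
  refine abs_le'.2 ⟨hu T hT, ?_⟩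
  have h := hu (-T) (neg_mem hT)
  rwa [map_neg, map_neg, norm_neg] at h

/-- A bounded functional on the finite rank operators extends to a stably continuous functional that
is bounded at the identity by the norm. -/
theorem exists_stable_extension (hp : 1 < p) {φ : CB p H →ₗ[ℝ] ℝ} {u : ℝ} (hu0 : 0 ≤ u)
    (hu : ∀ T, φ T ≤ u * ‖ampliation EllTwo T‖) :
    ∃ (g : CB p H →ₗ[ℝ] ℝ) (x : NullSeq p H) (C : ℝ), (∀ T, |g T| ≤ C * stableSeminorm x T) ∧
      (∀ T ∈ finiteRank p H, g T = φ T) ∧ g idCB ≤ u := by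
  classical
  -- The rate `4⁻ⁿ` beats the factor `2 ^ n` paid for a single null sequence and leaves `2⁻ⁿ`.
  choose s hs using fun n : ℕ => exists_finProj_sub_conj_le (H := H) hp hu0 hu
    (show (0 : ℝ) < (1 / 4) ^ n by positivity)
  have hs' : ∀ n, ∀ T ∈ finiteRank p H,
      |φ T - φ (conj (finProj (s n)) T)| ≤ (1 / 4) ^ n * ‖ampliation EllTwo T‖ := fun n T hT => by
    have := abs_le_of_le_norm (V := finiteRank p H)
      (φ := φ ∘ₗ (LinearMap.id - (conj (finProj (s n))).restrictScalars ℝ)) (hs n) hT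
    rw [← map_sub]
    exact this
  obtain ⟨x, hx⟩ := exists_nullSeq_norm_ampliation_conj_le (p := p) fun n => s n ∪ s (n + 1)
  let f : ℕ → CB p H →ₗ[ℝ] ℝ := fun n => φ ∘ₗ (conj (finProj (s n))).restrictScalars ℝ
  have hf : ∀ n T, f n T = φ (conj (finProj (s n)) T) := fun _ _ => rfl
  have hstep : ∀ T n, dist (f n T) (f (n + 1) T) ≤ (2 * stableSeminorm x T) * (1 / 2) ^ n := by
    intro T n
    -- The approximation is valid only on finite rank operators, and `T` is arbitrary. Compressing
    -- to the joint range first gives a finite rank `R` with the same `n`-th and `(n + 1)`-th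
    -- compressions as `T`.
    set R := conj (finProj (s n ∪ s (n + 1))) T with hR
    have hRf : R ∈ finiteRank p H := comp_mem_finiteRank_left (compression_mem_finiteRank _) _
    have h1 := hs' n R hRf
    have h2 := hs' (n + 1) R hRf
    rw [hR, conj_conj (finProj_mul_of_subset Finset.subset_union_left)
      (finProj_mul_of_subset' Finset.subset_union_left), ← hR] at h1
    rw [hR, conj_conj (finProj_mul_of_subset Finset.subset_union_right)
      (finProj_mul_of_subset' Finset.subset_union_right), ← hR] at h2
    have h3 : ((1 : ℝ) / 4) ^ (n + 1) * ‖ampliation EllTwo R‖ ≤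
        (1 / 4) ^ n * ‖ampliation EllTwo R‖ := by
      gcongr ?_ * _
      exact pow_le_pow_of_le_one (by norm_num) (by norm_num) n.le_succ
    have h4 : ((1 : ℝ) / 4) ^ n * ‖ampliation EllTwo R‖ ≤ (1 / 2) ^ n * stableSeminorm x T := by
      calc _ ≤ ((1 : ℝ) / 4) ^ n * (2 ^ n * stableSeminorm x T) := by gcongr; exact hx n T
        _ = _ := by rw [← mul_assoc, ← mul_pow]; norm_num
    rw [dist_comm, Real.dist_eq, hf, hf]
    have h5 := abs_sub_le (φ (conj (finProj (s (n + 1))) T)) (φ R) (φ (conj (finProj (s n)) T))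
    rw [abs_sub_comm _ (φ R)] at h5
    linarith
  choose g hg using fun T =>
    cauchySeq_tendsto_of_complete (cauchySeq_of_le_geometric _ _ one_half_lt_one (hstep T))
  -- In the constant, `u` bounds the zeroth functional and `4` is the sum of the increments `2 ·
  -- 2⁻ⁿ`.
  refine ⟨linearMapOfTendsto g f (tendsto_pi_nhds.2 hg), x, u + 4, fun T => ?_, fun T hT => ?_, ?_⟩
  · change |g T| ≤ _
    have h1 := dist_le_of_le_geometric_of_tendsto₀ _ _ one_half_lt_one (hstep T) (hg T)
    rw [dist_comm, Real.dist_eq] at h1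
    have h2 : |f 0 T| ≤ u * stableSeminorm x T := by
      refine (abs_le_of_le_norm (V := ⊤) (fun T _ => hu T) Submodule.mem_top).trans ?_
      gcongr
      have h3 := hx 0 T
      rw [pow_zero, one_mul] at h3
      refine le_trans ?_ h3
      have h4 := conj_conj (finProj_mul_of_subset (Finset.subset_union_left (s₂ := s 1)))
        (finProj_mul_of_subset' (Finset.subset_union_left (s₁ := s 0))) T
      change ‖ampliation EllTwo (conj (finProj (s 0)) T)‖ ≤ _
      rw [← h4]
      exact norm_ampliation_conj_le EllTwo (isStarProjection_finProj _) _
    have h3 := abs_sub_le (g T) (f 0 T) 0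
    rw [sub_zero, sub_zero] at h3
    linarith [show 2 * stableSeminorm x T / (1 - 1 / 2) = 4 * stableSeminorm x T by ring]
  · change g T = φ T
    refine tendsto_nhds_unique (hg T) (tendsto_iff_dist_tendsto_zero.2 ?_)
    refine squeeze_zero (fun _ => dist_nonneg) (fun n => ?_)
      (g := fun n => (1 / 4 : ℝ) ^ n * ‖ampliation EllTwo T‖) ?_
    · rw [dist_comm, Real.dist_eq]
      exact hs' n T hT
    · simpa using (tendsto_pow_atTop_nhds_zero_of_lt_one (r := (1 / 4 : ℝ)) (by norm_num)
        (by norm_num)).mul_const ‖ampliation EllTwo T‖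
  · change g idCB ≤ u
    -- Every compression of the identity is completely contractive, so each approximant is at most
    -- `u` there.
    refine le_of_tendsto (hg idCB) (Eventually.of_forall fun n => ?_)
    refine (hu _).trans (mul_le_of_le_one_right hu0 ?_)
    refine (norm_ampliation_conj_le EllTwo (isStarProjection_finProj _) _).trans ?_
    rw [ampliation_idCB]
    exact ContinuousLinearMap.norm_id_le

end Extension

end Schatten

/-! ### The separation argument -/

theorem theorem3p10 (p : ℝ) [Fact (1 ≤ p)] (hp : 1 < p)
    (H : Type*) [NormedAddCommGroup H] [InnerProductSpace ℂ H] [CompleteSpace H]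
    (F₀ : Submodule ℂ (Schatten.SchattenClass p H →L[ℂ] Schatten.SchattenClass p H))
    (hF₀ : ∀ T ∈ F₀, FiniteDimensional ℂ (LinearMap.range T.toLinearMap))
    (hid : (Schatten.idCB : Schatten.CB p H) ∈ closure[Schatten.stableTopology p H]
      {T : Schatten.CB p H |
        (T : Schatten.SchattenClass p H →L[ℂ] Schatten.SchattenClass p H) ∈ F₀}) :
    (Schatten.idCB : Schatten.CB p H) ∈ closure[Schatten.stableTopology p H]
      {T : Schatten.CB p H |
        (T : Schatten.SchattenClass p H →L[ℂ] Schatten.SchattenClass p H) ∈ F₀ ∧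
          Schatten.cbNorm T ≤ 1} := by
  let _ := Schatten.stableTopology p H
  have hws : WithSeminorms (fun x : Schatten.NullSeq p H => Schatten.stableSeminorm x) := ⟨rfl⟩
  have := hws.topologicalAddGroup
  have := hws.continuousSMul
  have hlc : LocallyConvexSpace ℝ (Schatten.CB p H) := hws.toLocallyConvexSpace
  have : ContinuousSMul ℝ (Schatten.CB p H) := IsScalarTower.continuousSMul ℂ
  let F : Submodule ℂ (Schatten.CB p H) := F₀.comap (Schatten.CB p H).subtype
  -- The ball is taken for the `ℓ²` ampliation norm, which dominates the cb norm; hence `C` lies in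
  -- the target set, and approximation from `C` is enough.
  let C : Set (Schatten.CB p H) := {T | T ∈ F ∧ ‖Schatten.ampliation Schatten.EllTwo T‖ ≤ 1}
  have hCconv : Convex ℝ C := by
    rintro S ⟨hS, hS1⟩ T ⟨hT, hT1⟩ a b ha hb hab
    refine ⟨?_, ?_⟩
    · rw [Schatten.CB.real_smul_eq, Schatten.CB.real_smul_eq]
      exact add_mem (F.smul_mem _ hS) (F.smul_mem _ hT)
    · rw [map_add]
      refine (norm_add_le _ _).trans ?_
      rw [Schatten.norm_ampliation_real_smul, Schatten.norm_ampliation_real_smul, abs_of_nonneg ha,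
        abs_of_nonneg hb]
      nlinarith
  have hCsub : C ⊆ {T : Schatten.CB p H |
      (T : Schatten.SchattenClass p H →L[ℂ] Schatten.SchattenClass p H) ∈ F₀ ∧
        Schatten.cbNorm T ≤ 1} := fun T hT =>
    ⟨hT.1, (Schatten.cbNorm_le_enorm_ampliation T).trans (by
      rw [← ofReal_norm]; exact ENNReal.ofReal_le_one.2 hT.2)⟩
  refine closure_mono hCsub ?_
  by_contra hcon
  obtain ⟨f, u, hfu, huid⟩ :=
    geometric_hahn_banach_closed_point hCconv.closure isClosed_closure hcon
  have hfC : ∀ T ∈ C, f T < u := fun T hT => hfu T (subset_closure hT)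
  have hu0 : 0 < u := by simpa using hfC 0 ⟨F.zero_mem, by simp⟩
  have hfF : ∀ T ∈ F, f T ≤ u * ‖Schatten.ampliation Schatten.EllTwo T‖ := fun T hT => by
    refine le_of_forall_pos_lt_add fun ε hε => ?_
    -- The added `ε / u` keeps the divisor positive when the ampliation norm of `T` is zero.
    set a := ‖Schatten.ampliation Schatten.EllTwo T‖ + ε / u with ha
    have ha0 : 0 < a := by positivity
    have h1 := hfC (a⁻¹ • T) ⟨by rw [Schatten.CB.real_smul_eq]; exact F.smul_mem _ hT, by
      rw [Schatten.norm_ampliation_real_smul, abs_of_pos (inv_pos.2 ha0), inv_mul_le_iff₀ ha0, ha,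
        mul_one]
      exact le_add_of_nonneg_right (by positivity)⟩
    rw [map_smul, smul_eq_mul, inv_mul_lt_iff₀ ha0] at h1
    calc f T < a * u := h1
      _ = _ := by rw [ha]; field_simp
  -- This extension forgets the stable continuity of `f` and keeps the norm bound on all of `CB`;
  -- `g` then restores continuity without changing the values on `F`.
  obtain ⟨φ, hφf, hφ⟩ := exists_extension_of_le_sublinear
    ⟨F.restrictScalars ℝ, f.toLinearMap ∘ₗ (F.restrictScalars ℝ).subtype⟩
    (fun T => u * ‖Schatten.ampliation Schatten.EllTwo T‖)
    (fun c hc T => by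
      rw [Schatten.norm_ampliation_real_smul, abs_of_pos hc]; ring)
    (fun S T => by
      rw [map_add, ← mul_add]
      gcongr
      exact norm_add_le _ _)
    (fun T => hfF T T.2)
  obtain ⟨g, x, M, hgM, hgφ, hgid⟩ := Schatten.exists_stable_extension hp hu0.le hφ
  have hgc : Continuous g := by
    refine continuous_of_continuousAt_zero g ?_
    rw [ContinuousAt, map_zero]
    refine squeeze_zero_norm (a := fun T => M * Schatten.stableSeminorm x T) (fun T => hgM T) ?_
    have := (hws.continuous_seminorm x).tendsto 0
    rw [map_zero] at this
    simpa using this.const_mul M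
  -- The only use of the hypothesis that the identity is in the closure of `F₀`: two stably
  -- continuous functionals that agree on `F` agree there.
  have hfg : f Schatten.idCB = g Schatten.idCB := by
    refine (isClosed_eq f.continuous hgc).closure_subset_iff.2 (fun T hT => ?_) hid
    change f T = g T
    rw [hgφ T (hF₀ _ hT)]
    exact (hφf ⟨T, hT⟩).symm
  linarith
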